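/- Let $k\ge 1$ be an integer and let $f:\mathbb{R}\to\mathbb{R}$ be a stationary centered Gaussian process whose trajectories are almost surely of class $\mathcal{C}^k$. Let $\kappa(x)=\mathbb{E}[f(0)f(x)]$ be its correlation function, and assume that $f$ is normalized, i.e. $\kappa(0)=1=-\kappa''(0)$. For $\eta\ge 0$ let $$\|\kappa\|_{k,\eta}=\sup\{|\kappa^{(l)}(x)| : 0\le l\le k,\ |x|\ge\eta\},$$ and assume that $\|\kappa\|_{k,\eta}\to 0$ as $\eta\to+\infty$. Write $\Delta_l=\{x\in\mathbb{R}^l : x_i=x_j \text{ for some } i\ne j\}$, let $Z=f^{-1}(0)$ and, for $1\le l\le k$ and $x\in\mathbb{R}^l\setminus\Delta_l$, let $$\rho_l(x)=\lim_{\varepsilon\to 0^+}\frac{1}{(2\varepsilon)^l}\,\mathbb{E}\Big[\prod_{i=1}^l \mathrm{card}\big(Z\cap[x_i-\varepsilon,x_i+\varepsilon]\big)\Big]$$ be the $l$-point function of $Z$. Then: 1. For all $1\le l\le k$ and all $x\in\mathbb{R}^l\setminus\Delta_l$, the limit defining $\rho_l(x)$ exists and is finite. 2. There exists $C>0$ such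 that for all $x=(x_i)_{1\le i\le k}\in\mathbb{R}^k\setminus\Delta_k$, $$0\le\rho_k(x)\le C\prod_{1\le i<j\le k}\min(|x_i-x_j|,1).$$ 3. There exists $C'>0$ such that for all $\eta\ge 1$, all partitions $\mathcal{I}$ of $\{1,\dots,k\}$ and all $x\in\mathbb{R}^k\setminus\Delta_k$ satisfying $|x_i-x_j|>\eta$ whenever $i$ and $j$ belong to different elements of $\mathcal{I}$, there is a real number $e$ with $$\prod_{I\in\mathcal{I}}\rho_{|I|}(\underline{x}_I)=\rho_k(x)\,(1+e),\qquad |e|\le C'\,\big(\|\kappa\|_{k,\eta}\big)^{1/2},$$ where $|I|$ is the cardinality of $I$ and $\underline{x}_I=(x_i)_{i\in I}$. -/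

import Mathlib

open MeasureTheory ProbabilityTheory Filter Topology Set
open scoped ENNReal

noncomputable section

/-- The correlation function `κ : x ↦ 𝔼[f(0) f(x)]` of a (centered stationary) process. -/
def correlationFunction {Ω : Type*} [MeasurableSpace Ω] (f : ℝ → Ω → ℝ) (P : Measure Ω) (x : ℝ) :
    ℝ :=
  ∫ ω, f 0 ω * f x ω ∂P

/-- `f` is a normalized stationary centered Gaussian process on `ℝ` of class `C^k`. -/
structure IsNormalizedStationaryGaussian {Ω : Type*} [MeasurableSpace Ω] (k : ℕ)
    (f : ℝ → Ω → ℝ) (P : Measure Ω) : Prop where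
  /-- All finite-dimensional marginals are (possibly degenerate) Gaussian vectors; in particular
  `P` is a probability measure. -/
  gaussian : IsGaussianProcess f P
  centered : ∀ t, ∫ ω, f t ω ∂P = 0
  /-- For every `s`, the process `t ↦ f (t + s)` has the same finite-dimensional distributions,
  that is, the same law, as `f`. -/
  stationary : ∀ (s : ℝ) (T : Finset ℝ),
    P.map (fun ω (t : T) => f (t + s) ω) = P.map (fun ω (t : T) => f t ω)
  /-- The trajectories are almost surely of class `C^k`. -/
  contDiff : ∀ᵐ ω ∂P, ContDiff ℝ k (fun t => f t ω)
  variance_eq : correlationFunction f P 0 = 1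
  deriv_variance_eq : iteratedDeriv 2 (correlationFunction f P) 0 = -1

/-- `‖g‖_{k,η} = sup { |g^(l)(x)| : 0 ≤ l ≤ k, |x| ≥ η }`, for a function `g` of class `C^k` which
is bounded together with its derivatives of order at most `k`. -/
def ckNorm (g : ℝ → ℝ) (k : ℕ) (η : ℝ) : ℝ :=
  sSup {r : ℝ | ∃ l ≤ k, ∃ x : ℝ, η ≤ |x| ∧ r = |iteratedDeriv l g x|}

/-- The random zero set `f⁻¹(0)`. -/
def zeroSet {Ω : Type*} (f : ℝ → Ω → ℝ) (ω : Ω) : Set ℝ := {t | f t ω = 0}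

/-- `(2ε)^{-l} 𝔼[∏ i, card (Z ∩ [x_i - ε, x_i + ε])]`, with values in `[0, ∞]`, for a random
subset `Z` of `ℝ`. -/
def smallBoxIntensity {Ω : Type*} [MeasurableSpace Ω] (P : Measure Ω) (Z : Ω → Set ℝ) {l : ℕ}
    (x : Fin l → ℝ) (ε : ℝ) : ℝ≥0∞ :=
  (∫⁻ ω, ∏ i, ((Z ω ∩ Icc (x i - ε) (x i + ε)).encard : ℝ≥0∞) ∂P) / ENNReal.ofReal ((2 * ε) ^ l)

/-- The `l`-point function of a random subset `Z` of `ℝ`: the limit of `smallBoxIntensity` as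
`ε → 0⁺`. It is meaningful at `x` when that limit exists and is finite, that is, when
`HasPointFunctionAt P Z x` holds. -/
def pointFunction {Ω : Type*} [MeasurableSpace Ω] (P : Measure Ω) (Z : Ω → Set ℝ) {l : ℕ}
    (x : Fin l → ℝ) : ℝ :=
  (limUnder (𝓝[>] 0) (smallBoxIntensity P Z x)).toReal

/-- The `l`-point function of `Z` is well-defined at `x`: the defining limit exists in `ℝ`. -/
def HasPointFunctionAt {Ω : Type*} [MeasurableSpace Ω] (P : Measure Ω) (Z : Ω → Set ℝ) {l : ℕ}
    (x : Fin l → ℝ) : Prop :=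
  ∃ r : ℝ≥0∞, r ≠ ∞ ∧ Tendsto (smallBoxIntensity P Z x) (𝓝[>] 0) (𝓝 r)

/-- The subfamily `(x_i)_{i ∈ I}`, listed in increasing order of the indices. -/
def subfamily {k : ℕ} (x : Fin k → ℝ) (I : Finset (Fin k)) : Fin I.card → ℝ :=
  fun a => x (I.orderEmbOfFin rfl a)

end

/-! The process is viewed as a curve `F` in the Hilbert space of square integrable variables, with
`⟪F s, F t⟫ = κ (s - t)`. Everything then rests on one quantitative fact: values of the curve at few
points are as independent as their spacing allows. By Kac–Rice, the `l`-point function at a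
configuration `s` is a power of `2π` times `(det Σ)^(-1/2) 𝔼 ∏ |Y_x|`. Here `Σ` is the covariance
matrix of the values at `s`, and `Y` is the Gaussian vector whose covariance is the Gram matrix of
the residuals of `F' x`, `x ∈ s`, after projection orthogonally to those values.

Regularity. A Gaussian family bounded almost surely has bounded second moments, and almost sure
convergence to zero of centered Gaussians implies convergence in `L²`. Hence `C^k` trajectories make
`F` differentiable and give the spectral measure of `κ` moments up to order `2k`. Since `κ` tends to
zero, this measure has no atoms, so jets at distinct points are linearly independent: a relation
would be an exponential polynomial vanishing almost everywhere.

Uniform nondegeneracy (`exists_duality_bound`). A compactness argument bounds `∑ a_i φ(x_i)` by `‖∑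
a_i F(x_i)‖` times a bound for the derivatives of `φ` near the points, uniformly in the
configuration. Along a degenerating sequence the points split into clusters escaping from each
other. In Newton coordinates the Gram matrix converges to a block matrix of jet covariances, which
is positive definite.

Repulsion (`exists_kacRiceDensity_bounds`). Testing this duality on products of sines, and bounding
divided differences of `F` from above, shows that the distance from `F y` to the span of the values
on `s` is comparable to `∏ min(|y - t|, 1)`. With `V` the truncated Vandermonde product, `det Σ` is
comparable to `V²` and so is the product of the norms of the derivative residuals; the density is
therefore comparable to `V² / V = V`.

Clustering (`exists_cluster`). Using duality in both variables, vectors attached to groups at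
distance more than `η` have a cosine of order `ε = ‖κ‖_{k,η}`. The determinant then factors up to a
relative error of order `ε`. The absolute moment, which is only shown to be `1/2`-Hölder in the
covariance, factors up to order `√ε`. When `ε` is not small the two-sided bounds suffice.

Kac–Rice (`tendsto_smallBoxIntensity`). Zeros are counted by sign changes on a grid. A sign change
on `[y - δ, y + δ]` says that the mean of the two values is smaller than `δ` times their slope in
absolute value, an event of computable Gaussian asymptotics, uniformly for `y` near `x`. -/

/-! ### Rolle's theorem and divided differences. -/

/-- Iterated Rolle theorem: a `C^n` function with `n + 1` ordered zeros has a zero of its `n`-th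
derivative between the extreme ones. -/
theorem exists_iteratedDeriv_eq_zero (n : ℕ) : ∀ (φ : ℝ → ℝ), ContDiff ℝ n φ →
    ∀ z : Fin (n + 1) → ℝ, StrictMono z → (∀ i, φ (z i) = 0) →
    ∃ ξ ∈ Icc (z 0) (z (Fin.last n)), iteratedDeriv n φ ξ = 0 := by
  induction n with
  | zero =>
    intro φ _ z _ h
    exact ⟨z 0, ⟨le_rfl, le_rfl⟩, by simpa using h 0⟩
  | succ n ih =>
    intro φ hφ z hz h
    have hd : ContDiff ℝ n (deriv φ) := by
      have : ContDiff ℝ ((n : WithTop ℕ∞) + 1) φ := by exact_mod_cast hφ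
      exact (contDiff_succ_iff_deriv.1 this).2.2
    have key : ∀ i : Fin (n + 1), ∃ c ∈ Ioo (z i.castSucc) (z i.succ), deriv φ c = 0 := fun i =>
      exists_deriv_eq_zero (hz i.castSucc_lt_succ) hφ.continuous.continuousOn (by rw [h, h])
    choose c hc hc0 using key
    have hmono : StrictMono c := by
      intro i j hij
      refine (hc i).2.trans_le (le_trans (hz.monotone ?_) (hc j).1.le)
      exact Fin.succ_le_castSucc_iff.2 hij
    obtain ⟨ξ, hξ, h0⟩ := ih (deriv φ) hd c hmono hc0
    refine ⟨ξ, ⟨?_, ?_⟩, by rw [iteratedDeriv_succ']; exact h0⟩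
    · exact le_trans (by simpa using (hc 0).1.le) hξ.1
    · exact hξ.2.trans (by simpa using (hc (Fin.last n)).2.le)

/-- Divided difference of `φ` at the nodes `v i`, `i ∈ s`. -/
noncomputable def dividedDifference {ι : Type*} [DecidableEq ι] (s : Finset ι) (v : ι → ℝ)
    (φ : ℝ → ℝ) : ℝ :=
  ∑ i ∈ s, (∏ j ∈ s.erase i, (v i - v j))⁻¹ * φ (v i)

/-- Mean value theorem for divided differences. -/
theorem exists_dividedDifference_eq {ι : Type*} [DecidableEq ι] (s : Finset ι) (hs : s.Nonempty)
    (v : ι → ℝ) (hv : InjOn v s) (φ : ℝ → ℝ) (hφ : ContDiff ℝ (s.card - 1 : ℕ) φ) :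
    ∃ i ∈ s, ∃ j ∈ s, ∃ ξ ∈ Icc (v i) (v j),
      dividedDifference s v φ = iteratedDeriv (s.card - 1) φ ξ / (s.card - 1).factorial := by
  classical
  set n := s.card - 1 with hn
  have hcard : s.card = n + 1 := by have := hs.card_pos; omega
  set p := Lagrange.interpolate s v (fun i => φ (v i)) with hp
  have hdeg : p.degree < s.card := Lagrange.degree_interpolate_lt _ hv
  have hpe : ∀ i ∈ s, p.eval (v i) = φ (v i) := fun i hi =>
    Lagrange.eval_interpolate_at_node _ hv hi
  have hcoeff : p.coeff n = dividedDifference s v φ := by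
    have := Lagrange.coeff_eq_sum hv hdeg
    rw [← hn] at this
    rw [this]
    refine Finset.sum_congr rfl fun i hi => ?_
    rw [hpe i hi, div_eq_inv_mul]
  have hT : (s.image v).card = n + 1 := by rw [Finset.card_image_of_injOn hv, hcard]
  let z : Fin (n + 1) → ℝ := fun i => (s.image v).orderEmbOfFin hT i
  have hz : ∀ i, ∃ a ∈ s, v a = z i := fun i => by
    exact Finset.mem_image.1 ((s.image v).orderEmbOfFin_mem hT i)
  -- Rolle is applied to the interpolation error: its `n`-th derivative is that of `φ` minus `n!`
  -- times the leading coefficient of `p`, which is the divided difference.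
  set ψ : ℝ → ℝ := fun t => φ t - p.eval t with hψ
  have hpc : ContDiff ℝ n (fun t => p.eval t) := by simpa using p.contDiff_aeval (𝕜 := ℝ) (n := n)
  have hψc : ContDiff ℝ n ψ := hφ.sub hpc
  obtain ⟨ξ, hξ, h0⟩ := exists_iteratedDeriv_eq_zero n ψ hψc z
    ((s.image v).orderEmbOfFin hT).strictMono (fun i => by
      obtain ⟨a, ha, hai⟩ := hz i
      simp [hψ, ← hai, hpe a ha])
  obtain ⟨i, hi, hi'⟩ := hz 0
  obtain ⟨j, hj, hj'⟩ := hz (Fin.last n)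
  refine ⟨i, hi, j, hj, ξ, by rw [hi', hj']; exact hξ, ?_⟩
  have hpd : iteratedDeriv n (fun t => p.eval t) ξ = n.factorial * p.coeff n := by
    have h1 : ∀ m : ℕ, iteratedDeriv m (fun t => p.eval t) =
        fun t => (Polynomial.derivative^[m] p).eval t := by
      intro m
      induction m with
      | zero => simp
      | succ m ihm =>
        rw [iteratedDeriv_succ, ihm]
        ext t
        rw [Polynomial.deriv, Function.iterate_succ_apply']
    rw [h1]
    have h2 : (Polynomial.derivative^[n] p).natDegree = 0 := by
      have : p.natDegree ≤ n := by
        rw [hcard] at hdeg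
        exact Polynomial.natDegree_le_of_degree_le (Order.le_of_lt_succ (by exact_mod_cast hdeg))
      have h3 := Polynomial.natDegree_iterate_derivative p n
      omega
    rw [Polynomial.eq_C_of_natDegree_eq_zero h2]
    simp [Polynomial.coeff_iterate_derivative, Nat.descFactorial_self]
  have : iteratedDeriv n ψ ξ = iteratedDeriv n φ ξ - iteratedDeriv n (fun t => p.eval t) ξ :=
    iteratedDeriv_fun_sub (hφ.contDiffAt) (hpc.contDiffAt)
  rw [this, hpd, hcoeff] at h0
  have hf : (n.factorial : ℝ) ≠ 0 := by exact_mod_cast n.factorial_ne_zero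
  rw [eq_div_iff hf]
  linarith

/-! ### Bochner's theorem by Fejér densities on lattices. -/

theorem integral_exp_int_mul (r : ℤ) :
    ∫ θ in (-Real.pi)..Real.pi, Complex.exp (r * θ * Complex.I) =
      if r = 0 then 2 * (Real.pi : ℂ) else 0 := by
  split_ifs with h
  · subst h
    simp
    ring
  · have hc : (r : ℂ) * Complex.I ≠ 0 := mul_ne_zero (by exact_mod_cast h) Complex.I_ne_zero
    have h1 := integral_exp_mul_complex (a := -Real.pi) (b := Real.pi) hc
    have h2 : ∀ θ : ℝ, Complex.exp (r * θ * Complex.I) = Complex.exp (r * Complex.I * θ) :=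
      fun θ => by ring_nf
    simp_rw [h2]
    rw [h1, div_eq_zero_iff]
    left
    rw [sub_eq_zero, Complex.exp_eq_exp_iff_exists_int]
    exact ⟨r, by push_cast; ring⟩

/-- Fejér-type density attached to the values of `κ` on the lattice `h ℤ`. -/
noncomputable def fejerDensity (κ : ℝ → ℝ) (h : ℝ) (N : ℕ) (θ : ℝ) : ℝ :=
  (2 * Real.pi * N)⁻¹ * ∑ m ∈ Finset.range N, ∑ n ∈ Finset.range N,
    κ (m * h - n * h) * Real.cos ((m - n) * θ)

/-- Positive semidefinite functions on the real line, tested on finite sequences. -/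
def IsPosSemidefFun (κ : ℝ → ℝ) : Prop :=
  ∀ (N : ℕ) (x a : ℕ → ℝ),
    0 ≤ ∑ m ∈ Finset.range N, ∑ n ∈ Finset.range N, a m * a n * κ (x m - x n)

theorem fejerDensity_nonneg {κ : ℝ → ℝ} (hκ : IsPosSemidefFun κ) (h : ℝ) (N : ℕ) (θ : ℝ) :
    0 ≤ fejerDensity κ h N θ := by
  have h1 := hκ N (fun m => m * h) (fun m => Real.cos (m * θ))
  have h2 := hκ N (fun m => m * h) (fun m => Real.sin (m * θ))
  have h3 : ∑ m ∈ Finset.range N, ∑ n ∈ Finset.range N,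
      κ (m * h - n * h) * Real.cos ((m - n) * θ) =
      ∑ m ∈ Finset.range N, ∑ n ∈ Finset.range N,
        Real.cos (m * θ) * Real.cos (n * θ) * κ (m * h - n * h) +
      ∑ m ∈ Finset.range N, ∑ n ∈ Finset.range N,
        Real.sin (m * θ) * Real.sin (n * θ) * κ (m * h - n * h) := by
    rw [← Finset.sum_add_distrib]
    refine Finset.sum_congr rfl fun m _ => ?_
    rw [← Finset.sum_add_distrib]
    refine Finset.sum_congr rfl fun n _ => ?_
    rw [sub_mul, Real.cos_sub]
    ring
  rw [fejerDensity, h3]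
  exact mul_nonneg (by positivity) (add_nonneg h1 h2)

theorem continuous_fejerDensity (κ : ℝ → ℝ) (h : ℝ) (N : ℕ) :
    Continuous (fejerDensity κ h N) := by
  unfold fejerDensity
  fun_prop

theorem sum_range_ite_eq_add (N j : ℕ) (c : ℂ) :
    ∑ m ∈ Finset.range N, ∑ n ∈ Finset.range N, (if m = n + j then c else 0) =
      ((N - j : ℕ) : ℂ) * c := by
  rw [Finset.sum_comm]
  have : ∀ n ∈ Finset.range N, (∑ m ∈ Finset.range N, if m = n + j then c else 0) =
      if n < N - j then c else 0 := by
    intro n _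
    rw [Finset.sum_ite_eq']
    simp only [Finset.mem_range]
    congr 1
    rw [eq_iff_iff]
    omega
  rw [Finset.sum_congr rfl this, ← Finset.sum_filter]
  have h2 : (Finset.range N).filter (fun n => n < N - j) = Finset.range (N - j) := by
    ext n; simp; omega
  rw [h2]
  simp

/-- By orthogonality only the diagonals `m - n = ±j` survive, each with `N - j` terms. The
subtraction of naturals gives the correct value zero when `j ≥ N`. -/
theorem integral_fejerDensity {κ : ℝ → ℝ} (heven : ∀ t, κ (-t) = κ t) (h : ℝ) {N : ℕ}
    (hN : 0 < N) (j : ℕ) :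
    ∫ θ in (-Real.pi)..Real.pi, (fejerDensity κ h N θ : ℂ) * Complex.exp (j * θ * Complex.I) =
      ((N - j : ℕ) : ℂ) / N * κ (j * h) := by
  have hint : ∀ g : ℝ → ℂ, Continuous g → IntervalIntegrable g volume (-Real.pi) Real.pi :=
    fun g hg => hg.intervalIntegrable _ _
  have e1 : ∀ θ : ℝ, (fejerDensity κ h N θ : ℂ) * Complex.exp (j * θ * Complex.I) =
      ∑ m ∈ Finset.range N, ∑ n ∈ Finset.range N,
        ((2 * Real.pi * N)⁻¹ * κ (m * h - n * h) / 2 : ℂ) *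
        (Complex.exp (((m - n + j : ℤ) : ℂ) * θ * Complex.I) +
          Complex.exp (((n - m + j : ℤ) : ℂ) * θ * Complex.I)) := by
    intro θ
    rw [fejerDensity]
    push_cast
    rw [Finset.mul_sum, Finset.sum_mul]
    refine Finset.sum_congr rfl fun m _ => ?_
    rw [Finset.mul_sum, Finset.sum_mul]
    refine Finset.sum_congr rfl fun n _ => ?_
    rw [Complex.cos]
    have e2 : Complex.exp (((m : ℂ) - n + j) * θ * Complex.I) =
        Complex.exp ((m - n) * θ * Complex.I) * Complex.exp (j * θ * Complex.I) := by
      rw [← Complex.exp_add]; ring_nf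
    have e3 : Complex.exp (((n : ℂ) - m + j) * θ * Complex.I) =
        Complex.exp (-((m - n) * θ) * Complex.I) * Complex.exp (j * θ * Complex.I) := by
      rw [← Complex.exp_add]; ring_nf
    rw [e2, e3]
    ring
  simp_rw [e1]
  rw [intervalIntegral.integral_finsetSum fun m _ => hint _ (by fun_prop)]
  have e4 : ∀ m ∈ Finset.range N, ∫ θ in (-Real.pi)..Real.pi, ∑ n ∈ Finset.range N,
        ((2 * Real.pi * N)⁻¹ * κ (m * h - n * h) / 2 : ℂ) *
        (Complex.exp (((m - n + j : ℤ) : ℂ) * θ * Complex.I) +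
          Complex.exp (((n - m + j : ℤ) : ℂ) * θ * Complex.I)) =
      ∑ n ∈ Finset.range N, ((if n = m + j then (2 * N : ℂ)⁻¹ * κ (j * h) else 0) +
        (if m = n + j then (2 * N : ℂ)⁻¹ * κ (j * h) else 0)) := by
    intro m _
    rw [intervalIntegral.integral_finsetSum fun m _ => hint _ (by fun_prop)]
    refine Finset.sum_congr rfl fun n _ => ?_
    rw [intervalIntegral.integral_const_mul,
      intervalIntegral.integral_add (hint _ (by fun_prop)) (hint _ (by fun_prop)),
      integral_exp_int_mul, integral_exp_int_mul]
    have c1 : ((m : ℤ) - n + j = 0) ↔ n = m + j := by omega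
    have c2 : ((n : ℤ) - m + j = 0) ↔ m = n + j := by omega
    simp only [c1, c2]
    have hπ : (Real.pi : ℂ) ≠ 0 := by exact_mod_cast Real.pi_ne_zero
    have hN' : (N : ℂ) ≠ 0 := by exact_mod_cast hN.ne'
    rw [mul_add]
    congr 1
    · split_ifs with hc
      · have : κ (m * h - n * h) = κ (j * h) := by
          rw [← heven]; congr 1; rw [hc]; push_cast; ring
        rw [this]
        push_cast
        field_simp
      · simp
    · split_ifs with hc
      · have : κ (m * h - n * h) = κ (j * h) := by
          congr 1; rw [hc]; push_cast; ring
        rw [this]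
        push_cast
        field_simp
      · simp
  rw [Finset.sum_congr rfl e4]
  simp_rw [Finset.sum_add_distrib]
  rw [sum_range_ite_eq_add, Finset.sum_comm, sum_range_ite_eq_add]
  have hN' : (N : ℂ) ≠ 0 := by exact_mod_cast hN.ne'
  field_simp
  ring

/-- Lattice approximation of the spectral measure. -/
theorem exists_lattice_measure {κ : ℝ → ℝ} (hκ : IsPosSemidefFun κ) (heven : ∀ t, κ (-t) = κ t)
    (h0 : κ 0 = 1) {C : ℝ} (hC : ∀ t, 1 - κ t ≤ C * t ^ 2) {h : ℝ} (hh : 0 < h) {N : ℕ}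
    (hN : 0 < N) :
    ∃ μ : ProbabilityMeasure ℝ,
      (∀ j : ℕ, charFun (μ : Measure ℝ) (j * h) = ((N - j : ℕ) : ℂ) / N * κ (j * h)) ∧
      ∀ r : ℝ, 0 < r → (μ : Measure ℝ) {x | r < ‖x‖} ≤
        ENNReal.ofReal (Real.pi ^ 2 / 2 * (C + |κ h| / (N * h ^ 2)) / r ^ 2) := by
  set p := fejerDensity κ h N with hp
  have hpc : Continuous p := continuous_fejerDensity κ h N
  have hp0 : ∀ θ, 0 ≤ p θ := fejerDensity_nonneg hκ h N
  have hN' : (N : ℂ) ≠ 0 := by exact_mod_cast hN.ne'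
  have hle : -Real.pi ≤ Real.pi := by linarith [Real.pi_pos]
  -- The spectral measure of the sequence `κ (j h)` smoothed by Fejér weights lives on the circle;
  -- dividing the angle by `h` places it on the line.
  set ν : Measure ℝ := (volume.restrict (Ioc (-Real.pi) Real.pi)).withDensity
    (fun θ => ENNReal.ofReal (p θ)) with hν
  have hint : ∀ g : ℝ → ℂ, ∫ θ, g θ ∂ν = ∫ θ in (-Real.pi)..Real.pi, (p θ : ℂ) * g θ := by
    intro g
    rw [hν, integral_withDensity_eq_integral_toReal_smul (by fun_prop) (by simp),
      intervalIntegral.integral_of_le hle]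
    simp [ENNReal.toReal_ofReal (hp0 _)]
  have hpi : Integrable p (volume.restrict (Ioc (-Real.pi) Real.pi)) :=
    (hpc.integrableOn_Icc (μ := volume)).mono_set Ioc_subset_Icc_self
  have hfin : IsFiniteMeasure ν := isFiniteMeasure_withDensity_ofReal hpi.2
  have hj : ∀ j : ℕ, ∫ θ, Complex.exp (j * θ * Complex.I) ∂ν =
      ((N - j : ℕ) : ℂ) / N * κ (j * h) := fun j => by
    rw [hint, integral_fejerDensity heven h hN j]
  have hprob : IsProbabilityMeasure ν := by
    have := hj 0
    simp [h0, hN'] at this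
    exact ⟨by rw [← ENNReal.toReal_eq_one_iff, ← measureReal_def]; exact_mod_cast this⟩
  have hm : Measurable fun θ : ℝ => θ / h := by fun_prop
  refine ⟨⟨ν.map (fun θ => θ / h), Measure.isProbabilityMeasure_map hm.aemeasurable⟩, ?_, ?_⟩
  · intro j
    rw [ProbabilityMeasure.coe_mk, charFun_apply_real, integral_map hm.aemeasurable
      (by fun_prop), ← hj j]
    refine integral_congr_ae (Eventually.of_forall fun θ => ?_)
    have : (h : ℂ) ≠ 0 := by exact_mod_cast hh.ne'
    simp only
    congr 1
    push_cast
    field_simp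
  · intro r hr
    rw [ProbabilityMeasure.coe_mk, Measure.map_apply hm (measurableSet_lt (by fun_prop) (by fun_prop))]
    -- Tightness comes from the mean of `1 - cos θ`, controlled by `1 - κ h`, and from `1 - cos θ ≥
    -- 2 θ² / π²` on the circle, whence the factor `π² / 2`.
    have hcos : ∫ θ, (1 - Real.cos θ) ∂ν ≤ h ^ 2 * (C + |κ h| / (N * h ^ 2)) := by
      have i1 : Integrable (fun θ : ℝ => Complex.exp ((1 : ℕ) * θ * Complex.I)) ν := by
        refine Integrable.of_bound (by fun_prop) 1 (Eventually.of_forall fun θ => ?_)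
        have : ((1 : ℕ) * θ * Complex.I : ℂ) = ((θ : ℝ) : ℂ) * Complex.I := by push_cast; ring
        rw [this, Complex.norm_exp_ofReal_mul_I]
      have e1 : ∫ θ, Real.cos θ ∂ν = ((N - 1 : ℕ) : ℝ) / N * κ h := by
        have := congrArg Complex.re (hj 1)
        rw [← RCLike.re_eq_complex_re, ← integral_re i1] at this
        have e2 : ∀ θ : ℝ, (RCLike.re (Complex.exp ((1 : ℕ) * θ * Complex.I)) : ℝ) =
            Real.cos θ := fun θ => by
          have : ((1 : ℕ) * θ * Complex.I : ℂ) = ((θ : ℝ) : ℂ) * Complex.I := by push_cast; ring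
          rw [this]
          simp [Complex.exp_ofReal_mul_I_re]
        simp_rw [e2] at this
        rw [this, RCLike.re_eq_complex_re]
        have : ((N - 1 : ℕ) : ℂ) / N * κ ((1 : ℕ) * h) =
            ((((N - 1 : ℕ) : ℝ) / N * κ h : ℝ) : ℂ) := by push_cast; simp
        rw [this, Complex.ofReal_re]
      have i2 : Integrable (fun θ : ℝ => Real.cos θ) ν :=
        Integrable.of_bound (by fun_prop) 1 (Eventually.of_forall fun θ => Real.abs_cos_le_one θ)
      rw [integral_sub (integrable_const _) i2, e1]
      simp only [integral_const, probReal_univ, smul_eq_mul, mul_one]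
      have hN1 : (1 : ℝ) ≤ N := by exact_mod_cast hN
      rw [Nat.cast_sub hN]
      have e3 : ((N : ℝ) - (1 : ℕ)) / N * κ h = κ h - κ h / N := by field_simp; push_cast; ring
      have e4 : h ^ 2 * (C + |κ h| / (N * h ^ 2)) = C * h ^ 2 + |κ h| / N := by field_simp
      rw [e3, e4]
      have : κ h / N ≤ |κ h| / N := by gcongr; exact le_abs_self _
      linarith [hC h]
    have hsub : ∀ᵐ θ ∂ν, θ ∈ Ioc (-Real.pi) Real.pi :=
      (withDensity_absolutelyContinuous _ _).ae_le (ae_restrict_mem measurableSet_Ioc)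
    have hbound : ν {θ | 2 / Real.pi ^ 2 * (r * h) ^ 2 ≤ 1 - Real.cos θ} ≤
        ENNReal.ofReal (Real.pi ^ 2 / 2 * (C + |κ h| / (N * h ^ 2)) / r ^ 2) := by
      have i3 : Integrable (fun θ : ℝ => 1 - Real.cos θ) ν :=
        (integrable_const _).sub (Integrable.of_bound (by fun_prop) 1
          (Eventually.of_forall fun θ => Real.abs_cos_le_one θ))
      have hmk := mul_meas_ge_le_integral_of_nonneg
        (Eventually.of_forall fun θ => by simp [Real.cos_le_one θ]) i3
        (2 / Real.pi ^ 2 * (r * h) ^ 2)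
      rw [← ENNReal.ofReal_toReal (measure_ne_top ν _)]
      apply ENNReal.ofReal_le_ofReal
      rw [← measureReal_def]
      have hπ := Real.pi_pos
      have hpos : 0 < 2 / Real.pi ^ 2 * (r * h) ^ 2 := by positivity
      have := (le_div_iff₀' hpos).2 (hmk.trans hcos)
      refine this.trans_eq ?_
      field_simp
    refine le_trans ?_ hbound
    refine measure_mono_ae ?_
    filter_upwards [hsub] with θ hθ hr'
    have hr'' : r < |θ / h| := hr'
    rw [abs_div, abs_of_pos hh, lt_div_iff₀ hh] at hr''
    have h1 : |θ| ≤ Real.pi := abs_le.2 ⟨hθ.1.le, hθ.2⟩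
    have h2 := Real.cos_le_one_sub_mul_cos_sq h1
    show 2 / Real.pi ^ 2 * (r * h) ^ 2 ≤ 1 - Real.cos θ
    have h3 : (r * h) ^ 2 ≤ θ ^ 2 := by
      rw [← sq_abs θ]; gcongr
    have h4 : 2 / Real.pi ^ 2 * (r * h) ^ 2 ≤ 2 / Real.pi ^ 2 * θ ^ 2 := by gcongr
    linarith

/-- Bochner's theorem, for functions with a quadratic bound at the origin. -/
theorem exists_spectral_measure {κ : ℝ → ℝ} (hκ : IsPosSemidefFun κ) (hcont : Continuous κ)
    (heven : ∀ t, κ (-t) = κ t) (h0 : κ 0 = 1) {C : ℝ} (hC : ∀ t, 1 - κ t ≤ C * t ^ 2)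
    (hle : ∀ t, |κ t| ≤ 1) :
    ∃ μ : ProbabilityMeasure ℝ, ∀ t, charFun (μ : Measure ℝ) t = κ t := by
  -- With `h = 2^(-p)` and `N = 4^p` one has `N h² = 1`, which keeps the tail bound uniform, and `N
  -- h → ∞`, which makes the Fejér weights tend to `1` at dyadic points.
  choose μ hμ hμt using fun p : ℕ => exists_lattice_measure hκ heven h0 hC
    (h := (2 ^ p)⁻¹) (by positivity) (N := 4 ^ p) (by positivity)
  have htight : IsTightMeasureSet {x | ∃ m ∈ range μ, ((m : ProbabilityMeasure ℝ) : Measure ℝ) = x} := by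
    refine isTightMeasureSet_of_tendsto_measure_norm_gt ?_
    have hlim : Tendsto (fun r : ℝ => ENNReal.ofReal (Real.pi ^ 2 / 2 * (C + 1) / r ^ 2)) atTop
        (𝓝 0) := by
      rw [← ENNReal.ofReal_zero]
      exact ENNReal.tendsto_ofReal
        (tendsto_const_nhds.div_atTop (tendsto_pow_atTop two_ne_zero))
    refine tendsto_of_tendsto_of_tendsto_of_le_of_le' tendsto_const_nhds hlim
      (Eventually.of_forall fun _ => zero_le) ?_
    filter_upwards [eventually_gt_atTop 0] with r hr
    refine iSup₂_le ?_
    rintro _ ⟨_, ⟨p, rfl⟩, rfl⟩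
    refine (hμt p r hr).trans (ENNReal.ofReal_le_ofReal ?_)
    have h4 : ((4 ^ p : ℕ) : ℝ) * ((2 ^ p)⁻¹) ^ 2 = 1 := by
      push_cast
      rw [inv_pow, ← pow_mul, mul_comm p 2, pow_mul]
      norm_num
    rw [h4, div_one]
    gcongr
    exact hle _
  have hcomp := isCompact_closure_of_isTightMeasureSet htight
  -- A limit along a nonprincipal ultrafilter plays the role of a convergent subsequence.
  set 𝒰 : Ultrafilter ℕ := hyperfilter ℕ
  obtain ⟨ν, -, hν⟩ := hcomp.ultrafilter_le_nhds (𝒰.map μ) (by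
    rw [le_principal_iff]
    exact mem_of_superset (Eventually.of_forall (f := (𝒰 : Filter ℕ))
      fun p => subset_closure (mem_range_self p)) (fun _ h => h))
  have hν' : Tendsto μ 𝒰 (𝓝 ν) := hν
  have hchar : ∀ t, Tendsto (fun p => charFun (μ p : Measure ℝ) t) 𝒰
      (𝓝 (charFun (ν : Measure ℝ) t)) := by
    intro t
    simp_rw [charFun_eq_integral_innerProbChar]
    exact (ProbabilityMeasure.tendsto_iff_forall_integral_rclike_tendsto ℂ).1 hν' _
  refine ⟨ν, ?_⟩
  have hdy : ∀ j q : ℕ, charFun (ν : Measure ℝ) (j / 2 ^ q) = κ (j / 2 ^ q) := by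
    intro j q
    have hpow : Tendsto (fun p : ℕ => ((j * 2 ^ (p - q) : ℕ) : ℂ) / ((4 ^ p : ℕ) : ℂ)) atTop
        (𝓝 0) := by
      have h1 : Tendsto (fun p : ℕ => (j : ℝ) * (1 / 2) ^ p) atTop (𝓝 0) := by
        simpa using (tendsto_pow_atTop_nhds_zero_of_lt_one (r := (1 / 2 : ℝ)) (by norm_num)
          (by norm_num)).const_mul (j : ℝ)
      refine squeeze_zero_norm (fun p => ?_) h1
      rw [norm_div, Complex.norm_natCast, Complex.norm_natCast]
      push_cast
      rw [div_le_iff₀ (by positivity), mul_assoc, ← mul_pow]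
      norm_num
      gcongr
      · norm_num
      · omega
    have hlim : Tendsto (fun p : ℕ => ((4 ^ p - j * 2 ^ (p - q) : ℕ) : ℂ) / ((4 ^ p : ℕ) : ℂ) *
        κ (j / 2 ^ q)) atTop (𝓝 (κ (j / 2 ^ q))) := by
      have h2 : Tendsto (fun p : ℕ => (1 - ((j * 2 ^ (p - q) : ℕ) : ℂ) / ((4 ^ p : ℕ) : ℂ)) *
        κ (j / 2 ^ q)) atTop (𝓝 ((1 - 0) * κ (j / 2 ^ q))) :=
          (tendsto_const_nhds.sub hpow).mul tendsto_const_nhds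
      rw [sub_zero, one_mul] at h2
      refine h2.congr' ?_
      filter_upwards [eventually_ge_atTop j] with p hp
      have : j * 2 ^ (p - q) ≤ 4 ^ p := by
        calc j * 2 ^ (p - q) ≤ 2 ^ p * 2 ^ p :=
              Nat.mul_le_mul (hp.trans Nat.lt_two_pow_self.le)
                (Nat.pow_le_pow_right (by norm_num) (by omega))
          _ = 4 ^ p := by rw [← mul_pow]; norm_num
      rw [Nat.cast_sub this, sub_div, div_self (by simp)]
    refine tendsto_nhds_unique (hchar (j / 2 ^ q)) ?_
    refine (hlim.congr' ?_).mono_left (Nat.hyperfilter_le_atTop)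
    filter_upwards [eventually_ge_atTop q] with p hp
    have h3 : (j : ℝ) / 2 ^ q = ((j * 2 ^ (p - q) : ℕ) : ℝ) * (2 ^ p)⁻¹ := by
      push_cast
      rw [pow_sub₀ _ two_ne_zero hp]
      field_simp
    have := hμ p (j * 2 ^ (p - q))
    rw [← h3] at this
    exact this.symm
  have hnonneg : ∀ t : ℝ, 0 ≤ t → charFun (ν : Measure ℝ) t = κ t := by
    intro t ht
    have hcl : Tendsto (fun q : ℕ => (⌊t * 2 ^ q⌋₊ : ℝ) / 2 ^ q) atTop (𝓝 t) :=
      (tendsto_nat_floor_mul_div_atTop ht).comp (tendsto_pow_atTop_atTop_of_one_lt one_lt_two)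
    have hc1 : Continuous (charFun (ν : Measure ℝ)) := continuous_charFun
    have l1 := (hc1.tendsto t).comp hcl
    have l2 := ((Complex.continuous_ofReal.comp hcont).tendsto t).comp hcl
    exact tendsto_nhds_unique l1 (l2.congr fun q => (hdy _ q).symm)
  intro t
  rcases le_total 0 t with ht | ht
  · exact hnonneg t ht
  · have := hnonneg (-t) (by linarith)
    rw [charFun_neg, heven] at this
    have h2 := congrArg (starRingEnd ℂ) this
    simpa using h2

/-! ### From properties of trajectories to second moments. -/

theorem gaussianReal_Icc_le {v : NNReal} (hv : v ≠ 0) {c : ℝ} :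
    gaussianReal 0 v (Icc (-c) c) ≤ ENNReal.ofReal (2 * c / √(2 * Real.pi * v)) := by
  rw [gaussianReal_apply 0 hv]
  calc ∫⁻ x in Icc (-c) c, gaussianPDF 0 v x
      ≤ ∫⁻ _ in Icc (-c) c, ENNReal.ofReal ((√(2 * Real.pi * v))⁻¹) := by
        refine lintegral_mono fun x => ENNReal.ofReal_le_ofReal ?_
        rw [gaussianPDFReal]
        refine mul_le_of_le_one_right (by positivity) (Real.exp_le_one_iff.2 ?_)
        rw [neg_div]
        exact neg_nonpos.2 (by positivity)
    _ = ENNReal.ofReal (2 * c / √(2 * Real.pi * v)) := by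
        rw [lintegral_const, Measure.restrict_apply MeasurableSet.univ, univ_inter,
          Real.volume_Icc, ← ENNReal.ofReal_mul (by positivity)]
        congr 1
        ring

section gaussian

variable {Ω : Type*} [MeasurableSpace Ω] {P : Measure Ω}

theorem integral_sq_eq_variance {X : Ω → ℝ} (hX : HasGaussianLaw X P)
    (h0 : ∫ ω, X ω ∂P = 0) : ∫ ω, X ω ^ 2 ∂P = Var[X; P] := by
  have := hX.isProbabilityMeasure
  rw [variance_of_integral_eq_zero hX.aemeasurable h0]

/-- A centered Gaussian variable that lies in `[-c, c]` with probability at least `1/2` has second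
moment at most `(2c)^2`. -/
theorem integral_sq_le_of_half_le {X : Ω → ℝ} (hX : HasGaussianLaw X P) (h0 : ∫ ω, X ω ∂P = 0)
    {c : ℝ} (hc : 0 ≤ c) (h : 1 / 2 ≤ P {ω | |X ω| ≤ c}) : ∫ ω, X ω ^ 2 ∂P ≤ (2 * c) ^ 2 := by
  rw [integral_sq_eq_variance hX h0]
  by_cases hv : Var[X; P] = 0
  · rw [hv]; positivity
  have hmap := hX.map_eq_gaussianReal
  rw [h0] at hmap
  set v := Var[X; P].toNNReal with hvdef
  have hvpos : 0 < Var[X; P] := lt_of_le_of_ne (variance_nonneg _ _) (Ne.symm hv)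
  have hv0 : v ≠ 0 := by
    rw [hvdef, Ne, Real.toNNReal_eq_zero, not_le]; exact hvpos
  have h1 : P {ω | |X ω| ≤ c} = gaussianReal 0 v (Icc (-c) c) := by
    rw [← hmap, Measure.map_apply_of_aemeasurable hX.aemeasurable measurableSet_Icc]
    congr 1
    ext ω
    simp [abs_le]
  rw [h1] at h
  have h2 := h.trans (gaussianReal_Icc_le hv0)
  have h3 : (1 / 2 : ℝ) ≤ 2 * c / √(2 * Real.pi * v) := by
    rw [← ENNReal.ofReal_le_ofReal_iff (by positivity)]
    refine le_trans (le_of_eq ?_) h2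
    rw [ENNReal.ofReal_div_of_pos (by norm_num)]
    simp
  have hvv : (v : ℝ) = Var[X; P] := Real.coe_toNNReal _ hvpos.le
  rw [hvv] at h3
  have hs : 0 < √(2 * Real.pi * Var[X; P]) := by positivity
  rw [div_le_div_iff₀ (by norm_num) hs] at h3
  have h4 : 2 * Real.pi * Var[X; P] ≤ (4 * c) ^ 2 := by
    rw [← Real.sq_sqrt (by positivity : 0 ≤ 2 * Real.pi * Var[X; P])]
    have : √(2 * Real.pi * Var[X; P]) ≤ 4 * c := by linarith
    gcongr
  nlinarith [Real.pi_gt_three]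

/-- The events `∀ i, |X i| ≤ n` increase to an almost sure event, so one of them has probability
above `1/2`, which bounds every variance at once. Continuity from below of the outer measure
suffices, so `ι` may be uncountable. -/
theorem exists_integral_sq_le {ι : Type*} {X : ι → Ω → ℝ} (hX : ∀ i, HasGaussianLaw (X i) P)
    (h0 : ∀ i, ∫ ω, X i ω ∂P = 0) [IsProbabilityMeasure P]
    (h : ∀ᵐ ω ∂P, ∃ R : ℝ, ∀ i, |X i ω| ≤ R) : ∃ C : ℝ, ∀ i, ∫ ω, X i ω ^ 2 ∂P ≤ C := by
  have hmono : Monotone fun n : ℕ => {ω | ∀ i, |X i ω| ≤ (n : ℝ)} := by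
    intro m n hmn ω hω i
    exact (hω i).trans (by exact_mod_cast hmn)
  have hU : P (⋃ n : ℕ, {ω | ∀ i, |X i ω| ≤ (n : ℝ)}) = 1 := by
    refine le_antisymm prob_le_one ?_
    rw [← measure_univ (μ := P)]
    refine measure_mono_ae ?_
    filter_upwards [h] with ω hω _
    obtain ⟨R, hR⟩ := hω
    obtain ⟨n, hn⟩ := exists_nat_ge R
    exact mem_iUnion.2 ⟨n, fun i => (hR i).trans hn⟩
  have hlim := tendsto_measure_iUnion_atTop (μ := P) hmono
  rw [hU] at hlim
  have hev := hlim.eventually_const_lt (u := (1 / 2 : ℝ≥0∞)) (by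
    rw [one_div]; exact ENNReal.one_half_lt_one)
  obtain ⟨n, hn⟩ := hev.exists
  refine ⟨(2 * n) ^ 2, fun i => integral_sq_le_of_half_le (hX i) (h0 i) (by positivity) ?_⟩
  exact le_trans (le_of_lt hn) (measure_mono fun ω hω => hω i)

/-- Convergence in probability puts `X n` in `[-c, c]` with probability at least `1/2` for large
`n`; for Gaussian variables this already bounds the second moment by `4 c² = ε / 2`. -/
theorem tendsto_integral_sq_of_ae_tendsto_zero [IsProbabilityMeasure P] {X : ℕ → Ω → ℝ}
    (hX : ∀ n, HasGaussianLaw (X n) P) (h0 : ∀ n, ∫ ω, X n ω ∂P = 0)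
    (h : ∀ᵐ ω ∂P, Tendsto (fun n => X n ω) atTop (𝓝 0)) :
    Tendsto (fun n => ∫ ω, X n ω ^ 2 ∂P) atTop (𝓝 0) := by
  have hmeas : TendstoInMeasure P X atTop (fun _ => 0) :=
    tendstoInMeasure_of_tendsto_ae (fun n => (hX n).aemeasurable.aestronglyMeasurable) h
  rw [Metric.tendsto_atTop]
  intro ε hε
  set c := √(ε / 2) / 2 with hc
  have hcpos : 0 < c := by positivity
  have := (tendstoInMeasure_iff_norm.1 hmeas) c hcpos
  have hev := this.eventually_lt_const (u := (1 / 2 : ℝ≥0∞)) (by simp)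
  obtain ⟨N, hN⟩ := eventually_atTop.1 hev
  refine ⟨N, fun n hn => ?_⟩
  rw [Real.dist_eq, sub_zero, abs_of_nonneg (integral_nonneg fun ω => sq_nonneg _)]
  have hhalf : 1 / 2 ≤ P {ω | |X n ω| ≤ c} := by
    have h1 : (1 : ℝ≥0∞) ≤ P {ω | |X n ω| ≤ c} + P {ω | |X n ω| ≤ c}ᶜ := by
      rw [← measure_univ (μ := P)]
      exact measure_univ_le_add_compl _
    have h2 : P {ω | |X n ω| ≤ c}ᶜ ≤ 1 / 2 := by
      refine le_trans (measure_mono fun ω hω => ?_) (hN n hn).le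
      have : ¬ |X n ω| ≤ c := hω
      simpa using (not_le.1 this).le
    have h3 := h1.trans (add_le_add_right h2 _)
    by_contra hlt
    rw [not_le] at hlt
    have : P {ω | |X n ω| ≤ c} + 1 / 2 < 1 / 2 + 1 / 2 :=
      ENNReal.add_lt_add_right (by simp) hlt
    rw [ENNReal.add_halves] at this
    exact absurd h3 (not_le.2 this)
  refine lt_of_le_of_lt (integral_sq_le_of_half_le (hX n) (h0 n) hcpos.le hhalf) ?_
  rw [hc, mul_div_cancel₀ _ two_ne_zero, Real.sq_sqrt (by positivity)]
  linarith

variable {k : ℕ} {f : ℝ → Ω → ℝ}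

theorem IsNormalizedStationaryGaussian.memLp (hf : IsNormalizedStationaryGaussian k f P) (t : ℝ) :
    MemLp (f t) 2 P := (hf.gaussian.hasGaussianLaw_eval t).memLp_two

theorem IsNormalizedStationaryGaussian.integral_mul (hf : IsNormalizedStationaryGaussian k f P)
    (s t : ℝ) : ∫ ω, f s ω * f t ω ∂P = correlationFunction f P (t - s) := by
  have h := hf.stationary s {0, t - s}
  have hm : ∀ g : ({0, t - s} : Finset ℝ) → ℝ,
      AEMeasurable (fun ω (u : ({0, t - s} : Finset ℝ)) => f (g u) ω) P := fun g =>
    aemeasurable_pi_lambda _ fun u => hf.gaussian.aemeasurable (g u)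
  have h1 := integral_map (hm fun u => u + s)
    (f := fun y => y ⟨0, by simp⟩ * y ⟨t - s, by simp⟩) (by fun_prop)
  have h2 := integral_map (hm fun u => u)
    (f := fun y => y ⟨0, by simp⟩ * y ⟨t - s, by simp⟩) (by fun_prop)
  rw [h, h2] at h1
  simp only [zero_add, sub_add_cancel] at h1
  rw [correlationFunction, h1]

theorem IsNormalizedStationaryGaussian.corr_neg (hf : IsNormalizedStationaryGaussian k f P)
    (t : ℝ) : correlationFunction f P (-t) = correlationFunction f P t := by
  have h1 := hf.integral_mul t 0
  have h2 := hf.integral_mul 0 t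
  rw [zero_sub] at h1
  rw [sub_zero] at h2
  rw [← h1, ← h2]
  simp_rw [mul_comm]

theorem IsNormalizedStationaryGaussian.hasGaussianLaw_sum
    (hf : IsNormalizedStationaryGaussian k f P) {ι : Type*} (s : Finset ι) (a t : ι → ℝ) :
    HasGaussianLaw (fun ω => ∑ i ∈ s, a i * f (t i) ω) P :=
  ((hf.gaussian.comp_right t).smul a).hasGaussianLaw_fun_sum (I := s)

theorem IsNormalizedStationaryGaussian.integral_sum
    (hf : IsNormalizedStationaryGaussian k f P) {ι : Type*} (s : Finset ι) (a t : ι → ℝ) :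
    ∫ ω, ∑ i ∈ s, a i * f (t i) ω ∂P = 0 := by
  rw [integral_finsetSum]
  · simp [integral_const_mul, hf.centered]
  · intro i _
    exact ((hf.gaussian.hasGaussianLaw_eval (t i)).integrable).const_mul _

theorem IsNormalizedStationaryGaussian.integral_sum_sq
    (hf : IsNormalizedStationaryGaussian k f P) {ι : Type*} (s : Finset ι) (a t : ι → ℝ) :
    ∫ ω, (∑ i ∈ s, a i * f (t i) ω) ^ 2 ∂P =
      ∑ i ∈ s, ∑ j ∈ s, a i * a j * correlationFunction f P (t i - t j) := by
  have hint : ∀ i j, Integrable (fun ω => a i * a j * (f (t j) ω * f (t i) ω)) P := fun i j =>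
    ((hf.memLp (t j)).integrable_mul (hf.memLp (t i))).const_mul _
  have e : ∀ ω, (∑ i ∈ s, a i * f (t i) ω) ^ 2 =
      ∑ i ∈ s, ∑ j ∈ s, a i * a j * (f (t j) ω * f (t i) ω) := by
    intro ω
    rw [sq, Finset.sum_mul_sum]
    exact Finset.sum_congr rfl fun i _ => Finset.sum_congr rfl fun j _ => by ring
  simp_rw [e]
  rw [integral_finsetSum _ fun i _ => integrable_finsetSum _ fun j _ => hint i j]
  refine Finset.sum_congr rfl fun i _ => ?_
  rw [integral_finsetSum _ fun j _ => hint i j]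
  refine Finset.sum_congr rfl fun j _ => ?_
  rw [integral_const_mul, hf.integral_mul]

theorem IsNormalizedStationaryGaussian.isPosSemidefFun
    (hf : IsNormalizedStationaryGaussian k f P) : IsPosSemidefFun (correlationFunction f P) := by
  intro N x a
  rw [← hf.integral_sum_sq]
  exact integral_nonneg fun ω => sq_nonneg _

theorem IsNormalizedStationaryGaussian.integral_sub_sq
    (hf : IsNormalizedStationaryGaussian k f P) (s t c : ℝ) :
    ∫ ω, (c * (f s ω - f t ω)) ^ 2 ∂P = c ^ 2 * (2 * (1 - correlationFunction f P (s - t))) := by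
  have h := hf.integral_sum_sq Finset.univ ![c, -c] ![s, t]
  simp only [Fin.sum_univ_two, Matrix.cons_val_zero, Matrix.cons_val_one, sub_self,
    hf.variance_eq] at h
  have h2 : correlationFunction f P (t - s) = correlationFunction f P (s - t) := by
    rw [← hf.corr_neg]; congr 1; ring
  rw [h2] at h
  have e : ∀ ω, (c * (f s ω - f t ω)) ^ 2 = (c * f s ω + -c * f t ω) ^ 2 := fun ω => by ring
  simp_rw [e]
  rw [h]
  ring

theorem IsNormalizedStationaryGaussian.hasGaussianLaw_sub
    (hf : IsNormalizedStationaryGaussian k f P) (s t c : ℝ) :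
    HasGaussianLaw (fun ω => c * (f s ω - f t ω)) P ∧ ∫ ω, c * (f s ω - f t ω) ∂P = 0 := by
  have h := hf.hasGaussianLaw_sum Finset.univ ![c, -c] ![s, t]
  have h' := hf.integral_sum Finset.univ ![c, -c] ![s, t]
  simp only [Fin.sum_univ_two, Matrix.cons_val_zero, Matrix.cons_val_one] at h h'
  have e : ∀ ω, c * (f s ω - f t ω) = c * f s ω + -c * f t ω := fun ω => by ring
  simp_rw [e]
  exact ⟨h, h'⟩

theorem IsNormalizedStationaryGaussian.abs_corr_le (hf : IsNormalizedStationaryGaussian k f P)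
    (t : ℝ) : |correlationFunction f P t| ≤ 1 := by
  have h := fun c : ℝ => hf.integral_sum_sq Finset.univ ![1, c] ![t, 0]
  simp only [Fin.sum_univ_two, Matrix.cons_val_zero, Matrix.cons_val_one, sub_self,
    hf.variance_eq, sub_zero, zero_sub, hf.corr_neg] at h
  have h1 : 0 ≤ ∫ ω, (1 * f t ω + 1 * f 0 ω) ^ 2 ∂P := integral_nonneg fun ω => sq_nonneg _
  have h2 : 0 ≤ ∫ ω, (1 * f t ω + -1 * f 0 ω) ^ 2 ∂P := integral_nonneg fun ω => sq_nonneg _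
  rw [h] at h1 h2
  rw [abs_le]
  constructor <;> linarith

/-- The difference quotients at `0` with step at most `1` are bounded on each `C¹` trajectory, hence
bounded in `L²`, and the second moment of such a quotient is `2 (1 - κ h) / h²`. For larger steps
the trivial bound `1 - κ ≤ 2` is enough. -/
theorem IsNormalizedStationaryGaussian.exists_quadratic_bound
    (hf : IsNormalizedStationaryGaussian k f P) (hk : 1 ≤ k) :
    ∃ C : ℝ, ∀ t, 1 - correlationFunction f P t ≤ C * t ^ 2 := by
  have := hf.gaussian.isProbabilityMeasure
  obtain ⟨C, hC⟩ := exists_integral_sq_le (P := P)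
    (X := fun (h : {h : ℝ // h ≠ 0 ∧ |h| ≤ 1}) ω => (h : ℝ)⁻¹ * (f h ω - f 0 ω))
    (fun h => (hf.hasGaussianLaw_sub _ _ _).1) (fun h => (hf.hasGaussianLaw_sub _ _ _).2) (by
      filter_upwards [hf.contDiff] with ω hω
      have h1 : ContDiff ℝ 1 (fun t => f t ω) := hω.of_le (by exact_mod_cast hk)
      have hlip := h1.contDiffOn (s := univ)
      obtain ⟨M, hM⟩ := (isCompact_Icc (a := (-1 : ℝ)) (b := 1)).exists_bound_of_continuousOn
        (h1.continuous_deriv le_rfl).continuousOn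
      refine ⟨M, fun h => ?_⟩
      have hmv := (convex_Icc (-1 : ℝ) 1).norm_image_sub_le_of_norm_deriv_le
        (f := fun t => f t ω) (fun x _ => (h1.differentiable one_ne_zero) x) hM
        (x := 0) (y := h) (by simp) (abs_le.1 h.2.2)
      rw [abs_mul, abs_inv, inv_mul_le_iff₀ (abs_pos.2 h.2.1)]
      simpa [mul_comm] using hmv)
  refine ⟨max C 2, fun t => ?_⟩
  by_cases h0 : t = 0
  · simp [h0, hf.variance_eq]
  by_cases h1 : |t| ≤ 1
  · have h2 := hC ⟨t, h0, h1⟩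
    simp only at h2
    rw [hf.integral_sub_sq, sub_zero, inv_pow, inv_mul_le_iff₀ (by positivity)] at h2
    have h3 : t ^ 2 * C ≤ max C 2 * t ^ 2 := by
      rw [mul_comm]; gcongr; exact le_max_left _ _
    nlinarith [(abs_le.1 (hf.abs_corr_le t)).2]
  · have h2 : 1 ≤ t ^ 2 := by
      rw [← sq_abs]; nlinarith
    have h3 := (abs_le.1 (hf.abs_corr_le t)).1
    have h4 : (2 : ℝ) * 1 ≤ max C 2 * t ^ 2 :=
      mul_le_mul (le_max_right _ _) h2 (by norm_num) (le_trans (by norm_num) (le_max_right _ _))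
    linarith

/-- This is Cauchy–Schwarz for `f s - f t` against `f 0`, obtained by optimizing the nonnegative
second moment of `f s - f t + c f 0` over `c`. -/
theorem IsNormalizedStationaryGaussian.continuous_corr
    (hf : IsNormalizedStationaryGaussian k f P) (hk : 1 ≤ k) :
    Continuous (correlationFunction f P) := by
  have := hf.gaussian.isProbabilityMeasure
  obtain ⟨C, hC⟩ := hf.exists_quadratic_bound hk
  have hb : ∀ s t,
      (correlationFunction f P s - correlationFunction f P t) ^ 2 ≤ 2 * C * (s - t) ^ 2 := by
    intro s t
    set κs := correlationFunction f P s
    set κt := correlationFunction f P t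
    have h := fun c : ℝ => hf.integral_sum_sq Finset.univ ![1, -1, c] ![s, t, 0]
    simp only [Fin.sum_univ_three, Matrix.cons_val_zero, Matrix.cons_val_one, Matrix.cons_val_two,
      Matrix.tail_cons, Matrix.head_cons, sub_self, hf.variance_eq, sub_zero, zero_sub,
      hf.corr_neg] at h
    have h2 : correlationFunction f P (t - s) = correlationFunction f P (s - t) := by
      rw [← hf.corr_neg]; congr 1; ring
    have h1 : ∀ c : ℝ,
        0 ≤ 2 * (1 - correlationFunction f P (s - t)) + 2 * c * (κs - κt) + c ^ 2 := by
      intro c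
      have : 0 ≤ ∫ ω, (1 * f s ω + -1 * f t ω + c * f 0 ω) ^ 2 ∂P :=
        integral_nonneg fun ω => sq_nonneg _
      rw [h, h2] at this
      convert this using 1
      ring
    have := h1 (-(κs - κt))
    nlinarith [hC (s - t)]
  rw [continuous_iff_continuousAt]
  intro t
  rw [ContinuousAt, tendsto_iff_norm_sub_tendsto_zero]
  have hz : Tendsto (fun s => √(2 * C * (s - t) ^ 2)) (𝓝 t) (𝓝 0) := by
    have : Continuous fun s : ℝ => √(2 * C * (s - t) ^ 2) := by fun_prop
    simpa using this.tendsto t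
  refine squeeze_zero_norm (fun s => ?_) hz
  rw [norm_norm]
  exact Real.abs_le_sqrt (hb s t)

theorem IsNormalizedStationaryGaussian.exists_spectral_measure
    (hf : IsNormalizedStationaryGaussian k f P) (hk : 1 ≤ k) :
    ∃ μ : ProbabilityMeasure ℝ, ∀ t, charFun (μ : Measure ℝ) t = correlationFunction f P t := by
  obtain ⟨C, hC⟩ := hf.exists_quadratic_bound hk
  exact _root_.exists_spectral_measure hf.isPosSemidefFun (hf.continuous_corr hk) hf.corr_neg
    hf.variance_eq hC hf.abs_corr_le

end gaussian

/-! ### The process as a differentiable curve in `L²`. -/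

section curve

variable {Ω : Type*} [MeasurableSpace Ω] {P : Measure Ω} {k : ℕ} {f : ℝ → Ω → ℝ}

/-- The process seen as a curve in the Hilbert space of square integrable random variables. -/
noncomputable def IsNormalizedStationaryGaussian.curve (hf : IsNormalizedStationaryGaussian k f P)
    (t : ℝ) : Lp ℝ 2 P := (hf.memLp t).toLp (f t)

theorem IsNormalizedStationaryGaussian.inner_curve (hf : IsNormalizedStationaryGaussian k f P)
    (s t : ℝ) : inner ℝ (hf.curve s) (hf.curve t) = correlationFunction f P (s - t) := by
  rw [L2.inner_def, ← neg_sub, hf.corr_neg, ← hf.integral_mul s t]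
  refine integral_congr_ae ?_
  filter_upwards [(hf.memLp s).coeFn_toLp, (hf.memLp t).coeFn_toLp] with ω h1 h2
  simp only [IsNormalizedStationaryGaussian.curve, h1, h2]
  simp [mul_comm]

theorem norm_sq_sum_smul_eq {E : Type*} [NormedAddCommGroup E] [InnerProductSpace ℝ E]
    {κ : ℝ → ℝ} {F : ℝ → E} (hF : ∀ s t, inner ℝ (F s) (F t) = κ (s - t)) {ι : Type*}
    (s : Finset ι) (a t : ι → ℝ) :
    ‖∑ i ∈ s, a i • F (t i)‖ ^ 2 = ∑ i ∈ s, ∑ j ∈ s, a i * a j * κ (t i - t j) := by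
  rw [← real_inner_self_eq_norm_sq, sum_inner]
  refine Finset.sum_congr rfl fun i _ => ?_
  rw [inner_sum]
  refine Finset.sum_congr rfl fun j _ => ?_
  rw [inner_smul_left, inner_smul_right, hF]
  simp
  ring

theorem hasStrictDerivAt_of_tendsto_slope {E : Type*} [NormedAddCommGroup E] [NormedSpace ℝ E]
    {F : ℝ → E} {x : ℝ} {F' : E}
    (h : Tendsto (fun p : ℝ × ℝ => (p.1 - p.2)⁻¹ • (F p.1 - F p.2))
      (𝓝[{p | p.1 ≠ p.2}] (x, x)) (𝓝 F')) : HasStrictDerivAt F F' x := by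
  rw [hasStrictDerivAt_iff_hasStrictFDerivAt, hasStrictFDerivAt_iff_isLittleO,
    Asymptotics.isLittleO_iff]
  intro c hc
  have h1 := Metric.tendsto_nhds.1 h c hc
  rw [eventually_nhdsWithin_iff] at h1
  filter_upwards [h1] with p hp
  by_cases hne : p.1 = p.2
  · simp [hne]
  · have h2 := (hp hne).le
    rw [dist_eq_norm] at h2
    have hs : p.1 - p.2 ≠ 0 := sub_ne_zero.2 hne
    have e : F p.1 - F p.2 - (p.1 - p.2) • F' =
        (p.1 - p.2) • ((p.1 - p.2)⁻¹ • (F p.1 - F p.2) - F') := by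
      rw [smul_sub, smul_smul, mul_inv_cancel₀ hs, one_smul]
    simp only [ContinuousLinearMap.toSpanSingleton_apply]
    rw [e, norm_smul, mul_comm]
    gcongr

theorem HasStrictDerivAt.tendsto_slope_prod {E : Type*} [NormedAddCommGroup E] [NormedSpace ℝ E]
    {F : ℝ → E} {x : ℝ} {F' : E} (h : HasStrictDerivAt F F' x) :
    Tendsto (fun p : ℝ × ℝ => (p.1 - p.2)⁻¹ • (F p.1 - F p.2))
      (𝓝[{p | p.1 ≠ p.2}] (x, x)) (𝓝 F') := by
  rw [hasStrictDerivAt_iff_hasStrictFDerivAt, hasStrictFDerivAt_iff_isLittleO,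
    Asymptotics.isLittleO_iff] at h
  rw [Metric.tendsto_nhds]
  intro ε hε
  rw [eventually_nhdsWithin_iff]
  filter_upwards [h (half_pos hε)] with p hp hne
  have hs : p.1 - p.2 ≠ 0 := sub_ne_zero.2 hne
  have e : F p.1 - F p.2 - (p.1 - p.2) • F' =
      (p.1 - p.2) • ((p.1 - p.2)⁻¹ • (F p.1 - F p.2) - F') := by
    rw [smul_sub, smul_smul, mul_inv_cancel₀ hs, one_smul]
  simp only [ContinuousLinearMap.toSpanSingleton_apply] at hp
  rw [e, norm_smul, mul_comm, mul_le_mul_iff_left₀ (norm_pos_iff.2 hs)] at hp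
  rw [dist_eq_norm]
  linarith

/-- Slopes of a trajectory between two moving points converge, so differences of two such slopes
tend to zero almost surely, hence in `L²`; completeness provides the limit. Strict differentiability
is needed because both endpoints of the sign-change cells move. -/
theorem IsNormalizedStationaryGaussian.exists_hasStrictDerivAt_curve
    (hf : IsNormalizedStationaryGaussian k f P) (hk : 1 ≤ k) (x : ℝ) :
    ∃ F' : Lp ℝ 2 P, HasStrictDerivAt hf.curve F' x := by
  have hprob := hf.gaussian.isProbabilityMeasure
  set L : Filter (ℝ × ℝ) := 𝓝[{p | p.1 ≠ p.2}] (x, x) with hL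
  have hne : L.NeBot := by
    rw [hL, ← mem_closure_iff_nhdsWithin_neBot, Metric.mem_closure_iff]
    intro ε hε
    refine ⟨(x + ε / 2, x), by simp [hε.ne'], ?_⟩
    rw [Prod.dist_eq]
    simp [abs_of_pos, hε]
  set q : ℝ × ℝ → Lp ℝ 2 P := fun p => (p.1 - p.2)⁻¹ • (hf.curve p.1 - hf.curve p.2) with hq
  have hcau : Cauchy (map q L) := by
    rw [cauchy_map_iff]
    refine ⟨hne, ?_⟩
    rw [tendsto_uniformity_iff_dist_tendsto_zero]
    refine tendsto_of_seq_tendsto fun u hu => ?_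
    have hu1 : Tendsto (fun n => (u n).1) atTop L := tendsto_fst.comp hu
    have hu2 : Tendsto (fun n => (u n).2) atTop L := tendsto_snd.comp hu
    -- The difference of two slopes is written as one combination of four values of the process.
    set X : ℕ → Ω → ℝ := fun n ω =>
      ∑ i ∈ (Finset.univ : Finset (Fin 4)),
        ![((u n).1.1 - (u n).1.2)⁻¹, -((u n).1.1 - (u n).1.2)⁻¹,
          -((u n).2.1 - (u n).2.2)⁻¹, ((u n).2.1 - (u n).2.2)⁻¹] i *
        f (![(u n).1.1, (u n).1.2, (u n).2.1, (u n).2.2] i) ω with hX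
    have hXt : Tendsto (fun n => ∫ ω, X n ω ^ 2 ∂P) atTop (𝓝 0) := by
      refine tendsto_integral_sq_of_ae_tendsto_zero
        (fun n => hf.hasGaussianLaw_sum _ _ _) (fun n => hf.integral_sum _ _ _) ?_
      filter_upwards [hf.contDiff] with ω hω
      have h1 : HasStrictDerivAt (fun t => f t ω) (deriv (fun t => f t ω) x) x :=
        hω.contDiffAt.hasStrictDerivAt (by exact_mod_cast (by omega : k ≠ 0))
      have h2 := h1.tendsto_slope_prod
      have h3 := (h2.comp hu1).sub (h2.comp hu2)
      rw [sub_self] at h3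
      refine h3.congr fun n => ?_
      simp [hX, Fin.sum_univ_four]
      ring
    have hd : ∀ n, dist (q (u n).1) (q (u n).2) = √(∫ ω, X n ω ^ 2 ∂P) := by
      intro n
      rw [dist_eq_norm, eq_comm, Real.sqrt_eq_iff_eq_sq (integral_nonneg fun ω => sq_nonneg _)
        (norm_nonneg _)]
      simp only [hX]
      rw [hf.integral_sum_sq, ← norm_sq_sum_smul_eq hf.inner_curve]
      congr 2
      simp [hq, Fin.sum_univ_four]
      module
    show Tendsto (fun n => dist (q (u n).1) (q (u n).2)) atTop (𝓝 0)
    simp_rw [hd]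
    simpa [Function.comp_def] using (Real.continuous_sqrt.tendsto 0).comp hXt
  obtain ⟨F', hF'⟩ := CompleteSpace.complete hcau
  exact ⟨F', hasStrictDerivAt_of_tendsto_slope hF'⟩

end curve

/-! ### Derivatives of the correlation function as spectral integrals. -/

theorem iteratedDeriv_cos_affine (n : ℕ) (a b : ℝ) :
    iteratedDeriv n (fun x => Real.cos (a * x + b)) =
      fun x => a ^ n * Real.cos (a * x + b + n * (Real.pi / 2)) := by
  induction n with
  | zero => simp
  | succ n ih =>
    rw [iteratedDeriv_succ, ih]
    ext x
    have h1 : HasDerivAt (fun x : ℝ => a * x + b + n * (Real.pi / 2)) a x := by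
      simpa using (((hasDerivAt_id x).const_mul a).add_const b).add_const (n * (Real.pi / 2))
    have h2 := (h1.cos).const_mul (a ^ n)
    rw [h2.deriv]
    have : a * x + b + ((n + 1 : ℕ) : ℝ) * (Real.pi / 2) =
        a * x + b + n * (Real.pi / 2) + Real.pi / 2 := by push_cast; ring
    rw [this, Real.cos_add_pi_div_two]
    ring

theorem iteratedDeriv_cos_mul (n : ℕ) (a x : ℝ) :
    iteratedDeriv n (fun x => Real.cos (a * x)) x = a ^ n * Real.cos (a * x + n * (Real.pi / 2)) := by
  have := congrFun (iteratedDeriv_cos_affine n a 0) x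
  simpa using this

theorem iteratedDeriv_sin_mul (n : ℕ) (a x : ℝ) :
    iteratedDeriv n (fun x => Real.sin (a * x)) x = a ^ n * Real.sin (a * x + n * (Real.pi / 2)) := by
  have h := congrFun (iteratedDeriv_cos_affine n a (-(Real.pi / 2))) x
  have e : (fun x => Real.cos (a * x + -(Real.pi / 2))) = fun x => Real.sin (a * x) := by
    ext x; rw [← sub_eq_add_neg, Real.cos_sub_pi_div_two]
  rw [e] at h
  rw [h]
  have : a * x + -(Real.pi / 2) + n * (Real.pi / 2) = a * x + n * (Real.pi / 2) - Real.pi / 2 := by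
    ring
  rw [this, Real.cos_sub_pi_div_two]

section spectral

variable {μ : Measure ℝ} [IsProbabilityMeasure μ] {κ : ℝ → ℝ}

theorem integrable_exp_mul_I (t : ℝ) :
    Integrable (fun x : ℝ => Complex.exp (t * x * Complex.I)) μ := by
  refine Integrable.of_bound (by fun_prop) 1 (Eventually.of_forall fun x => ?_)
  have : (t * x * Complex.I : ℂ) = ((t * x : ℝ) : ℂ) * Complex.I := by push_cast; ring
  rw [this, Complex.norm_exp_ofReal_mul_I]

theorem integrable_cos_mul (t : ℝ) : Integrable (fun x : ℝ => Real.cos (t * x)) μ :=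
  Integrable.of_bound (by fun_prop) 1 (Eventually.of_forall fun x => Real.abs_cos_le_one _)

theorem eq_integral_cos (hμ : ∀ t, charFun μ t = κ t) (t : ℝ) :
    κ t = ∫ x, Real.cos (t * x) ∂μ := by
  have h := congrArg Complex.re (hμ t)
  rw [Complex.ofReal_re, charFun_apply_real, ← RCLike.re_eq_complex_re,
    ← integral_re (integrable_exp_mul_I t)] at h
  rw [← h]
  refine integral_congr_ae (Eventually.of_forall fun x => ?_)
  have : (t * x * Complex.I : ℂ) = ((t * x : ℝ) : ℂ) * Complex.I := by push_cast; ring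
  simp only [this, RCLike.re_eq_complex_re, Complex.exp_ofReal_mul_I_re]

/-- Covariances of combinations of values become integrals of the squared modulus of the
corresponding exponential sums. -/
theorem sum_mul_eq_integral (hμ : ∀ t, charFun μ t = κ t) {ι : Type*} (s : Finset ι)
    (a t : ι → ℝ) :
    ∑ i ∈ s, ∑ j ∈ s, a i * a j * κ (t i - t j) =
      ∫ x, ((∑ i ∈ s, a i * Real.cos (x * t i)) ^ 2 + (∑ i ∈ s, a i * Real.sin (x * t i)) ^ 2)
        ∂μ := by
  have hint : ∀ i j, Integrable (fun x : ℝ => a i * a j * Real.cos ((t i - t j) * x)) μ :=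
    fun i j => (integrable_cos_mul _).const_mul _
  have e : ∀ x : ℝ, (∑ i ∈ s, a i * Real.cos (x * t i)) ^ 2 +
      (∑ i ∈ s, a i * Real.sin (x * t i)) ^ 2 =
      ∑ i ∈ s, ∑ j ∈ s, a i * a j * Real.cos ((t i - t j) * x) := by
    intro x
    rw [sq, sq, Finset.sum_mul_sum, Finset.sum_mul_sum, ← Finset.sum_add_distrib]
    refine Finset.sum_congr rfl fun i _ => ?_
    rw [← Finset.sum_add_distrib]
    refine Finset.sum_congr rfl fun j _ => ?_
    rw [mul_comm _ x, mul_sub, Real.cos_sub]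
    ring
  simp_rw [e]
  rw [integral_finsetSum _ fun i _ => integrable_finsetSum _ fun j _ => hint i j]
  refine Finset.sum_congr rfl fun i _ => ?_
  rw [integral_finsetSum _ fun j _ => hint i j]
  refine Finset.sum_congr rfl fun j _ => ?_
  rw [integral_const_mul, eq_integral_cos hμ]

theorem contDiff_of_spectral (hμ : ∀ t, charFun μ t = κ t) {n : ℕ} (hm : MemLp id n μ) :
    ContDiff ℝ n κ := by
  have h1 : ContDiff ℝ n (charFun μ) := contDiff_charFun hm
  have h2 : κ = fun t => Complex.reCLM (charFun μ t) := by ext t; simp [hμ]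
  rw [h2]
  exact Complex.reCLM.contDiff.comp h1

theorem iteratedDeriv_eq_integral (hμ : ∀ t, charFun μ t = κ t) {n : ℕ} (hm : MemLp id n μ) :
    ∀ j ≤ n, ∀ t, iteratedDeriv j κ t =
      ∫ x, x ^ j * Real.cos (t * x + j * (Real.pi / 2)) ∂μ := by
  have h1 : ContDiff ℝ n (charFun μ) := contDiff_charFun hm
  have key : ∀ j ≤ n, iteratedDeriv j κ = fun t => (iteratedDeriv j (charFun μ) t).re := by
    intro j
    induction j with
    | zero => intro _; ext t; simp [hμ]
    | succ j ih =>
      intro hj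
      ext t
      rw [iteratedDeriv_succ, ih (by omega)]
      have h2 : HasDerivAt (iteratedDeriv j (charFun μ)) (iteratedDeriv (j + 1) (charFun μ) t) t := by
        rw [iteratedDeriv_succ]
        exact ((h1.differentiable_iteratedDeriv j (by exact_mod_cast hj)) t).hasDerivAt
      exact (Complex.reCLM.hasFDerivAt.comp_hasDerivAt t h2).deriv
  intro j hj t
  have hmj : MemLp id j μ := hm.mono_exponent (by exact_mod_cast hj)
  rw [key j hj]
  beta_reduce
  rw [iteratedDeriv_charFun hmj, ← integral_const_mul, ← RCLike.re_eq_complex_re]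
  have hi : Integrable (fun x : ℝ => Complex.I ^ j * ((x : ℂ) ^ j *
      Complex.exp (t * x * Complex.I))) μ := by
    have h2 : Integrable (fun x : ℝ => ‖x‖ ^ j) μ := by
      simpa using hmj.integrable_norm_pow'
    refine h2.mono' (by fun_prop) (Eventually.of_forall fun x => ?_)
    have : (t * x * Complex.I : ℂ) = ((t * x : ℝ) : ℂ) * Complex.I := by push_cast; ring
    rw [norm_mul, norm_mul, this, Complex.norm_exp_ofReal_mul_I]
    simp
  rw [← integral_re hi]
  refine integral_congr_ae (Eventually.of_forall fun x => ?_)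
  have e1 : Complex.I ^ j = Complex.exp ((j * (Real.pi / 2) : ℝ) * Complex.I) := by
    rw [Complex.ofReal_mul, mul_assoc, Complex.ofReal_natCast, Complex.exp_nat_mul]
    congr 1
    push_cast
    rw [Complex.exp_pi_div_two_mul_I]
  have e2 : Complex.I ^ j * ((x : ℂ) ^ j * Complex.exp (t * x * Complex.I)) =
      ((x ^ j : ℝ) : ℂ) * Complex.exp ((t * x + j * (Real.pi / 2) : ℝ) * Complex.I) := by
    rw [e1, mul_left_comm, ← Complex.exp_add]
    push_cast
    ring_nf
  simp only [e2, RCLike.re_eq_complex_re, Complex.re_ofReal_mul, Complex.exp_ofReal_mul_I_re]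

theorem exists_bound_iteratedDeriv (hμ : ∀ t, charFun μ t = κ t) {n : ℕ} (hm : MemLp id n μ) :
    ∃ B : ℝ, 0 ≤ B ∧ ∀ j ≤ n, ∀ t, |iteratedDeriv j κ t| ≤ B := by
  refine ⟨∑ j ∈ Finset.range (n + 1), ∫ x, ‖x‖ ^ j ∂μ,
    Finset.sum_nonneg fun j _ => integral_nonneg fun x => by positivity, fun j hj t => ?_⟩
  have hmj : MemLp id j μ := hm.mono_exponent (by exact_mod_cast hj)
  have h2 : Integrable (fun x : ℝ => ‖x‖ ^ j) μ := by
    simpa using hmj.integrable_norm_pow'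
  rw [iteratedDeriv_eq_integral hμ hm j hj]
  have h3 : |∫ x, x ^ j * Real.cos (t * x + j * (Real.pi / 2)) ∂μ| ≤ ∫ x, ‖x‖ ^ j ∂μ := by
    refine norm_integral_le_of_norm_le (f := fun x : ℝ => x ^ j * Real.cos (t * x + j * (Real.pi / 2))) h2
      (Eventually.of_forall fun x => ?_)
    rw [norm_mul, norm_pow]
    exact mul_le_of_le_one_right (by positivity) (Real.abs_cos_le_one _)
  refine h3.trans (Finset.single_le_sum (f := fun j => ∫ x, ‖x‖ ^ j ∂μ)
    (fun j _ => integral_nonneg fun x => by positivity) (Finset.mem_range.2 (by omega)))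

end spectral

/-! ### Moments of the spectral measure. -/

section moments

variable {Ω : Type*} [MeasurableSpace Ω] {P : Measure Ω} {k : ℕ} {f : ℝ → Ω → ℝ}

/-- The spectral measure of a `C^k` stationary Gaussian process has moments up to order `2k`. -/
theorem IsNormalizedStationaryGaussian.memLp_spectral
    (hf : IsNormalizedStationaryGaussian k f P) {μ : Measure ℝ} [IsProbabilityMeasure μ]
    (hμ : ∀ t, charFun μ t = correlationFunction f P t) : MemLp id ((2 * k : ℕ) : ℝ≥0∞) μ := by
  have hprob := hf.gaussian.isProbabilityMeasure
  set s := Finset.range (k + 1) with hs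
  have hcard : s.card - 1 = k := by simp [hs]
  have hsne : s.Nonempty := ⟨0, by simp [hs]⟩
  -- Here are `k + 1` equally spaced nodes shrinking to `0`. By the mean value theorem the divided
  -- differences of a trajectory stay bounded, hence so do their variances.
  set v : ℕ → ℕ → ℝ := fun n i => i * ((n : ℝ) + 1)⁻¹ with hv
  have hvpos : ∀ n : ℕ, 0 < ((n : ℝ) + 1)⁻¹ := fun n => by positivity
  have hvinj : ∀ n, Function.Injective (v n) := fun n i j h => by
    have := mul_right_cancel₀ (hvpos n).ne' h
    exact_mod_cast this
  have hvmem : ∀ n : ℕ, ∀ i ∈ s, v n i ∈ Icc 0 (k * ((n : ℝ) + 1)⁻¹) := fun n i hi => by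
    have : (i : ℝ) ≤ k := by exact_mod_cast Nat.lt_succ_iff.1 (Finset.mem_range.1 hi)
    exact ⟨by have := (hvpos n).le; simp only [hv]; positivity, by
      simp only [hv]; gcongr⟩
  obtain ⟨C, hC⟩ := exists_integral_sq_le (P := P)
    (X := fun (n : ℕ) ω => dividedDifference s (v n) (fun t => f t ω))
    (fun n => hf.hasGaussianLaw_sum _ _ _) (fun n => hf.integral_sum _ _ _) (by
      filter_upwards [hf.contDiff] with ω hω
      obtain ⟨M, hM⟩ := (isCompact_Icc (a := (0 : ℝ)) (b := k)).exists_bound_of_continuousOn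
        (hω.continuous_iteratedDeriv k le_rfl).continuousOn
      refine ⟨M / k.factorial, fun n => ?_⟩
      obtain ⟨i, hi, j, hj, ξ, hξ, he⟩ := exists_dividedDifference_eq s hsne (v n)
        (hvinj n).injOn (fun t => f t ω) (by rw [hcard]; exact hω)
      rw [he, hcard, abs_div, Nat.abs_cast]
      gcongr
      refine hM ξ ⟨(hvmem n i hi).1.trans hξ.1, hξ.2.trans ((hvmem n j hj).2.trans ?_)⟩
      refine mul_le_of_le_one_right (by positivity) ?_
      exact inv_le_one_of_one_le₀ (by linarith [(Nat.cast_nonneg n : (0 : ℝ) ≤ n)]))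
  -- The variance of the divided difference is the spectral integral of `g n`, the squared modulus
  -- of the divided difference of `t ↦ exp (i x t)`. As `g n x` tends to `(x^k / k!)²`, Fatou's
  -- lemma yields the moment of order `2k`.
  set g : ℕ → ℝ → ℝ := fun n x => dividedDifference s (v n) (fun t => Real.cos (x * t)) ^ 2 +
    dividedDifference s (v n) (fun t => Real.sin (x * t)) ^ 2 with hg
  have hgi : ∀ n, ∫ x, g n x ∂μ ≤ C := fun n => by
    refine le_trans (le_of_eq ?_) (hC n)
    simp only [dividedDifference, hg]
    rw [hf.integral_sum_sq, sum_mul_eq_integral hμ]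
  have hgc : ∀ n, Continuous (g n) := fun n => by
    simp only [hg, dividedDifference]; fun_prop
  have hgb : ∀ n, Integrable (g n) μ := fun n => by
    have : ∀ h : ℝ → ℝ, (∀ x, |h x| ≤ 1) → ∀ x, |dividedDifference s (v n) (fun t => h (x * t))| ≤
        ∑ i ∈ s, |(∏ j ∈ s.erase i, (v n i - v n j))⁻¹| := fun h hh x => by
      refine (Finset.abs_sum_le_sum_abs _ _).trans (Finset.sum_le_sum fun i _ => ?_)
      rw [abs_mul]
      exact mul_le_of_le_one_right (abs_nonneg _) (hh _)
    set B := ∑ i ∈ s, |(∏ j ∈ s.erase i, (v n i - v n j))⁻¹|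
    refine Integrable.of_bound (hgc n).aestronglyMeasurable (B ^ 2 + B ^ 2)
      (Eventually.of_forall fun x => ?_)
    rw [Real.norm_of_nonneg (by simp only [hg]; positivity)]
    simp only [hg]
    rw [← sq_abs (dividedDifference s (v n) fun t => Real.cos (x * t)),
      ← sq_abs (dividedDifference s (v n) fun t => Real.sin (x * t))]
    gcongr
    · exact this Real.cos Real.abs_cos_le_one x
    · exact this Real.sin Real.abs_sin_le_one x
  have hlim0 : ∀ φ : ℝ → ℝ, ContDiff ℝ k φ → Tendsto (fun n => dividedDifference s (v n) φ) atTop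
      (𝓝 (iteratedDeriv k φ 0 / k.factorial)) := by
    intro φ hφ
    have : ∀ n : ℕ, ∃ ξ ∈ Icc 0 (k * ((n : ℝ) + 1)⁻¹), dividedDifference s (v n) φ =
        iteratedDeriv k φ ξ / k.factorial := fun n => by
      obtain ⟨i, hi, j, hj, ξ, hξ, he⟩ := exists_dividedDifference_eq s hsne (v n)
        (hvinj n).injOn φ (by rw [hcard]; exact hφ)
      rw [hcard] at he
      exact ⟨ξ, ⟨(hvmem n i hi).1.trans hξ.1, hξ.2.trans (hvmem n j hj).2⟩, he⟩
    choose ξ hξ he using this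
    simp_rw [he]
    have h0 : Tendsto (fun n : ℕ => (k : ℝ) * ((n : ℝ) + 1)⁻¹) atTop (𝓝 0) := by
      simpa using (tendsto_one_div_add_atTop_nhds_zero_nat (𝕜 := ℝ)).const_mul (k : ℝ)
    have hξ0 : Tendsto ξ atTop (𝓝 0) :=
      tendsto_of_tendsto_of_tendsto_of_le_of_le tendsto_const_nhds h0 (fun n => (hξ n).1)
        (fun n => (hξ n).2)
    exact (((hφ.continuous_iteratedDeriv k le_rfl).tendsto 0).comp hξ0).div_const _
  have hlim : ∀ x, Tendsto (fun n => g n x) atTop (𝓝 ((x ^ k / k.factorial) ^ 2)) := by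
    intro x
    have h1 := ((hlim0 (fun t => Real.cos (x * t)) (by fun_prop)).pow 2).add
      ((hlim0 (fun t => Real.sin (x * t)) (by fun_prop)).pow 2)
    rw [iteratedDeriv_cos_mul, iteratedDeriv_sin_mul] at h1
    refine h1.trans (le_of_eq ?_)
    congr 1
    simp only [mul_zero, zero_add, div_pow, mul_pow]
    rw [← add_div, ← mul_add, Real.cos_sq_add_sin_sq, mul_one]
  have hfatou : ∫⁻ x, ENNReal.ofReal ((x ^ k / k.factorial) ^ 2) ∂μ ≤ ENNReal.ofReal C := by
    have h1 : ∀ x, ENNReal.ofReal ((x ^ k / k.factorial) ^ 2) =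
        liminf (fun n => ENNReal.ofReal (g n x)) atTop := fun x =>
      ((ENNReal.continuous_ofReal.tendsto _).comp (hlim x)).liminf_eq.symm
    simp_rw [h1]
    refine (lintegral_liminf_le fun n => by have := (hgc n).measurable; fun_prop).trans ?_
    refine liminf_le_of_le (by isBoundedDefault) fun b hb => ?_
    obtain ⟨n, hn⟩ := hb.exists
    refine hn.trans ?_
    rw [← ofReal_integral_eq_lintegral_ofReal (hgb n)
      (Eventually.of_forall fun x => by simp only [hg]; positivity)]
    exact ENNReal.ofReal_le_ofReal (hgi n)
  have hint : Integrable (fun x : ℝ => (x ^ k / k.factorial) ^ 2) μ := by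
    refine ⟨by fun_prop, ?_⟩
    rw [hasFiniteIntegral_iff_ofReal (Eventually.of_forall fun x => by positivity)]
    exact hfatou.trans_lt ENNReal.ofReal_lt_top
  by_cases hk0 : k = 0
  · subst hk0
    simpa using (by fun_prop : AEStronglyMeasurable (id : ℝ → ℝ) μ)
  have h2 : Integrable (fun x : ℝ => ‖id x‖ ^ (2 * k)) μ := by
    refine (hint.const_mul ((k.factorial : ℝ) ^ 2)).congr (Eventually.of_forall fun x => ?_)
    have : (k.factorial : ℝ) ≠ 0 := by exact_mod_cast k.factorial_ne_zero
    simp only [id, Real.norm_eq_abs, pow_mul, sq_abs]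
    field_simp
    ring
  have := (integrable_norm_rpow_iff (μ := μ) (f := (id : ℝ → ℝ)) (p := ((2 * k : ℕ) : ℝ≥0∞))
    (by fun_prop) (by simpa using hk0) (ENNReal.natCast_ne_top _)).1
  refine this (h2.congr (Eventually.of_forall fun x => ?_))
  simp only [ENNReal.toReal_natCast, Real.rpow_natCast]

end moments

/-! ### Exponential polynomials, atoms and independence of jets. -/

/-- Functions `s ↦ s ^ o * exp (s * z)` with distinct exponents `(z, o)` are linearly
independent on the real line. -/
theorem exp_polynomial_eq_zero {ι : Type*} (s : Finset ι) (o : ι → ℕ) (z b : ι → ℝ)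
    (hinj : ∀ i ∈ s, ∀ j ∈ s, o i = o j → z i = z j → i = j)
    (h : ∀ t : ℝ, ∑ i ∈ s, b i * (t ^ o i * Real.exp (t * z i)) = 0) : ∀ i ∈ s, b i = 0 := by
  classical
  by_contra! hcon
  obtain ⟨i₀, hi₀, hb₀⟩ := hcon
  set s' := s.filter (fun i => b i ≠ 0) with hs'
  have hne : s'.Nonempty := ⟨i₀, by simp [hs', hi₀, hb₀]⟩
  -- The lexicographically largest pair `(z, o)` is the dominant term at `+∞`; dividing by it leaves
  -- its coefficient in the limit.
  obtain ⟨m, hm, hmax⟩ := s'.exists_max_image (fun i => toLex (z i, o i)) hne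
  have hm' : m ∈ s ∧ b m ≠ 0 := by simpa [hs'] using hm
  have hlim : ∀ i ∈ s', Tendsto (fun t : ℝ => b i * (t ^ ((o i : ℝ) - o m) *
      Real.exp (-(z m - z i) * t))) atTop (𝓝 (if i = m then b m else 0)) := by
    intro i hi
    have hi' : i ∈ s ∧ b i ≠ 0 := by simpa [hs'] using hi
    split_ifs with him
    · subst him
      simp
    · rw [← mul_zero (b i)]
      refine Tendsto.const_mul _ ?_
      have hle := hmax i hi
      rw [Prod.Lex.toLex_le_toLex] at hle
      rcases hle with hlt | ⟨heq, hle⟩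
      · exact tendsto_rpow_mul_exp_neg_mul_atTop_nhds_zero _ _ (sub_pos.2 hlt)
      · simp only at heq hle
        have hlt : o i < o m := lt_of_le_of_ne hle fun h => him (hinj i hi'.1 m hm'.1 h heq)
        have e : ∀ t : ℝ, t ^ ((o i : ℝ) - o m) * Real.exp (-(z m - z i) * t) =
            t ^ (-((o m : ℝ) - o i)) := fun t => by simp [heq]
        simp_rw [e]
        exact tendsto_rpow_neg_atTop (sub_pos.2 (by exact_mod_cast hlt))
  have hsum := tendsto_finsetSum s' hlim
  rw [Finset.sum_ite_eq' s' m, if_pos hm] at hsum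
  have hz : Tendsto (fun t : ℝ => ∑ i ∈ s', b i * (t ^ ((o i : ℝ) - o m) *
      Real.exp (-(z m - z i) * t))) atTop (𝓝 0) := by
    refine tendsto_const_nhds.congr' ?_
    filter_upwards [eventually_gt_atTop 0] with t ht
    have e : ∀ i ∈ s', b i * (t ^ ((o i : ℝ) - o m) * Real.exp (-(z m - z i) * t)) =
        b i * (t ^ o i * Real.exp (t * z i)) * (t ^ (-(o m : ℝ)) * Real.exp (-(t * z m))) := by
      intro i _
      have e2 : Real.exp (-(z m - z i) * t) = Real.exp (t * z i) * Real.exp (-(t * z m)) := by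
        rw [← Real.exp_add]; congr 1; ring
      rw [e2, sub_eq_add_neg, Real.rpow_add ht, Real.rpow_natCast]
      ring
    rw [Finset.sum_congr rfl e, ← Finset.sum_mul]
    have : ∑ i ∈ s', b i * (t ^ o i * Real.exp (t * z i)) = 0 := by
      rw [← h t, hs', Finset.sum_filter]
      refine Finset.sum_congr rfl fun i _ => ?_
      split_ifs with hb
      · rfl
      · rw [not_not] at hb; simp [hb]
    rw [this, zero_mul]
  exact hm'.2 (tendsto_nhds_unique hsum hz)

section spectral

variable {μ : Measure ℝ} [IsProbabilityMeasure μ] {κ : ℝ → ℝ}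

/-- A spectral measure has no atoms if the correlation function decays at infinity. -/
theorem measure_singleton_eq_zero (hμ : ∀ t, charFun μ t = κ t)
    (hκ : Tendsto κ atTop (𝓝 0)) (w : ℝ) : μ {w} = 0 := by
  have heven : ∀ t, κ (-t) = κ t := fun t => by
    rw [eq_integral_cos hμ, eq_integral_cos hμ]
    simp
  have hces : Tendsto (fun N : ℕ => 2 * ((N : ℝ)⁻¹ * ∑ p ∈ Finset.range N, |κ p|)) atTop (𝓝 0) := by
    have h1 : Tendsto (fun p : ℕ => |κ p|) atTop (𝓝 0) := by
      simpa using (hκ.comp tendsto_natCast_atTop_atTop).abs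
    simpa using h1.cesaro.const_mul 2
  have hbound : ∀ N : ℕ, 0 < N →
      μ.real {w} ≤ 2 * ((N : ℝ)⁻¹ * ∑ p ∈ Finset.range N, |κ p|) := by
    intro N hN
    have hN' : (0 : ℝ) < N := by exact_mod_cast hN
    -- This is the squared modulus of a mean of exponentials centered at `w`: it is nonnegative and
    -- equals `1` at `w`, so its integral dominates the mass of `w`. The integral is an average of
    -- values of `κ`, controlled by Cesàro means (Wiener's lemma).
    set g : ℝ → ℝ := fun x => (N : ℝ)⁻¹ ^ 2 *
      ((∑ n ∈ Finset.range N, Real.cos (n * (x - w))) ^ 2 +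
       (∑ n ∈ Finset.range N, Real.sin (n * (x - w))) ^ 2) with hg
    have hge : ∀ x, g x = (N : ℝ)⁻¹ ^ 2 * ∑ m ∈ Finset.range N, ∑ n ∈ Finset.range N,
        (Real.cos (((m : ℝ) - n) * w) * Real.cos (((m : ℝ) - n) * x) +
          Real.sin (((m : ℝ) - n) * w) * Real.sin (((m : ℝ) - n) * x)) := by
      intro x
      simp only [hg]
      congr 1
      rw [sq, sq, Finset.sum_mul_sum, Finset.sum_mul_sum, ← Finset.sum_add_distrib]
      refine Finset.sum_congr rfl fun m _ => ?_
      rw [← Finset.sum_add_distrib]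
      refine Finset.sum_congr rfl fun n _ => ?_
      rw [← Real.cos_sub, ← Real.cos_sub, ← Real.cos_neg]
      congr 1
      ring
    have hsin : ∀ t : ℝ, Integrable (fun x : ℝ => Real.sin (t * x)) μ := fun t =>
      Integrable.of_bound (by fun_prop) 1 (Eventually.of_forall fun x => Real.abs_sin_le_one _)
    have hsin0 : ∀ t : ℝ, ∫ x, Real.sin (t * x) ∂μ = 0 := fun t => by
      have h := congrArg Complex.im (hμ t)
      rw [Complex.ofReal_im, charFun_apply_real, ← RCLike.im_eq_complex_im,
        ← integral_im (integrable_exp_mul_I t)] at h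
      rw [← h]
      refine integral_congr_ae (Eventually.of_forall fun x => ?_)
      have : (t * x * Complex.I : ℂ) = ((t * x : ℝ) : ℂ) * Complex.I := by push_cast; ring
      simp only [this, RCLike.im_eq_complex_im, Complex.exp_ofReal_mul_I_im]
    have hterm : ∀ m n : ℕ, Integrable (fun x : ℝ =>
        Real.cos (((m : ℝ) - n) * w) * Real.cos (((m : ℝ) - n) * x) +
          Real.sin (((m : ℝ) - n) * w) * Real.sin (((m : ℝ) - n) * x)) μ := fun m n =>
      ((integrable_cos_mul _).const_mul _).add ((hsin _).const_mul _)
    have hgi : ∫ x, g x ∂μ = (N : ℝ)⁻¹ ^ 2 * ∑ m ∈ Finset.range N, ∑ n ∈ Finset.range N,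
        Real.cos (((m : ℝ) - n) * w) * κ (m - n) := by
      simp_rw [hge]
      rw [integral_const_mul, integral_finsetSum _ fun m _ =>
        integrable_finsetSum _ fun n _ => hterm m n]
      congr 1
      refine Finset.sum_congr rfl fun m _ => ?_
      rw [integral_finsetSum _ fun n _ => hterm m n]
      refine Finset.sum_congr rfl fun n _ => ?_
      rw [integral_add ((integrable_cos_mul _).const_mul _) ((hsin _).const_mul _),
        integral_const_mul, integral_const_mul, hsin0, mul_zero, add_zero, ← eq_integral_cos hμ]
    have hgint : Integrable g μ := by
      rw [funext hge]
      exact (integrable_finsetSum _ fun m _ => integrable_finsetSum _ fun n _ =>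
        hterm m n).const_mul _
    have h1 : μ.real {w} ≤ ∫ x, g x ∂μ := by
      have hgw : g w = 1 := by
        simp only [hg, sub_self, mul_zero, Real.cos_zero, Real.sin_zero]
        simp
        field_simp
      have h2 := mul_meas_ge_le_integral_of_nonneg
        (Eventually.of_forall fun x => by simp only [hg]; positivity) hgint 1
      rw [one_mul] at h2
      refine le_trans (measureReal_mono (by simpa using hgw.ge) (measure_ne_top _ _)) h2
    rw [hgi] at h1
    refine h1.trans ?_
    have h3 : ∀ m ∈ Finset.range N, ∑ n ∈ Finset.range N,
        Real.cos (((m : ℝ) - n) * w) * κ (m - n) ≤ 2 * ∑ p ∈ Finset.range N, |κ p| := by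
      intro m hm
      have h4 : ∀ n : ℕ, Real.cos (((m : ℝ) - n) * w) * κ (m - n) ≤ |κ ((m : ℝ) - n)| := fun n => by
        refine (le_abs_self _).trans ?_
        rw [abs_mul]
        exact mul_le_of_le_one_left (abs_nonneg _) (Real.abs_cos_le_one _)
      refine (Finset.sum_le_sum fun n _ => h4 n).trans ?_
      rw [two_mul, ← Finset.sum_filter_add_sum_filter_not (Finset.range N) (fun n => n ≤ m)]
      have hmN := Finset.mem_range.1 hm
      refine add_le_add ?_ ?_
      · have : ∑ n ∈ (Finset.range N).filter (fun n => n ≤ m), |κ ((m : ℝ) - n)| =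
            ∑ p ∈ ((Finset.range N).filter (fun n => n ≤ m)).image (fun n => m - n), |κ p| := by
          rw [Finset.sum_image]
          · refine Finset.sum_congr rfl fun n hn => ?_
            rw [Nat.cast_sub (Finset.mem_filter.1 hn).2]
          · intro a ha b hb hab
            have h1 := (Finset.mem_filter.1 ha).2
            have h2 := (Finset.mem_filter.1 hb).2
            simp only at hab
            omega
        rw [this]
        refine Finset.sum_le_sum_of_subset_of_nonneg ?_ fun _ _ _ => abs_nonneg _
        intro p hp
        obtain ⟨n, hn, rfl⟩ := Finset.mem_image.1 hp
        exact Finset.mem_range.2 (by omega)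
      · have : ∑ n ∈ (Finset.range N).filter (fun n => ¬ n ≤ m), |κ ((m : ℝ) - n)| =
            ∑ p ∈ ((Finset.range N).filter (fun n => ¬ n ≤ m)).image (fun n => n - m), |κ p| := by
          rw [Finset.sum_image]
          · refine Finset.sum_congr rfl fun n hn => ?_
            have := (Finset.mem_filter.1 hn).2
            rw [Nat.cast_sub (by omega), ← heven, neg_sub]
          · intro a ha b hb hab
            have h1 := (Finset.mem_filter.1 ha).2
            have h2 := (Finset.mem_filter.1 hb).2
            simp only at hab
            omega
        rw [this]
        refine Finset.sum_le_sum_of_subset_of_nonneg ?_ fun _ _ _ => abs_nonneg _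
        intro p hp
        obtain ⟨n, hn, rfl⟩ := Finset.mem_image.1 hp
        have := Finset.mem_range.1 (Finset.mem_filter.1 hn).1
        exact Finset.mem_range.2 (by omega)
    have h5 := Finset.sum_le_sum h3
    rw [Finset.sum_const, Finset.card_range, nsmul_eq_mul] at h5
    calc _ ≤ (N : ℝ)⁻¹ ^ 2 * (N * (2 * ∑ p ∈ Finset.range N, |κ p|)) := by gcongr
      _ = _ := by field_simp
  have h6 : μ.real {w} ≤ 0 := ge_of_tendsto hces (by
    filter_upwards [eventually_gt_atTop 0] with N hN using hbound N hN)
  have h7 : μ.real {w} = 0 := le_antisymm h6 measureReal_nonneg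
  rwa [measureReal_eq_zero_iff] at h7

/-- Exponential polynomials vanishing almost everywhere for a measure without atoms are trivial. -/
theorem exp_polynomial_eq_zero_of_ae (hat : ∀ w, μ {w} = 0) {ι : Type*}
    (s : Finset ι) (o : ι → ℕ) (z b : ι → ℝ)
    (hinj : ∀ i ∈ s, ∀ j ∈ s, o i = o j → z i = z j → i = j)
    (h : ∀ᵐ x : ℝ ∂μ, ∑ i ∈ s, (b i : ℂ) * ((x * Complex.I) ^ o i * Complex.exp (x * Complex.I * z i))
      = 0) : ∀ i ∈ s, b i = 0 := by
  set G : ℂ → ℂ := fun w => ∑ i ∈ s, (b i : ℂ) * (w ^ o i * Complex.exp (w * z i)) with hG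
  have hGd : Differentiable ℂ G := by
    simp only [hG]; fun_prop
  have hGa : AnalyticOnNhd ℂ G univ := hGd.differentiableOn.analyticOnNhd isOpen_univ
  have hNA : NullSingletonClass μ := ⟨hat⟩
  have hpos : μ {x : ℝ | G (x * Complex.I) = 0} ≠ 0 := by
    have : μ {x : ℝ | G (x * Complex.I) = 0} = 1 := by
      rw [← measure_univ (μ := μ)]
      refine le_antisymm (measure_mono (subset_univ _)) (measure_mono_ae ?_)
      filter_upwards [h] with x hx _ using hx
    rw [this]; exact one_ne_zero
  -- A set of positive mass for an atomless measure has an accumulation point, so the entire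
  -- function `G` vanishes identically by the identity theorem and can be evaluated at real
  -- arguments.
  obtain ⟨x₀, hx₀⟩ := exists_accPt_of_nullSingletonClass (pos_iff_ne_zero.2 hpos)
  rw [accPt_iff_frequently] at hx₀
  have hfreq : ∃ᶠ w in 𝓝[≠] ((x₀ : ℂ) * Complex.I), G w = 0 := by
    rw [frequently_nhdsWithin_iff]
    have hc : Tendsto (fun x : ℝ => (x : ℂ) * Complex.I) (𝓝 x₀) (𝓝 ((x₀ : ℂ) * Complex.I)) :=
      (by fun_prop : Continuous fun x : ℝ => (x : ℂ) * Complex.I).tendsto x₀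
    refine hc.frequently (hx₀.mono fun x hx => ⟨hx.2, ?_⟩)
    intro heq
    have := mul_right_cancel₀ Complex.I_ne_zero heq
    exact hx.1 (by exact_mod_cast this)
  have hzero := hGa.eqOn_zero_of_preconnected_of_frequently_eq_zero isPreconnected_univ
    (mem_univ _) hfreq
  refine exp_polynomial_eq_zero s o z b hinj fun t => ?_
  have h1 : G t = 0 := hzero (mem_univ (t : ℂ))
  simp only [hG] at h1
  exact_mod_cast h1

/-- Formally, the derivative of order `o` of the process at `z` corresponds to `(i x)^o exp (i x z)`
in `L²(μ)`, and the entry attached to `i, j` is the covariance of two such derivatives. The moment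
of order `2k` allows all orders up to `k`, including jets whose orders exceed the differentiability
shown for the curve. -/
theorem spectral_form_eq_integral (hμ : ∀ t, charFun μ t = κ t) {k : ℕ}
    (hm : MemLp id ((2 * k : ℕ) : ℝ≥0∞) μ) {ι : Type*} (s : Finset ι) (o : ι → ℕ) (z b : ι → ℝ)
    (ho : ∀ i ∈ s, o i ≤ k) :
    Integrable (fun x : ℝ => ‖∑ i ∈ s, (b i : ℂ) *
      ((x * Complex.I) ^ o i * Complex.exp (x * Complex.I * z i))‖ ^ 2) μ ∧
    ∑ i ∈ s, ∑ j ∈ s, b i * b j * ((-1) ^ o j * iteratedDeriv (o i + o j) κ (z i - z j)) =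
      ∫ x : ℝ, ‖∑ i ∈ s, (b i : ℂ) *
        ((x * Complex.I) ^ o i * Complex.exp (x * Complex.I * z i))‖ ^ 2 ∂μ := by
  have hint : ∀ i ∈ s, ∀ j ∈ s, Integrable (fun x : ℝ => b i * b j * ((-1) ^ o j *
      (x ^ (o i + o j) * Real.cos ((z i - z j) * x + (o i + o j : ℕ) * (Real.pi / 2))))) μ := by
    intro i hi j hj
    have hmj : MemLp id ((o i + o j : ℕ) : ℝ≥0∞) μ := hm.mono_exponent (by
      have := ho i hi
      have := ho j hj
      exact_mod_cast (by omega))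
    have h2 : Integrable (fun x : ℝ => ‖x‖ ^ (o i + o j)) μ := by
      simpa using hmj.integrable_norm_pow'
    refine ((h2.mono' (by fun_prop) (Eventually.of_forall fun x => ?_)).const_mul _).const_mul _
    rw [norm_mul, norm_pow]
    exact mul_le_of_le_one_right (by positivity) (Real.abs_cos_le_one _)
  have e : ∀ x : ℝ, ‖∑ i ∈ s, (b i : ℂ) *
        ((x * Complex.I) ^ o i * Complex.exp (x * Complex.I * z i))‖ ^ 2 =
      ∑ i ∈ s, ∑ j ∈ s, b i * b j * ((-1) ^ o j *
      (x ^ (o i + o j) * Real.cos ((z i - z j) * x + (o i + o j : ℕ) * (Real.pi / 2)))) := by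
    intro x
    have e1 : ∀ i, (b i : ℂ) * ((x * Complex.I) ^ o i * Complex.exp (x * Complex.I * z i)) =
        ((b i * x ^ o i : ℝ) : ℂ) *
          Complex.exp ((x * z i + o i * (Real.pi / 2) : ℝ) * Complex.I) := by
      intro i
      have hI : Complex.I ^ o i = Complex.exp ((o i * (Real.pi / 2) : ℝ) * Complex.I) := by
        rw [Complex.ofReal_mul, mul_assoc, Complex.ofReal_natCast, Complex.exp_nat_mul]
        congr 1
        push_cast
        rw [Complex.exp_pi_div_two_mul_I]
      rw [mul_pow, hI, Complex.ofReal_add, add_mul, Complex.exp_add]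
      push_cast
      ring_nf
    simp_rw [e1]
    rw [← Complex.normSq_eq_norm_sq, Complex.normSq_apply, Complex.re_sum, Complex.im_sum]
    simp_rw [Complex.re_ofReal_mul, Complex.im_ofReal_mul, Complex.exp_ofReal_mul_I_re,
      Complex.exp_ofReal_mul_I_im]
    rw [Finset.sum_mul_sum, Finset.sum_mul_sum, ← Finset.sum_add_distrib]
    refine Finset.sum_congr rfl fun i _ => ?_
    rw [← Finset.sum_add_distrib]
    refine Finset.sum_congr rfl fun j _ => ?_
    have e2 : Real.cos ((z i - z j) * x + (o i + o j : ℕ) * (Real.pi / 2)) =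
        (-1) ^ o j * Real.cos ((x * z i + o i * (Real.pi / 2)) - (x * z j + o j * (Real.pi / 2))) := by
      rw [← Real.cos_add_nat_mul_pi]
      congr 1
      push_cast
      ring
    have e3 : ((-1 : ℝ) ^ o j) * (-1) ^ o j = 1 := by
      rw [← mul_pow]; simp
    rw [e2, Real.cos_sub, pow_add]
    linear_combination (-(b i * b j * x ^ o i * x ^ o j *
      (Real.cos (x * z i + o i * (Real.pi / 2)) * Real.cos (x * z j + o j * (Real.pi / 2)) +
       Real.sin (x * z i + o i * (Real.pi / 2)) * Real.sin (x * z j + o j * (Real.pi / 2))))) * e3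
  simp_rw [e]
  refine ⟨integrable_finsetSum _ fun i hi => integrable_finsetSum _ fun j hj => hint i hi j hj, ?_⟩
  rw [integral_finsetSum _ fun i hi => integrable_finsetSum _ fun j hj => hint i hi j hj]
  refine Finset.sum_congr rfl fun i hi => ?_
  rw [integral_finsetSum _ fun j hj => hint i hi j hj]
  refine Finset.sum_congr rfl fun j hj => ?_
  rw [integral_const_mul, integral_const_mul, iteratedDeriv_eq_integral hμ hm _ (by
    have := ho i hi
    have := ho j hj
    omega)]

theorem spectral_form_nonneg (hμ : ∀ t, charFun μ t = κ t) {k : ℕ}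
    (hm : MemLp id ((2 * k : ℕ) : ℝ≥0∞) μ) {ι : Type*} (s : Finset ι) (o : ι → ℕ) (z b : ι → ℝ)
    (ho : ∀ i ∈ s, o i ≤ k) :
    0 ≤ ∑ i ∈ s, ∑ j ∈ s, b i * b j * ((-1) ^ o j * iteratedDeriv (o i + o j) κ (z i - z j)) := by
  rw [(spectral_form_eq_integral hμ hm s o z b ho).2]
  exact integral_nonneg fun x => by positivity

/-- If the form vanishes, the exponential polynomial is zero almost everywhere for a measure without
atoms, hence trivial. This is the qualitative nondegeneracy that compactness makes uniform. -/
theorem eq_zero_of_spectral_form_eq_zero (hμ : ∀ t, charFun μ t = κ t)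
    (hκ : Tendsto κ atTop (𝓝 0)) {k : ℕ}
    (hm : MemLp id ((2 * k : ℕ) : ℝ≥0∞) μ) {ι : Type*} (s : Finset ι) (o : ι → ℕ) (z b : ι → ℝ)
    (ho : ∀ i ∈ s, o i ≤ k) (hinj : ∀ i ∈ s, ∀ j ∈ s, o i = o j → z i = z j → i = j)
    (h : ∑ i ∈ s, ∑ j ∈ s, b i * b j * ((-1) ^ o j * iteratedDeriv (o i + o j) κ (z i - z j)) = 0) :
    ∀ i ∈ s, b i = 0 := by
  obtain ⟨hi, he⟩ := spectral_form_eq_integral hμ hm s o z b ho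
  rw [he, integral_eq_zero_iff_of_nonneg (fun x => by positivity) hi] at h
  refine exp_polynomial_eq_zero_of_ae (measure_singleton_eq_zero hμ hκ) s o z b hinj ?_
  filter_upwards [h] with x hx
  simpa using hx

end spectral

/-! ### Uniform nondegeneracy by compactness. -/

theorem contDiff_iteratedDeriv_of_add {n j l : ℕ} {φ : ℝ → ℝ} (hφ : ContDiff ℝ n φ)
    (h : l + j ≤ n) : ContDiff ℝ l (iteratedDeriv j φ) := by
  rw [iteratedDeriv_eq_iterate]
  exact ContDiff.iterate_deriv' l j (hφ.of_le (by exact_mod_cast h))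

theorem iteratedDeriv_iteratedDeriv (j l : ℕ) (φ : ℝ → ℝ) :
    iteratedDeriv l (iteratedDeriv j φ) = iteratedDeriv (j + l) φ := by
  simp only [iteratedDeriv_eq_iterate]
  rw [add_comm, Function.iterate_add_apply]

/-- Derivatives of the function `t ↦ ∑ i, a i * κ (t - y i)`. -/
theorem iteratedDeriv_sum_mul_comp_sub {n : ℕ} {κ : ℝ → ℝ} (hκ : ContDiff ℝ n κ) {ι : Type*}
    (s : Finset ι) (a y : ι → ℝ) {j : ℕ} (hj : j ≤ n) (t : ℝ) :
    iteratedDeriv j (fun t => ∑ i ∈ s, a i * κ (t - y i)) t =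
      ∑ i ∈ s, a i * iteratedDeriv j κ (t - y i) := by
  have hc : ∀ i, ContDiff ℝ j (fun t => a i * κ (t - y i)) := fun i =>
    contDiff_const.mul ((hκ.of_le (by exact_mod_cast hj)).comp (contDiff_id.sub contDiff_const))
  rw [iteratedDeriv_fun_sum fun i _ => (hc i).contDiffAt]
  refine Finset.sum_congr rfl fun i _ => ?_
  rw [iteratedDeriv_const_mul_field, iteratedDeriv_comp_sub_const]

/-- Mean value theorem for divided differences of `κ (x - y)` in both variables. -/
theorem exists_double_dividedDifference_eq {n : ℕ} {κ : ℝ → ℝ} (hκ : ContDiff ℝ n κ)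
    {ι : Type*} [DecidableEq ι] (s t : Finset ι) (hs : s.Nonempty) (ht : t.Nonempty)
    (v : ι → ℝ) (hv : Function.Injective v) (hn : (s.card - 1) + (t.card - 1) ≤ n) :
    ∃ ξ τ : ℝ, (∃ i ∈ s, ∃ j ∈ s, ξ ∈ Icc (v i) (v j)) ∧ (∃ i ∈ t, ∃ j ∈ t, τ ∈ Icc (v i) (v j)) ∧
      dividedDifference s v (fun x => dividedDifference t v (fun y => κ (x - y))) =
        (-1) ^ (t.card - 1) * iteratedDeriv ((s.card - 1) + (t.card - 1)) κ (ξ - τ) /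
          ((s.card - 1).factorial * (t.card - 1).factorial) := by
  have hg : ContDiff ℝ (s.card - 1 : ℕ) (fun x => dividedDifference t v (fun y => κ (x - y))) := by
    unfold dividedDifference
    refine ContDiff.sum fun i _ => contDiff_const.mul
      ((hκ.of_le (by exact_mod_cast (by omega))).comp (contDiff_id.sub contDiff_const))
  obtain ⟨i, hi, j, hj, ξ, hξ, he⟩ := exists_dividedDifference_eq s hs v hv.injOn _ hg
  have h1 : iteratedDeriv (s.card - 1) (fun x => dividedDifference t v (fun y => κ (x - y))) ξ =
      dividedDifference t v (fun y => iteratedDeriv (s.card - 1) κ (ξ - y)) := by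
    unfold dividedDifference
    exact iteratedDeriv_sum_mul_comp_sub hκ t _ v (by omega) ξ
  have hg2 : ContDiff ℝ (t.card - 1 : ℕ) (fun y => iteratedDeriv (s.card - 1) κ (ξ - y)) :=
    (contDiff_iteratedDeriv_of_add hκ (by omega)).comp (contDiff_const.sub contDiff_id)
  obtain ⟨i', hi', j', hj', τ, hτ, he'⟩ := exists_dividedDifference_eq t ht v hv.injOn _ hg2
  refine ⟨ξ, τ, ⟨i, hi, j, hj, hξ⟩, ⟨i', hi', j', hj', hτ⟩, ?_⟩
  rw [he, h1, he', iteratedDeriv_comp_const_sub]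
  simp only [iteratedDeriv_iteratedDeriv, smul_eq_mul]
  rw [div_div, mul_comm ((t.card - 1).factorial : ℝ)]

/-- Every sequence of finite configurations has a subsequence along which each difference of two
points converges or tends to infinity. -/
theorem exists_subseq_differences {m : ℕ} (x : ℕ → Fin m → ℝ) :
    ∃ ψ : ℕ → ℕ, StrictMono ψ ∧ ∀ i j,
      (∃ d : ℝ, Tendsto (fun n => x (ψ n) i - x (ψ n) j) atTop (𝓝 d)) ∨
        Tendsto (fun n => x (ψ n) i - x (ψ n) j) atTop (Bornology.cobounded ℝ) := by
  -- All differences are taken in the compact space of extended reals; an infinite limit means that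
  -- the two points separate.
  obtain ⟨D, ψ, hψ, hD⟩ := SeqCompactSpace.tendsto_subseq
    (fun n (p : Fin m × Fin m) => ((x n p.1 - x n p.2 : ℝ) : EReal))
  refine ⟨ψ, hψ, fun i j => ?_⟩
  have h := (tendsto_pi_nhds.1 hD) (i, j)
  simp only [Function.comp_def] at h
  induction hd : D (i, j) with
  | bot =>
    right
    rw [hd, EReal.tendsto_coe_nhds_bot_iff] at h
    exact h.mono_right (by rw [IsOrderBornology.cobounded_eq]; exact le_sup_left)
  | top =>
    right
    rw [hd, EReal.tendsto_coe_nhds_top_iff] at h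
    exact h.mono_right (by rw [IsOrderBornology.cobounded_eq]; exact le_sup_right)
  | coe d =>
    left
    rw [hd, EReal.tendsto_coe] at h
    exact ⟨d, h⟩

section

variable {μ : Measure ℝ} [IsProbabilityMeasure μ] {κ : ℝ → ℝ}

/-- The limit of the Gram matrices of divided differences, for several clusters escaping from each
other, is positive definite. -/
theorem eq_zero_of_block_form_nonpos (hμ : ∀ t, charFun μ t = κ t)
    (hκ : Tendsto κ atTop (𝓝 0)) {k : ℕ} (hm : MemLp id ((2 * k : ℕ) : ℝ≥0∞) μ)
    {ι γ : Type*} [Fintype ι] [DecidableEq γ] (c : ι → γ) (o : ι → ℕ) (z b : ι → ℝ)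
    (ho : ∀ i, o i ≤ k) (hinj : ∀ i j, c i = c j → o i = o j → z i = z j → i = j)
    (h : ∑ i, ∑ j, b i * b j * (if c i = c j then
      (-1) ^ o j * iteratedDeriv (o i + o j) κ (z i - z j) / ((o i).factorial * (o j).factorial)
        else 0) ≤ 0) : ∀ i, b i = 0 := by
  classical
  set b' : ι → ℝ := fun i => b i / (o i).factorial with hb'
  set Q : γ → ℝ := fun g => ∑ i with c i = g, ∑ j with c j = g,
    b' i * b' j * ((-1) ^ o j * iteratedDeriv (o i + o j) κ (z i - z j)) with hQ
  have hQ0 : ∀ g, 0 ≤ Q g := fun g => spectral_form_nonneg hμ hm _ o z b' fun i _ => ho i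
  have hsum : ∑ i, ∑ j, b i * b j * (if c i = c j then
      (-1) ^ o j * iteratedDeriv (o i + o j) κ (z i - z j) / ((o i).factorial * (o j).factorial)
        else 0) = ∑ g ∈ Finset.univ.image c, Q g := by
    rw [← Finset.sum_fiberwise_of_maps_to (g := c) (t := Finset.univ.image c)
      (fun i _ => Finset.mem_image_of_mem c (Finset.mem_univ i))]
    refine Finset.sum_congr rfl fun g _ => ?_
    simp only [hQ]
    refine Finset.sum_congr rfl fun i hi => ?_
    have hci : c i = g := (Finset.mem_filter.1 hi).2
    rw [Finset.sum_filter]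
    refine Finset.sum_congr rfl fun j _ => ?_
    rw [hci]
    by_cases hg : c j = g
    · rw [if_pos hg, if_pos hg.symm]
      simp only [hb']
      field_simp
    · rw [if_neg hg, if_neg (Ne.symm hg), mul_zero]
  rw [hsum] at h
  have hz := (Finset.sum_eq_zero_iff_of_nonneg fun g _ => hQ0 g).1
    (le_antisymm h (Finset.sum_nonneg fun g _ => hQ0 g))
  intro i
  have hi := eq_zero_of_spectral_form_eq_zero hμ hκ hm (Finset.univ.filter fun j => c j = c i) o z b'
    (fun i _ => ho i) (fun p hp q hq h1 h2 => hinj p q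
      ((Finset.mem_filter.1 hp).2.trans (Finset.mem_filter.1 hq).2.symm) h1 h2)
    (hz (c i) (Finset.mem_image_of_mem c (Finset.mem_univ i))) i (by simp)
  have hf : ((o i).factorial : ℝ) ≠ 0 := by exact_mod_cast (o i).factorial_ne_zero
  simpa [hb', hf] using hi

/-- Newton coordinates: combinations of point evaluations expressed with divided differences over
initial segments of classes of indices. -/
theorem exists_newton_coordinates {m : ℕ} (S : Fin m → Finset (Fin m)) (hS : ∀ i, i ∈ S i)
    (hS' : ∀ i, ∀ j ∈ S i, j ≤ i) (v : Fin m → ℝ) (hv : Function.Injective v) (a : Fin m → ℝ) :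
    ∃ b : Fin m → ℝ, ∀ φ : ℝ → ℝ,
      ∑ j, a j * φ (v j) = ∑ i, b i * dividedDifference (S i) v φ := by
  classical
  -- The rows are the coefficients of the divided differences. The matrix is lower triangular, as `S
  -- i` only contains indices up to `i`, with nonzero diagonal, so the coordinates are `a T⁻¹`.
  set T : Matrix (Fin m) (Fin m) ℝ := Matrix.of fun i j =>
    if j ∈ S i then (∏ l ∈ (S i).erase j, (v j - v l))⁻¹ else 0 with hT
  have htri : T.IsLowerTriangular := by
    intro i j hij
    have hij' : i < j := by simpa using hij
    simp only [hT, Matrix.of_apply]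
    rw [if_neg fun h => absurd (hS' i j h) (not_le.2 hij')]
  have hdet : T.det ≠ 0 := by
    rw [Matrix.det_of_isLowerTriangular _ htri]
    refine Finset.prod_ne_zero_iff.2 fun i _ => ?_
    simp only [hT, Matrix.of_apply, if_pos (hS i)]
    refine inv_ne_zero (Finset.prod_ne_zero_iff.2 fun l hl => sub_ne_zero.2 fun h => ?_)
    exact (Finset.mem_erase.1 hl).1 (hv h).symm
  refine ⟨Matrix.vecMul a T⁻¹, fun φ => ?_⟩
  set b := Matrix.vecMul a T⁻¹
  have hb : Matrix.vecMul b T = a := by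
    rw [Matrix.vecMul_vecMul, Matrix.nonsing_inv_mul _ (isUnit_iff_ne_zero.2 hdet),
      Matrix.vecMul_one]
  have hdd : ∀ i, dividedDifference (S i) v φ = ∑ j, T i j * φ (v j) := by
    intro i
    rw [dividedDifference, ← Finset.sum_filter_add_sum_filter_not Finset.univ (fun j => j ∈ S i)]
    rw [Finset.filter_mem_eq_inter, Finset.univ_inter]
    rw [Finset.sum_eq_zero (s := Finset.univ.filter fun j => j ∉ S i), add_zero]
    · refine Finset.sum_congr rfl fun j hj => ?_
      simp only [hT, Matrix.of_apply, if_pos hj]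
    · intro j hj
      simp only [hT, Matrix.of_apply, if_neg (Finset.mem_filter.1 hj).2, zero_mul]
  simp_rw [hdd, Finset.mul_sum]
  rw [Finset.sum_comm]
  refine Finset.sum_congr rfl fun j _ => ?_
  rw [← hb]
  simp only [Matrix.vecMul, dotProduct]
  rw [Finset.sum_mul]
  exact Finset.sum_congr rfl fun i _ => by ring

end

theorem dividedDifference_sum {ι γ : Type*} [DecidableEq ι] (s : Finset ι) (v : ι → ℝ)
    (t : Finset γ) (b : γ → ℝ) (g : γ → ℝ → ℝ) :
    dividedDifference s v (fun u => ∑ j ∈ t, b j * g j u) =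
      ∑ j ∈ t, b j * dividedDifference s v (g j) := by
  simp only [dividedDifference, Finset.mul_sum]
  rw [Finset.sum_comm]
  exact Finset.sum_congr rfl fun j _ => Finset.sum_congr rfl fun i _ => by ring

theorem tendsto_of_mem_Icc_family {ι : Type*} (S : Finset ι) {y : ℕ → ι → ℝ} {i : ι}
    (h : ∀ j ∈ S, Tendsto (fun n => y n j - y n i) atTop (𝓝 0)) {ξ : ℕ → ℝ}
    (hξ : ∀ n, ∃ p ∈ S, ∃ q ∈ S, ξ n ∈ Icc (y n p) (y n q)) :
    Tendsto (fun n => ξ n - y n i) atTop (𝓝 0) := by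
  have hz : Tendsto (fun n => ∑ j ∈ S, |y n j - y n i|) atTop (𝓝 0) := by
    simpa using tendsto_finsetSum S fun j hj => (h j hj).abs
  refine squeeze_zero_norm (fun n => ?_) hz
  obtain ⟨p, hp, q, hq, h1, h2⟩ := hξ n
  have hp' := Finset.single_le_sum (f := fun j => |y n j - y n i|) (fun j _ => abs_nonneg _) hp
  have hq' := Finset.single_le_sum (f := fun j => |y n j - y n i|) (fun j _ => abs_nonneg _) hq
  rw [Real.norm_eq_abs, abs_le]
  constructor
  · have := neg_abs_le (y n p - y n i)
    linarith
  · have := le_abs_self (y n q - y n i)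
    linarith

section

variable {μ : Measure ℝ} [IsProbabilityMeasure μ] {κ : ℝ → ℝ}

/-- Uniform nondegeneracy: the pairing of a measure supported on at most `k + 1` points with a
function that has bounded derivatives near clusters of these points is controlled by the norm of
the corresponding combination of values of the process. -/
theorem exists_duality_bound (hμ : ∀ t, charFun μ t = κ t) {k : ℕ}
    (hm : MemLp id ((2 * k : ℕ) : ℝ≥0∞) μ)
    (hdec : ∀ j ≤ k, Tendsto (iteratedDeriv j κ) (Bornology.cobounded ℝ) (𝓝 0))
    {m : ℕ} (hmk : m ≤ k + 1) :
    ∃ C : ℝ, 0 < C ∧ ∀ (x : Fin m → ℝ), Function.Injective x → ∀ (a : Fin m → ℝ) (φ : ℝ → ℝ)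
      (M : ℝ), ContDiff ℝ k φ →
      (∀ j < m, ∀ p q, x q - x p ≤ 1 / 2 → ∀ t ∈ Icc (x p) (x q), |iteratedDeriv j φ t| ≤ M) →
      |∑ i, a i * φ (x i)| ≤ C * M * √(∑ i, ∑ j, a i * a j * κ (x i - x j)) := by
  classical
  have hκc : ContDiff ℝ (2 * k : ℕ) κ := contDiff_of_spectral hμ hm
  have hκ0 : Tendsto κ atTop (𝓝 0) := by
    have := hdec 0 (Nat.zero_le _)
    rw [iteratedDeriv_zero] at this
    refine this.mono_left ?_
    rw [IsOrderBornology.cobounded_eq]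
    exact le_sup_right
  rcases Nat.eq_zero_or_pos m with rfl | hmpos
  · exact ⟨1, one_pos, fun x _ a φ M _ _ => by simp⟩
  by_contra! hcon
  -- For every `n` there is a counterexample to the bound with constant `n + 1`.
  choose x hx a φ M hφ hM hlt using fun n : ℕ => hcon (n + 1) (by positivity)
  obtain ⟨ψ, hψ, hdiff⟩ := exists_subseq_differences x
  set y : ℕ → Fin m → ℝ := fun n => x (ψ n) with hy
  have hyinj : ∀ n, Function.Injective (y n) := fun n => hx (ψ n)
  -- Clusters are the classes of indices whose mutual differences converge. Positions inside a
  -- cluster are measured from a representative and converge to `z`.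
  let st : Setoid (Fin m) :=
    { r := fun i j => ∃ d : ℝ, Tendsto (fun n => y n i - y n j) atTop (𝓝 d)
      iseqv :=
        { refl := fun i => ⟨0, by simp⟩
          symm := by
            rintro i j ⟨d, hd⟩
            exact ⟨-d, by simpa using hd.neg⟩
          trans := by
            rintro i j l ⟨d, hd⟩ ⟨e, he⟩
            exact ⟨d + e, by simpa using hd.add he⟩ } }
  let c : Fin m → Quotient st := fun i => Quotient.mk st i
  have hrep : ∀ i, ∃ d : ℝ, Tendsto (fun n => y n i - y n (c i).out) atTop (𝓝 d) := fun i =>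
    st.symm (Quotient.mk_out (s := st) i)
  choose z hz using hrep
  have hsame : ∀ i j, c i = c j → Tendsto (fun n => y n i - y n j) atTop (𝓝 (z i - z j)) := by
    intro i j hij
    have h1 := hz i
    rw [hij] at h1
    simpa using h1.sub (hz j)
  have hfar : ∀ i j, c i ≠ c j →
      Tendsto (fun n => y n i - y n j) atTop (Bornology.cobounded ℝ) := by
    intro i j hij
    rcases hdiff i j with h | h
    · exact absurd (Quotient.sound (s := st) h) hij
    · exact h
  -- `S i` collects the indices up to `i` that collapse onto the same limit point as `i`. A divided
  -- difference over `S i` tends to a derivative of order `o i` divided by `(o i)!`, and the orders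
  -- at one limit point are distinct.
  set S : Fin m → Finset (Fin m) := fun i =>
    Finset.univ.filter fun j => j ≤ i ∧ c j = c i ∧ z j = z i with hSdef
  have hSmem : ∀ i j, j ∈ S i ↔ j ≤ i ∧ c j = c i ∧ z j = z i := fun i j => by simp [hSdef]
  have hSi : ∀ i, i ∈ S i := fun i => by simp [hSmem]
  have hSne : ∀ i, (S i).Nonempty := fun i => ⟨i, hSi i⟩
  have hnear : ∀ i, ∀ j ∈ S i, Tendsto (fun n => y n j - y n i) atTop (𝓝 0) := by
    intro i j hj
    obtain ⟨-, h1, h2⟩ := (hSmem i j).1 hj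
    simpa [h2] using hsame j i h1
  set o : Fin m → ℕ := fun i => (S i).card - 1 with ho
  have hcard : ∀ i, (S i).card = o i + 1 := fun i => by
    have := (hSne i).card_pos
    simp only [ho]; omega
  have hom : ∀ i, o i < m := fun i => by
    have h1 := (S i).card_le_univ
    rw [Fintype.card_fin] at h1
    have := hcard i
    omega
  have hok : ∀ i, o i ≤ k := fun i => by have := hom i; omega
  have hinj : ∀ i j, c i = c j → o i = o j → z i = z j → i = j := by
    have key : ∀ i j, i < j → c i = c j → z i = z j → o i < o j := by
      intro i j hij hc hzz
      have hss : S i ⊂ S j := by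
        refine (Finset.ssubset_iff_of_subset fun l hl => ?_).2 ⟨j, hSi j, fun h => ?_⟩
        · obtain ⟨h1, h2, h3⟩ := (hSmem i l).1 hl
          exact (hSmem j l).2 ⟨h1.trans hij.le, h2.trans hc, h3.trans hzz⟩
        · exact absurd ((hSmem i j).1 h).1 (not_le.2 hij)
      have := Finset.card_lt_card hss
      rw [hcard, hcard] at this
      omega
    intro i j hc hoo hzz
    rcases lt_trichotomy i j with h | h | h
    · have := key i j h hc hzz; omega
    · exact h
    · have := key j i h hc.symm hzz.symm; omega
  choose b hb using fun n => exists_newton_coordinates S hSi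
    (fun i j hj => ((hSmem i j).1 hj).1) (y n) (hyinj n) (a (ψ n))
  set G : ℕ → Fin m → Fin m → ℝ := fun n i j =>
    dividedDifference (S i) (y n) (fun u => dividedDifference (S j) (y n) (fun w => κ (u - w)))
    with hG
  set Γ : Fin m → Fin m → ℝ := fun i j => if c i = c j then
      (-1) ^ o j * iteratedDeriv (o i + o j) κ (z i - z j) / ((o i).factorial * (o j).factorial)
        else 0 with hΓ
  have hGlim : ∀ i j, Tendsto (fun n => G n i j) atTop (𝓝 (Γ i j)) := by
    intro i j
    have hsum2 : o i + o j ≤ 2 * k := by have := hok i; have := hok j; omega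
    choose ξ τ hξ hτ he using fun n => exists_double_dividedDifference_eq hκc (S i) (S j) (hSne i)
      (hSne j) (y n) (hyinj n) hsum2
    have h1 := tendsto_of_mem_Icc_family (S i) (hnear i) hξ
    have h2 := tendsto_of_mem_Icc_family (S j) (hnear j) hτ
    have h3 : Tendsto (fun n => (ξ n - y n i) - (τ n - y n j)) atTop (𝓝 0) := by
      simpa using h1.sub h2
    have e : ∀ n, ξ n - τ n = ((ξ n - y n i) - (τ n - y n j)) + (y n i - y n j) := fun n => by ring
    have hGe : ∀ n, G n i j = (-1) ^ o j * iteratedDeriv (o i + o j) κ (ξ n - τ n) /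
        ((o i).factorial * (o j).factorial) := he
    simp_rw [hGe]
    by_cases hc : c i = c j
    · have hlim : Tendsto (fun n => ξ n - τ n) atTop (𝓝 (z i - z j)) := by
        simp_rw [e]
        simpa using h3.add (hsame i j hc)
      simp only [hΓ, if_pos hc]
      exact ((((hκc.continuous_iteratedDeriv _ (by exact_mod_cast hsum2)).tendsto _).comp
        hlim).const_mul _).div_const _
    · have hdisj : Disjoint (S i) (S j) := by
        rw [Finset.disjoint_left]
        intro l hl hl'
        exact hc (((hSmem i l).1 hl).2.1.symm.trans ((hSmem j l).1 hl').2.1)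
      -- Between different clusters the node sets are disjoint with at most `k + 1` nodes
      -- altogether; this is why decay of the derivatives of `κ` up to order `k` is enough although
      -- orders up to `2k` occur within a cluster.
      have hsmall : o i + o j ≤ k := by
        have h4 := (S i ∪ S j).card_le_univ
        rw [Finset.card_union_of_disjoint hdisj, Fintype.card_fin, hcard, hcard] at h4
        omega
      have hlim : Tendsto (fun n => ξ n - τ n) atTop (Bornology.cobounded ℝ) := by
        rw [← tendsto_norm_atTop_iff_cobounded]
        have h5 := tendsto_norm_atTop_iff_cobounded.2 (hfar i j hc)
        refine tendsto_atTop_mono' _ ?_ (tendsto_atTop_add_const_right _ (-1) h5)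
        filter_upwards [h3.norm.eventually_lt_const (by simp : ‖(0 : ℝ)‖ < 1)] with n hn
        have h6 : y n i - y n j = (ξ n - τ n) - ((ξ n - y n i) - (τ n - y n j)) := by ring
        have h7 : ‖y n i - y n j‖ ≤ ‖ξ n - τ n‖ + ‖(ξ n - y n i) - (τ n - y n j)‖ := by
          rw [h6]; exact norm_sub_le _ _
        linarith
      simp only [hΓ, if_neg hc]
      simpa using (((hdec _ hsmall).comp hlim).const_mul ((-1 : ℝ) ^ o j)).div_const
        (((o i).factorial : ℝ) * (o j).factorial)
  -- Newton coordinates are used once in each variable of `κ (u - w)`.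
  have hQ : ∀ n, ∑ p, ∑ q, a (ψ n) p * a (ψ n) q * κ (y n p - y n q) =
      ∑ i, ∑ j, b n i * b n j * G n i j := by
    intro n
    have h1 : ∀ u, ∑ q, a (ψ n) q * κ (u - y n q) =
        ∑ j, b n j * dividedDifference (S j) (y n) (fun w => κ (u - w)) := fun u =>
      hb n (fun w => κ (u - w))
    have h2 := hb n (fun u => ∑ q, a (ψ n) q * κ (u - y n q))
    simp_rw [h1, dividedDifference_sum] at h2
    simp_rw [← h1, Finset.mul_sum, ← mul_assoc] at h2
    exact h2
  set s : ℕ → ℝ := fun n => ∑ i, |b n i| with hs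
  have hs0 : ∀ n, 0 ≤ s n := fun n => Finset.sum_nonneg fun i _ => abs_nonneg _
  have hM0 : ∀ n, 0 ≤ M n := fun n =>
    (abs_nonneg _).trans (hM n 0 hmpos ⟨0, hmpos⟩ ⟨0, hmpos⟩ (by simp) (x n ⟨0, hmpos⟩) (by simp))
  have hclose : ∀ᶠ n in atTop, ∀ i, ∀ p ∈ S i, ∀ q ∈ S i, y n q - y n p ≤ 1 / 2 := by
    rw [eventually_all]
    intro i
    rw [Filter.eventually_all_finset]
    intro p hp
    rw [Filter.eventually_all_finset]
    intro q hq
    have h1 : Tendsto (fun n => y n q - y n p) atTop (𝓝 0) := by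
      simpa using (hnear i q hq).sub (hnear i p hp)
    exact (h1.eventually_lt_const (by norm_num : (0 : ℝ) < 1 / 2)).mono fun n hn => hn.le
  -- Once the nodes of each `S i` are within `1/2`, divided differences of `φ` are at most `M`, so
  -- the pairing is at most `s M`. The failed inequality then says that the form is below `(s / (n +
  -- 1))²`, and normalizing the coordinates by `s` sends the form to zero.
  have hmain : ∀ᶠ n : ℕ in atTop, 0 < s n ∧
      ∑ i, ∑ j, b n i / s n * (b n j / s n) * G n i j ≤ (((n : ℝ) + 1) ^ 2)⁻¹ := by
    filter_upwards [hclose] with n hn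
    have hdd : ∀ i, |dividedDifference (S i) (y n) (φ (ψ n))| ≤ M (ψ n) := by
      intro i
      obtain ⟨p, hp, q, hq, ξ, hξ, he⟩ := exists_dividedDifference_eq (S i) (hSne i) (y n)
        (hyinj n).injOn (φ (ψ n)) ((hφ (ψ n)).of_le (by exact_mod_cast hok i))
      rw [he, abs_div, Nat.abs_cast]
      refine (div_le_self (abs_nonneg _) (by exact_mod_cast (Nat.factorial_pos _))).trans ?_
      exact hM (ψ n) (o i) (hom i) p q (hn i p hp q hq) ξ hξ
    have h1 : |∑ i, a (ψ n) i * φ (ψ n) (y n i)| ≤ s n * M (ψ n) := by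
      rw [hb n, hs, Finset.sum_mul]
      refine (Finset.abs_sum_le_sum_abs _ _).trans (Finset.sum_le_sum fun i _ => ?_)
      rw [abs_mul]
      exact mul_le_mul_of_nonneg_left (hdd i) (abs_nonneg _)
    have h2 := (hlt (ψ n)).trans_le h1
    rw [hQ] at h2
    set q := ∑ i, ∑ j, b n i * b n j * G n i j with hq
    have hMpos : 0 < M (ψ n) := by
      rcases (hM0 (ψ n)).eq_or_lt with h | h
      · rw [← h] at h2; simp at h2
      · exact h
    have h3 : ((ψ n : ℝ) + 1) * √q < s n := by
      have : ((ψ n : ℝ) + 1) * √q * M (ψ n) < s n * M (ψ n) := by linarith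
      exact lt_of_mul_lt_mul_right this hMpos.le
    have hspos : 0 < s n := lt_of_le_of_lt (by positivity) h3
    have h4 : ((n : ℝ) + 1) * √q < s n := by
      refine lt_of_le_of_lt ?_ h3
      have : (n : ℝ) ≤ ψ n := by exact_mod_cast hψ.id_le n
      gcongr
    have hn1 : (0 : ℝ) < (n : ℝ) + 1 := by positivity
    have h5 : √q < s n / (n + 1) := by rw [lt_div_iff₀' hn1]; exact h4
    rw [Real.sqrt_lt' (by positivity)] at h5
    refine ⟨hspos, ?_⟩
    have h6 : ∑ i, ∑ j, b n i / s n * (b n j / s n) * G n i j = q / s n ^ 2 := by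
      rw [hq, Finset.sum_div]
      refine Finset.sum_congr rfl fun i _ => ?_
      rw [Finset.sum_div]
      refine Finset.sum_congr rfl fun j _ => ?_
      field_simp
    rw [h6, div_le_iff₀ (by positivity)]
    refine h5.le.trans (le_of_eq ?_)
    rw [div_pow]; ring
  obtain ⟨β, -, θ, hθ, hβ⟩ := (isCompact_Icc (a := fun _ : Fin m => (-1 : ℝ))
    (b := fun _ => 1)).tendsto_subseq (x := fun n i => b n i / s n) (by
      intro n
      have : ∀ i, |b n i / s n| ≤ 1 := fun i => by
        rw [abs_div, abs_of_nonneg (hs0 n)]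
        exact div_le_one_of_le₀ (Finset.single_le_sum (f := fun i => |b n i|)
          (fun i _ => abs_nonneg _) (Finset.mem_univ i)) (hs0 n)
      exact ⟨fun i => (abs_le.1 (this i)).1, fun i => (abs_le.1 (this i)).2⟩)
  have hβ' : ∀ i, Tendsto (fun n => b (θ n) i / s (θ n)) atTop (𝓝 (β i)) := fun i =>
    (tendsto_pi_nhds.1 hβ) i
  have hform : Tendsto (fun n => ∑ i, ∑ j, b (θ n) i / s (θ n) * (b (θ n) j / s (θ n)) *
      G (θ n) i j) atTop (𝓝 (∑ i, ∑ j, β i * β j * Γ i j)) :=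
    tendsto_finsetSum _ fun i _ => tendsto_finsetSum _ fun j _ =>
      ((hβ' i).mul (hβ' j)).mul ((hGlim i j).comp hθ.tendsto_atTop)
  have hmainθ := hθ.tendsto_atTop.eventually hmain
  have hle : ∑ i, ∑ j, β i * β j * Γ i j ≤ 0 := by
    have hinv : Tendsto (fun n : ℕ => (((θ n : ℝ) + 1) ^ 2)⁻¹) atTop (𝓝 0) := by
      have h1 : Tendsto (fun n : ℕ => ((n : ℝ) + 1) ^ 2) atTop atTop :=
        (tendsto_pow_atTop two_ne_zero).comp
          (tendsto_atTop_add_const_right _ 1 tendsto_natCast_atTop_atTop)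
      exact (tendsto_inv_atTop_zero.comp h1).comp hθ.tendsto_atTop
    exact le_of_tendsto_of_tendsto hform hinv (hmainθ.mono fun n hn => hn.2)
  -- The limit coordinates vanish by positive definiteness of the limit form, while their absolute
  -- values sum to `1`.
  have hβ0 := eq_zero_of_block_form_nonpos hμ hκ0 hm c o z β hok hinj hle
  have hone : Tendsto (fun n => ∑ i, |b (θ n) i / s (θ n)|) atTop (𝓝 (∑ i, |β i|)) :=
    tendsto_finsetSum _ fun i _ => (hβ' i).abs
  have hone' : Tendsto (fun n => ∑ i, |b (θ n) i / s (θ n)|) atTop (𝓝 1) := by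
    refine tendsto_const_nhds.congr' ?_
    filter_upwards [hmainθ] with n hn
    have h1 := hn.1
    simp_rw [abs_div, abs_of_pos h1]
    rw [← Finset.sum_div, div_self h1.ne']
  have := tendsto_nhds_unique hone hone'
  simp [hβ0] at this

end

/-! ### Nondegenerate curves: distances between values and spans of values. -/

/-- A differentiable curve in a Hilbert space, with stationary inner products, whose values at
finitely many points are quantitatively independent. -/
structure NondegenerateCurve {E : Type*} [NormedAddCommGroup E] [InnerProductSpace ℝ E] (k : ℕ)
    (κ : ℝ → ℝ) (F F' : ℝ → E) : Prop where
  inner_eq : ∀ s t, inner ℝ (F s) (F t) = κ (s - t)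
  hasStrictDerivAt : ∀ t, HasStrictDerivAt F (F' t) t
  contDiff : ContDiff ℝ (2 * k : ℕ) κ
  bounded : ∃ B : ℝ, 0 ≤ B ∧ ∀ j ≤ 2 * k, ∀ t, |iteratedDeriv j κ t| ≤ B
  duality : ∃ C : ℝ, 0 < C ∧ ∀ s : Finset ℝ, s.card ≤ k + 1 → ∀ (a : ℝ → ℝ) (φ : ℝ → ℝ) (M : ℝ),
    ContDiff ℝ k φ → (∀ j < s.card, ∀ p ∈ s, ∀ q ∈ s, q - p ≤ 1 / 2 → ∀ t ∈ Icc p q,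
      |iteratedDeriv j φ t| ≤ M) → |∑ i ∈ s, a i * φ i| ≤ C * M * ‖∑ i ∈ s, a i • F i‖

theorem nondegenerateCurve_of_spectral {E : Type*} [NormedAddCommGroup E] [InnerProductSpace ℝ E]
    {μ : Measure ℝ} [IsProbabilityMeasure μ] {κ : ℝ → ℝ} {F F' : ℝ → E}
    (hμ : ∀ t, charFun μ t = κ t) {k : ℕ} (hm : MemLp id ((2 * k : ℕ) : ℝ≥0∞) μ)
    (hdec : ∀ j ≤ k, Tendsto (iteratedDeriv j κ) (Bornology.cobounded ℝ) (𝓝 0))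
    (hF : ∀ s t, inner ℝ (F s) (F t) = κ (s - t)) (hF' : ∀ t, HasStrictDerivAt F (F' t) t) :
    NondegenerateCurve k κ F F' where
  inner_eq := hF
  hasStrictDerivAt := hF'
  contDiff := contDiff_of_spectral hμ hm
  bounded := exists_bound_iteratedDeriv hμ hm
  duality := by
    choose C hC0 hC using fun m : Fin (k + 2) =>
      exists_duality_bound (m := m) hμ hm hdec (by omega)
    refine ⟨∑ m, C m, Finset.sum_pos (fun m _ => hC0 m) ⟨0, Finset.mem_univ _⟩, ?_⟩
    intro s hs a φ M hφ hM
    set e := s.orderEmbOfFin rfl with he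
    have hs' : s = Finset.univ.map e.toEmbedding := (s.map_orderEmbOfFin_univ rfl).symm
    have h1 := hC ⟨s.card, by omega⟩ e e.injective (a ∘ e) φ M hφ (fun j hj p q hpq t ht =>
      hM j hj _ (s.orderEmbOfFin_mem rfl p) _ (s.orderEmbOfFin_mem rfl q) hpq t ht)
    simp only [Function.comp_apply] at h1
    rw [← norm_sq_sum_smul_eq hF Finset.univ (fun i => a (e i)) (fun i => e i),
      Real.sqrt_sq (norm_nonneg _)] at h1
    have hsum1 : ∑ i ∈ s, a i * φ i = ∑ i, a (e i) * φ (e i) := by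
      conv_lhs => rw [hs', Finset.sum_map]
      rfl
    have hsum2 : ∑ i ∈ s, a i • F i = ∑ i, a (e i) • F (e i) := by
      conv_lhs => rw [hs', Finset.sum_map]
      rfl
    rw [hsum1, hsum2]
    refine h1.trans ?_
    rcases Nat.eq_zero_or_pos s.card with h0 | hpos
    · have : IsEmpty (Fin s.card) := by rw [h0]; infer_instance
      simp
    have hM0 : 0 ≤ M := (abs_nonneg _).trans (hM 0 hpos _ (s.orderEmbOfFin_mem rfl ⟨0, hpos⟩) _
      (s.orderEmbOfFin_mem rfl ⟨0, hpos⟩) (by norm_num) _ ⟨le_rfl, le_rfl⟩)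
    gcongr
    exact Finset.single_le_sum (f := C) (fun m _ => (hC0 m).le) (Finset.mem_univ _)

theorem abs_iteratedDeriv_sin_affine_le (θ r : ℝ) (hθ : |θ| ≤ 1) (j : ℕ) (t : ℝ) :
    |iteratedDeriv j (fun t => Real.sin (θ * (t - r))) t| ≤ 1 := by
  have e : (fun t => Real.sin (θ * (t - r))) =
      fun t => Real.cos (θ * t + (-(θ * r) - Real.pi / 2)) := by
    ext t
    rw [← Real.cos_sub_pi_div_two]
    congr 1
    ring
  rw [e, iteratedDeriv_cos_affine, abs_mul, abs_pow]
  exact mul_le_one₀ (pow_le_one₀ (abs_nonneg _) hθ) (abs_nonneg _) (Real.abs_cos_le_one _)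

/-- The binomial expansion of `(1 + n)^j` matches Leibniz's rule. Sines serve as test functions
instead of linear factors because their derivatives are bounded on the whole line, wherever the
zeros `r i` are. -/
theorem abs_iteratedDeriv_prod_sin_le {ι : Type*} [DecidableEq ι] (s : Finset ι) (θ r : ι → ℝ)
    (hθ : ∀ i, |θ i| ≤ 1) (j : ℕ) (t : ℝ) :
    |iteratedDeriv j (fun t => ∏ i ∈ s, Real.sin (θ i * (t - r i))) t| ≤ (s.card : ℝ) ^ j := by
  induction s using Finset.induction_on generalizing j with
  | empty =>
    rcases Nat.eq_zero_or_pos j with rfl | hj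
    · simp
    · simp [iteratedDeriv_const, hj.ne']
  | insert i s hi ih =>
    have e : (fun t => ∏ i ∈ insert i s, Real.sin (θ i * (t - r i))) =
        (fun t => Real.sin (θ i * (t - r i))) *
          fun t => ∏ i ∈ s, Real.sin (θ i * (t - r i)) := by
      ext t; simp [Finset.prod_insert hi]
    have hc : ∀ i, ContDiff ℝ j (fun t => Real.sin (θ i * (t - r i))) := fun i => by fun_prop
    rw [e, iteratedDeriv_mul (hc i).contDiffAt (contDiff_prod fun i _ => hc i).contDiffAt,
      Finset.card_insert_of_notMem hi]
    push_cast
    rw [add_comm (s.card : ℝ) 1, add_pow]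
    refine (Finset.abs_sum_le_sum_abs _ _).trans (Finset.sum_le_sum fun l _ => ?_)
    rw [abs_mul, abs_mul, one_pow, one_mul, mul_comm, Nat.abs_cast, mul_comm (j.choose l : ℝ),
      ← mul_assoc]
    gcongr
    calc _ ≤ (s.card : ℝ) ^ (j - l) * 1 := by
          gcongr
          · exact ih _
          · exact abs_iteratedDeriv_sin_affine_le _ _ (hθ i) _ _
      _ = _ := mul_one _

/-- The frequency `min(1, 1/|u|)` keeps the argument in `[-1, 1]`, where `|sin|` is at least `2/π`
times its argument. -/
theorem half_min_le_abs_sin {u : ℝ} :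
    min |u| 1 / 2 ≤ |Real.sin (min 1 |u|⁻¹ * u)| := by
  rcases eq_or_ne u 0 with rfl | hu
  · simp
  have hu' : 0 < |u| := abs_pos.2 hu
  have h1 : |min 1 |u|⁻¹ * u| = min |u| 1 := by
    rw [abs_mul, abs_of_pos (lt_min one_pos (inv_pos.2 hu')), min_mul_of_nonneg _ _ hu'.le,
      one_mul, inv_mul_cancel₀ hu'.ne']
  have h2 : |Real.sin (min 1 |u|⁻¹ * u)| = |Real.sin (min |u| 1)| := by
    rw [← h1]
    rcases abs_choice (min 1 |u|⁻¹ * u) with h | h <;> rw [h]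
    rw [Real.sin_neg, abs_neg]
  have h3 : (0:ℝ) ≤ min |u| 1 := by positivity
  have h4 : min |u| 1 ≤ 1 := min_le_right _ _
  rw [h2]
  refine le_trans ?_ (le_abs_self _)
  refine le_trans ?_ (Real.mul_le_sin h3 (by linarith [Real.pi_gt_three]))
  have : 1 / 2 ≤ 2 / Real.pi := by
    rw [div_le_div_iff₀ two_pos Real.pi_pos]
    linarith [Real.pi_lt_four]
  nlinarith

/-- The span of the values of a curve at finitely many points. -/
def evalSpan {E : Type*} [NormedAddCommGroup E] [InnerProductSpace ℝ E] (F : ℝ → E)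
    (s : Finset ℝ) : Submodule ℝ E := Submodule.span ℝ (F '' s)

section

variable {E : Type*} [NormedAddCommGroup E] [InnerProductSpace ℝ E] {k : ℕ} {κ : ℝ → ℝ}
  {F F' : ℝ → E}

instance (s : Finset ℝ) : FiniteDimensional ℝ (evalSpan F s) :=
  FiniteDimensional.span_of_finite ℝ (s.finite_toSet.image F)

theorem mem_evalSpan {s : Finset ℝ} {u : E} :
    u ∈ evalSpan F s ↔ ∃ a : ℝ → ℝ, u = ∑ t ∈ s, a t • F t := by
  rw [evalSpan, Submodule.mem_span_image_finset_iff_exists_fun']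
  exact exists_congr fun a => eq_comm

theorem apply_mem_evalSpan {s : Finset ℝ} {t : ℝ} (ht : t ∈ s) : F t ∈ evalSpan F s :=
  Submodule.subset_span ⟨t, ht, rfl⟩

theorem evalSpan_mono {s t : Finset ℝ} (h : s ⊆ t) : evalSpan F s ≤ evalSpan F t :=
  Submodule.span_mono (image_mono h)

theorem apply_sub_mem_evalSpan_iff {s : Finset ℝ} {y : ℝ} (hy : y ∉ s) {v : E} :
    F y - v ∈ evalSpan F s ↔ ∃ a : ℝ → ℝ, a y = 1 ∧ v = ∑ t ∈ insert y s, a t • F t := by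
  rw [mem_evalSpan]
  constructor
  · rintro ⟨a, ha⟩
    refine ⟨Function.update (-a) y 1, by simp, ?_⟩
    rw [Finset.sum_insert hy, Function.update_self, one_smul]
    have : ∑ t ∈ s, Function.update (-a) y 1 t • F t = -∑ t ∈ s, a t • F t := by
      rw [← Finset.sum_neg_distrib]
      refine Finset.sum_congr rfl fun t ht => ?_
      rw [Function.update_of_ne (by rintro rfl; exact hy ht)]
      simp
    rw [this, ← ha]
    abel
  · rintro ⟨a, ha, rfl⟩
    refine ⟨-a, ?_⟩
    rw [Finset.sum_insert hy, ha, one_smul]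
    simp

/-- Duality is tested on a product of sines vanishing at every point of `s`: only the coefficient
`1` at `y` contributes to the pairing, and the value of the product at `y` is at least `∏ min(|y -
t|, 1)` up to a factor `2^k`. -/
theorem NondegenerateCurve.exists_le_norm (h : NondegenerateCurve k κ F F') :
    ∃ c : ℝ, 0 < c ∧ ∀ s : Finset ℝ, s.card ≤ k → ∀ y ∉ s, ∀ v, F y - v ∈ evalSpan F s →
      c * ∏ t ∈ s, min |y - t| 1 ≤ ‖v‖ := by
  obtain ⟨C, hC0, hC⟩ := h.duality
  refine ⟨(C * ((k : ℝ) + 1) ^ k * 2 ^ k)⁻¹, by positivity, ?_⟩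
  intro s hs y hy v hv
  obtain ⟨a, hay, rfl⟩ := (apply_sub_mem_evalSpan_iff hy).1 hv
  set θ : ℝ → ℝ := fun r => min 1 |y - r|⁻¹ with hθ
  have hθ1 : ∀ r, |θ r| ≤ 1 := fun r => by
    rw [abs_of_nonneg (by positivity)]; exact min_le_left _ _
  set φ : ℝ → ℝ := fun t => ∏ r ∈ s, Real.sin (θ r * (t - r)) with hφ
  have hφc : ContDiff ℝ k φ := contDiff_prod fun i _ => by fun_prop
  have h1 := hC (insert y s) (by rw [Finset.card_insert_of_notMem hy]; omega) a φ
    (((k : ℝ) + 1) ^ k) hφc (by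
      intro j hj p _ q _ _ t _
      refine (abs_iteratedDeriv_prod_sin_le s θ id hθ1 j t).trans ?_
      rw [Finset.card_insert_of_notMem hy] at hj
      have hs' : (s.card : ℝ) ≤ k + 1 := by exact_mod_cast (by omega)
      calc (s.card : ℝ) ^ j ≤ ((k : ℝ) + 1) ^ j := by gcongr
        _ ≤ ((k : ℝ) + 1) ^ k := pow_le_pow_right₀ (by simp) (by omega))
  rw [Finset.sum_insert hy, hay, one_mul, Finset.sum_eq_zero, add_zero] at h1
  · have h2 : (∏ t ∈ s, min |y - t| 1) / 2 ^ k ≤ |φ y| := by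
      rw [hφ, Finset.abs_prod]
      calc (∏ t ∈ s, min |y - t| 1) / 2 ^ k ≤ (∏ t ∈ s, min |y - t| 1) / 2 ^ s.card := by
            gcongr; norm_num
        _ = ∏ t ∈ s, (min |y - t| 1 / 2) := by
            rw [Finset.prod_div_distrib, Finset.prod_const]
        _ ≤ _ := Finset.prod_le_prod (fun t _ => by positivity) fun t _ => half_min_le_abs_sin
    have h3 := h2.trans h1
    rw [inv_mul_le_iff₀ (by positivity)]
    rw [div_le_iff₀ (by positivity)] at h3
    linarith
  · intro t ht
    rw [hφ]
    simp only
    rw [Finset.prod_eq_zero ht (by simp), mul_zero]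

theorem prod_min_le_prod_filter (s : Finset ℝ) (y : ℝ) :
    ∏ t ∈ s with |y - t| ≤ 1, |y - t| = ∏ t ∈ s, min |y - t| 1 := by
  rw [Finset.prod_filter]
  refine Finset.prod_congr rfl fun t _ => ?_
  split_ifs with h
  · rw [min_eq_left h]
  · rw [min_eq_right (not_le.1 h).le]

/-- Only the points of `s` within distance `1` of `y` are used. The divided difference of the curve
at these points and `y` has bounded norm, by the mean value theorem in both variables and the bounds
on derivatives of `κ` up to order `2k`; multiplying it by `∏ (y - t)` makes the coefficient at `y`
equal to `1`. -/
theorem NondegenerateCurve.exists_norm_le (h : NondegenerateCurve k κ F F') :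
    ∃ C : ℝ, 0 < C ∧ ∀ s : Finset ℝ, s.card ≤ k → ∀ y ∉ s, ∃ v, F y - v ∈ evalSpan F s ∧
      ‖v‖ ≤ C * ∏ t ∈ s, min |y - t| 1 := by
  classical
  obtain ⟨B, hB0, hB⟩ := h.bounded
  refine ⟨√B + 1, by positivity, ?_⟩
  intro s hs y hy
  set s₁ := s.filter (fun t => |y - t| ≤ 1) with hs₁
  have hy₁ : y ∉ s₁ := fun hh => hy (Finset.mem_filter.1 hh).1
  set s' := insert y s₁ with hs'
  have hcard : s'.card ≤ k + 1 := by
    rw [hs', Finset.card_insert_of_notMem hy₁]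
    have : s₁.card ≤ s.card := Finset.card_filter_le s (fun t => |y - t| ≤ 1)
    omega
  set c : ℝ → ℝ := fun i => (∏ j ∈ s'.erase i, (i - j))⁻¹ with hc
  set D : E := ∑ i ∈ s', c i • F i with hD
  have hDn : ‖D‖ ≤ √B := by
    refine Real.le_sqrt_of_sq_le ?_
    have h1 := norm_sq_sum_smul_eq h.inner_eq s' c id
    simp only [id] at h1
    rw [hD, h1]
    obtain ⟨ξ, τ, -, -, he⟩ := exists_double_dividedDifference_eq h.contDiff s' s'
      ⟨y, by simp [hs']⟩ ⟨y, by simp [hs']⟩ id Function.injective_id (by omega)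
    have h2 : ∑ i ∈ s', ∑ j ∈ s', c i * c j * κ (i - j) =
        dividedDifference s' id (fun x => dividedDifference s' id (fun y => κ (x - y))) := by
      simp only [dividedDifference, id, hc, Finset.mul_sum]
      exact Finset.sum_congr rfl fun i _ => Finset.sum_congr rfl fun j _ => by ring
    rw [h2, he]
    refine (le_abs_self _).trans ?_
    rw [abs_div, abs_mul, abs_pow, abs_neg, abs_one, one_pow, one_mul]
    refine (div_le_self (abs_nonneg _) ?_).trans (hB _ (by omega) _)
    rw [abs_of_nonneg (by positivity)]
    have : ∀ n : ℕ, (1:ℝ) ≤ n.factorial := fun n => by exact_mod_cast n.factorial_pos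
    exact one_le_mul_of_one_le_of_one_le (this _) (this _)
  have hprod : c y = (∏ t ∈ s₁, (y - t))⁻¹ := by
    rw [hc]; simp only; rw [hs', Finset.erase_insert hy₁]
  have hne : ∏ t ∈ s₁, (y - t) ≠ 0 := Finset.prod_ne_zero_iff.2 fun t ht =>
    sub_ne_zero.2 (by rintro rfl; exact hy₁ ht)
  refine ⟨(∏ t ∈ s₁, (y - t)) • D, ?_, ?_⟩
  · refine evalSpan_mono (Finset.filter_subset (fun t => |y - t| ≤ 1) s) ?_
    rw [apply_sub_mem_evalSpan_iff hy₁]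
    refine ⟨fun i => (∏ t ∈ s₁, (y - t)) * c i, ?_, ?_⟩
    · simp only; rw [hprod, mul_inv_cancel₀ hne]
    · rw [hD, Finset.smul_sum]; simp only [mul_smul]; rfl
  · rw [norm_smul, Real.norm_eq_abs, Finset.abs_prod, hs₁, prod_min_le_prod_filter, mul_comm]
    gcongr
    linarith

/-- The component of `F' x` orthogonal to the values of the curve at the points of `s`. -/
noncomputable def derivResidual (F F' : ℝ → E) (s : Finset ℝ) (x : ℝ) : E :=
  F' x - (evalSpan F s).starProjection (F' x)

theorem sub_residual_mem (s : Finset ℝ) (x : ℝ) : F' x - derivResidual F F' s x ∈ evalSpan F s := by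
  rw [derivResidual, sub_sub_cancel]
  exact Submodule.starProjection_apply_mem _ _

theorem inner_residual_eq_zero {s : Finset ℝ} (x : ℝ) {u : E} (hu : u ∈ evalSpan F s) :
    inner ℝ (derivResidual F F' s x) u = 0 :=
  Submodule.starProjection_inner_eq_zero _ _ hu

/-- Projecting away from the span kills `F x`, so the projected slope only involves the residual of
`F y`. -/
theorem tendsto_residual_slope (h : NondegenerateCurve k κ F F') {s : Finset ℝ} {x : ℝ}
    (hx : x ∈ s) : Tendsto (fun y => ‖F y - (evalSpan F s).starProjection (F y)‖ / |y - x|)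
      (𝓝[≠] x) (𝓝 ‖derivResidual F F' s x‖) := by
  have h1 := hasDerivAt_iff_tendsto_slope.1 (h.hasStrictDerivAt x).hasDerivAt
  set R : E →L[ℝ] E := ContinuousLinearMap.id ℝ E - (evalSpan F s).starProjection with hR
  have h2 := ((R.continuous.tendsto _).comp h1).norm
  have h3 : ‖R (F' x)‖ = ‖derivResidual F F' s x‖ := rfl
  rw [h3] at h2
  refine h2.congr' ?_
  filter_upwards [self_mem_nhdsWithin] with y hy
  have hRx : R (F x) = 0 := by
    simp only [hR, sub_apply, ContinuousLinearMap.id_apply]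
    rw [Submodule.starProjection_eq_self_iff.2 (apply_mem_evalSpan hx), sub_self]
  simp only [Function.comp_apply, slope, vsub_eq_sub, map_smul, map_sub, hRx, sub_zero, norm_smul,
    norm_inv, Real.norm_eq_abs]
  rw [div_eq_inv_mul]
  rfl

/-- The two distance bounds for `F y`, with `y ∉ s`, are divided by `|y - x|` and passed to the
limit `y → x`; the factor of the product at `t = x` cancels. -/
theorem NondegenerateCurve.exists_norm_residual (h : NondegenerateCurve k κ F F') :
    ∃ c C : ℝ, 0 < c ∧ 0 < C ∧ ∀ s : Finset ℝ, s.card ≤ k → ∀ x ∈ s,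
      c * ∏ t ∈ s.erase x, min |x - t| 1 ≤ ‖derivResidual F F' s x‖ ∧
      ‖derivResidual F F' s x‖ ≤ C * ∏ t ∈ s.erase x, min |x - t| 1 := by
  obtain ⟨c, hc0, hc⟩ := h.exists_le_norm
  obtain ⟨C, hC0, hC⟩ := h.exists_norm_le
  refine ⟨c, C, hc0, hC0, fun s hs x hx => ?_⟩
  have hlim := tendsto_residual_slope h hx
  have hcont : Continuous fun y : ℝ => ∏ t ∈ s.erase x, min |y - t| 1 := by fun_prop
  have hprod : Tendsto (fun y : ℝ => ∏ t ∈ s.erase x, min |y - t| 1) (𝓝[≠] x)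
      (𝓝 (∏ t ∈ s.erase x, min |x - t| 1)) := (hcont.tendsto x).mono_left nhdsWithin_le_nhds
  have hev : ∀ᶠ y in 𝓝[≠] x, y ∉ s ∧ 0 < |y - x| ∧
      ∏ t ∈ s, min |y - t| 1 = |y - x| * ∏ t ∈ s.erase x, min |y - t| 1 := by
    have h1 : ∀ᶠ y in 𝓝[≠] x, y ∉ s.erase x :=
      nhdsWithin_le_nhds ((s.erase x).finite_toSet.isClosed.isOpen_compl.mem_nhds (by simp))
    have h2 : ∀ᶠ y in 𝓝[≠] x, |y - x| < 1 := by
      refine nhdsWithin_le_nhds ?_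
      have := Metric.ball_mem_nhds x one_pos
      filter_upwards [this] with y hy
      simpa [Real.dist_eq] using hy
    filter_upwards [h1, h2, self_mem_nhdsWithin] with y hy1 hy2 hy3
    refine ⟨fun hys => hy1 (Finset.mem_erase.2 ⟨hy3, hys⟩), abs_pos.2 (sub_ne_zero.2 hy3), ?_⟩
    rw [← Finset.mul_prod_erase s _ hx, min_eq_left hy2.le]
  constructor
  · refine le_of_tendsto_of_tendsto (hprod.const_mul c) hlim ?_
    filter_upwards [hev] with y ⟨hy, hpos, he⟩
    have := hc s hs y hy (F y - (evalSpan F s).starProjection (F y)) (by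
      rw [sub_sub_cancel]; exact Submodule.starProjection_apply_mem _ _)
    rw [he] at this
    rw [le_div_iff₀ hpos]
    linarith
  · refine le_of_tendsto_of_tendsto hlim (hprod.const_mul C) ?_
    filter_upwards [hev] with y ⟨hy, hpos, he⟩
    obtain ⟨v, hv, hvn⟩ := hC s hs y hy
    rw [he] at hvn
    have h1 : ‖F y - (evalSpan F s).starProjection (F y)‖ ≤ ‖v‖ := by
      rw [Submodule.starProjection_minimal]
      refine (ciInf_le ⟨0, ?_⟩ ⟨F y - v, hv⟩).trans ?_
      · rintro _ ⟨z, rfl⟩; exact norm_nonneg _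
      · simp
    rw [div_le_iff₀ hpos]
    linarith

end

/-! ### Almost orthogonality of distant groups of points. -/

section

variable {E : Type*} [NormedAddCommGroup E] [InnerProductSpace ℝ E] {k : ℕ} {κ : ℝ → ℝ}
  {F F' : ℝ → E}

/-- Boundedness is essential here: the supremum of an unbounded set of reals is `0` by convention.
-/
theorem abs_iteratedDeriv_le_ckNorm {g : ℝ → ℝ} {k : ℕ}
    (hb : ∃ B : ℝ, ∀ j ≤ k, ∀ t, |iteratedDeriv j g t| ≤ B) {j : ℕ} (hj : j ≤ k) {η t : ℝ}
    (ht : η ≤ |t|) : |iteratedDeriv j g t| ≤ ckNorm g k η := by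
  obtain ⟨B, hB⟩ := hb
  refine le_csSup ⟨B, ?_⟩ ⟨j, hj, t, ht, rfl⟩
  rintro _ ⟨l, hl, u, -, rfl⟩
  exact hB l hl u

theorem ckNorm_nonneg (g : ℝ → ℝ) (k : ℕ) (η : ℝ) : 0 ≤ ckNorm g k η := by
  refine Real.sSup_nonneg ?_
  rintro _ ⟨l, -, u, -, rfl⟩
  exact abs_nonneg _

/-- Two intervals of length at most `1/2` whose opposite endpoints are more than `η ≥ 1` apart
cannot overlap or exchange order, so the separation extends to the points between the endpoints. -/
theorem lt_abs_sub_of_mem_Icc {η p q r s t u : ℝ} (hη : 1 ≤ η) (hqp : q - p ≤ 1 / 2)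
    (hsr : s - r ≤ 1 / 2) (h2 : η < |p - s|) (h3 : η < |q - r|)
    (ht : t ∈ Icc p q) (hu : u ∈ Icc r s) : η < |t - u| := by
  obtain ⟨ht1, ht2⟩ := ht
  obtain ⟨hu1, hu2⟩ := hu
  rw [lt_abs] at h2 h3 ⊢
  rcases h2 with h2 | h2
  · left; linarith
  · right
    rcases h3 with h3 | h3
    · linarith
    · linarith

/-- Duality is used twice. The inner product is the pairing on `s` of `x ↦ ⟪F x, v⟫`, whose
derivatives at `x` are themselves pairings on `t` of derivatives of `y ↦ κ (x - y)`. The orders are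
below `|s|` and `|t|`, so their sum is at most `|s| + |t| - 2 ≤ k`. -/
theorem NondegenerateCurve.exists_abs_inner_le_of_mem_evalSpan (h : NondegenerateCurve k κ F F') :
    ∃ C : ℝ, 0 < C ∧ ∀ η : ℝ, 1 ≤ η → ∀ s t : Finset ℝ, s.card ≤ k + 1 → t.card ≤ k + 1 →
      s.card + t.card ≤ k + 2 → (∀ x ∈ s, ∀ y ∈ t, η < |x - y|) →
      ∀ u ∈ evalSpan F s, ∀ v ∈ evalSpan F t,
        |inner ℝ u v| ≤ C * ckNorm κ k η * ‖u‖ * ‖v‖ := by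
  obtain ⟨C, hC0, hC⟩ := h.duality
  obtain ⟨B, hB0, hB⟩ := h.bounded
  refine ⟨C * C, by positivity, ?_⟩
  intro η hη s t hs ht hst hsep u hu v hv
  obtain ⟨a, rfl⟩ := mem_evalSpan.1 hu
  obtain ⟨b, rfl⟩ := mem_evalSpan.1 hv
  set N := ckNorm κ k η with hN
  set ψ : ℝ → ℝ := fun x => ∑ y ∈ t, b y * κ (x - y) with hψ
  have hψc : ContDiff ℝ k ψ := ContDiff.sum fun i _ => contDiff_const.mul
    ((h.contDiff.of_le (by exact_mod_cast (by omega))).comp (contDiff_id.sub contDiff_const))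
  have h1 := hC s hs a ψ (C * N * ‖∑ y ∈ t, b y • F y‖) hψc (by
    intro j hj p hp q hq hpq x hx
    have hd := iteratedDeriv_sum_mul_comp_sub h.contDiff t b id (j := j) (by omega) x
    simp only [id] at hd
    rw [hψ, hd]
    have hφc : ContDiff ℝ k (fun y => iteratedDeriv j κ (x - y)) :=
      (contDiff_iteratedDeriv_of_add h.contDiff (by omega)).comp (contDiff_const.sub contDiff_id)
    refine hC t ht b (fun y => iteratedDeriv j κ (x - y)) N hφc ?_
    intro j' hj' p' hp' q' hq' hpq' y hy
    rw [iteratedDeriv_comp_const_sub, iteratedDeriv_iteratedDeriv]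
    simp only [smul_eq_mul]
    rw [abs_mul, abs_pow, abs_neg, abs_one, one_pow, one_mul]
    exact abs_iteratedDeriv_le_ckNorm ⟨B, fun j hj t => hB j (by omega) t⟩ (by omega)
      (lt_abs_sub_of_mem_Icc hη hpq hpq' (hsep p hp q' hq') (hsep q hq p' hp') hx hy).le)
  have e : inner ℝ (∑ x ∈ s, a x • F x) (∑ y ∈ t, b y • F y) = ∑ x ∈ s, a x * ψ x := by
    rw [sum_inner]
    refine Finset.sum_congr rfl fun x _ => ?_
    rw [inner_sum, hψ, Finset.mul_sum]
    refine Finset.sum_congr rfl fun y _ => ?_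
    rw [inner_smul_left, inner_smul_right, h.inner_eq]
    simp
  rw [e]
  refine h1.trans (le_of_eq ?_)
  ring

/-- Values of the curve at points of `s`, combined with at most one derivative. -/
def jetSet (F F' : ℝ → E) (s : Finset ℝ) : Set E :=
  {u | u ∈ evalSpan F s ∨ ∃ x ∈ s, F' x - u ∈ evalSpan F s}

/-- A derivative is a limit of slopes, at the cost of one extra point close to `x`. -/
theorem NondegenerateCurve.mem_closure_of_mem_jetSet (h : NondegenerateCurve k κ F F')
    {s : Finset ℝ} {X : Set ℝ} (hX : IsOpen X) (hsX : ↑s ⊆ X) {u : E} (hu : u ∈ jetSet F F' s) :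
    u ∈ closure {v | ∃ t : Finset ℝ, t.card ≤ s.card + 1 ∧ ↑t ⊆ X ∧ v ∈ evalSpan F t} := by
  classical
  rcases hu with hu | ⟨x, hx, hu⟩
  · exact subset_closure ⟨s, by omega, hsX, hu⟩
  · have h1 := hasDerivAt_iff_tendsto_slope.1 (h.hasStrictDerivAt x).hasDerivAt
    have h2 : Tendsto (fun y => slope F x y - (F' x - u)) (𝓝[≠] x) (𝓝 u) := by
      simpa using h1.sub_const (F' x - u)
    refine mem_closure_of_tendsto h2 ?_
    filter_upwards [nhdsWithin_le_nhds (hX.mem_nhds (hsX hx))] with y hy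
    refine ⟨insert y s, Finset.card_insert_le _ _, ?_, ?_⟩
    · rw [Finset.coe_insert]; exact insert_subset hy hsX
    · refine Submodule.sub_mem _ (Submodule.smul_mem _ _ (Submodule.sub_mem _ ?_ ?_)) ?_
      · exact apply_mem_evalSpan (Finset.mem_insert_self _ _)
      · exact apply_mem_evalSpan (Finset.mem_insert_of_mem hx)
      · exact evalSpan_mono (Finset.subset_insert _ _) hu

/-- Almost orthogonality of distant parts of the curve. -/
theorem NondegenerateCurve.exists_abs_inner_le (h : NondegenerateCurve k κ F F') :
    ∃ C : ℝ, 0 < C ∧ ∀ η : ℝ, 1 ≤ η → ∀ s t : Finset ℝ, s.card + t.card ≤ k →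
      (∀ x ∈ s, ∀ y ∈ t, η < |x - y|) → ∀ u ∈ jetSet F F' s, ∀ v ∈ jetSet F F' t,
        |inner ℝ u v| ≤ C * ckNorm κ k η * ‖u‖ * ‖v‖ := by
  obtain ⟨C, hC0, hC⟩ := h.exists_abs_inner_le_of_mem_evalSpan
  refine ⟨C, hC0, ?_⟩
  intro η hη s t hst hsep u hu v hv
  -- The strict separation leaves room `2 θ`, so the auxiliary points of the slopes remain more than
  -- `η` apart. One extra point on each side is what the bound `k + 2` on the number of points was
  -- for.
  obtain ⟨θ, hθ0, hθ⟩ : ∃ θ : ℝ, 0 < θ ∧ ∀ x ∈ s, ∀ y ∈ t, η + 2 * θ < |x - y| := by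
    have h1 : ∀ᶠ θ : ℝ in 𝓝[>] 0, ∀ x ∈ s, ∀ y ∈ t, η + 2 * θ < |x - y| := by
      refine Filter.Eventually.filter_mono nhdsWithin_le_nhds ?_
      rw [Filter.eventually_all_finset]
      intro x hx
      rw [Filter.eventually_all_finset]
      intro y hy
      have hc : Continuous fun θ : ℝ => η + 2 * θ := by fun_prop
      exact (hc.tendsto 0).eventually_lt_const (by simpa using hsep x hx y hy)
    obtain ⟨θ, h2, h3⟩ := (h1.and self_mem_nhdsWithin).exists
    exact ⟨θ, h3, h2⟩
  set N : Finset ℝ → Set ℝ := fun s => ⋃ x ∈ s, Metric.ball x θ with hN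
  have hNo : ∀ s, IsOpen (N s) := fun s => isOpen_biUnion fun _ _ => Metric.isOpen_ball
  have hsN : ∀ s : Finset ℝ, ↑s ⊆ N s := fun s x hx =>
    mem_biUnion hx (Metric.mem_ball_self hθ0)
  have hu' := h.mem_closure_of_mem_jetSet (hNo s) (hsN s) hu
  have hv' := h.mem_closure_of_mem_jetSet (hNo t) (hsN t) hv
  have hcl : IsClosed {p : E × E | |inner ℝ p.1 p.2| ≤ C * ckNorm κ k η * ‖p.1‖ * ‖p.2‖} :=
    isClosed_le (by fun_prop) (by fun_prop)
  have hmem : (u, v) ∈ closure ({v | ∃ t : Finset ℝ, t.card ≤ s.card + 1 ∧ ↑t ⊆ N s ∧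
      v ∈ evalSpan F t} ×ˢ {v | ∃ t' : Finset ℝ, t'.card ≤ t.card + 1 ∧ ↑t' ⊆ N t ∧
      v ∈ evalSpan F t'}) := by
    rw [closure_prod_eq]; exact ⟨hu', hv'⟩
  refine closure_minimal ?_ hcl hmem
  rintro ⟨u, v⟩ ⟨⟨s', hs', hsX, hu⟩, ⟨t', ht', htX, hv⟩⟩
  refine hC η hη s' t' (by omega) (by omega) (by omega) ?_ u hu v hv
  intro x hx y hy
  obtain ⟨x', hx', hxx⟩ := mem_iUnion₂.1 (hsX hx)
  obtain ⟨y', hy', hyy⟩ := mem_iUnion₂.1 (htX hy)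
  rw [Metric.mem_ball, Real.dist_eq] at hxx hyy
  have h1 := hθ x' hx' y' hy'
  have h2 : |x' - y'| ≤ |x - y| + |x - x'| + |y - y'| := by
    have e : x' - y' = (x - y) - (x - x') + (y - y') := by ring
    rw [e]
    exact (abs_add_le _ _).trans (by gcongr; exact abs_sub _ _)
  linarith

theorem derivResidual_mem_jetSet {s : Finset ℝ} {x : ℝ} (hx : x ∈ s) :
    derivResidual F F' s x ∈ jetSet F F' s := Or.inr ⟨x, hx, sub_residual_mem s x⟩

theorem mem_evalSpan_union [DecidableEq ℝ] {s t : Finset ℝ} {u : E} :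
    u ∈ evalSpan F (s ∪ t) ↔ ∃ a ∈ evalSpan F s, ∃ b ∈ evalSpan F t, a + b = u := by
  rw [evalSpan, Finset.coe_union, image_union, Submodule.span_union, Submodule.mem_sup]
  rfl

/-- Removing the contribution of distant points changes the derivative residuals very little. -/
theorem norm_derivResidual_sub_le [DecidableEq ℝ] {s t : Finset ℝ} {ε : ℝ} (hε : ε ≤ 1 / 2)
    (hε0 : 0 ≤ ε)
    (hang : ∀ u ∈ jetSet F F' s, ∀ v ∈ jetSet F F' t, |inner ℝ u v| ≤ ε * ‖u‖ * ‖v‖) {x : ℝ}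
    (hx : x ∈ s) : ‖derivResidual F F' (s ∪ t) x - derivResidual F F' s x‖ ≤
      2 * ε * ‖derivResidual F F' s x‖ := by
  set v := derivResidual F F' s x with hv
  set p := (evalSpan F (s ∪ t)).starProjection v with hp
  have h1 : derivResidual F F' (s ∪ t) x = v - p := by
    have h2 : F' x - v ∈ evalSpan F (s ∪ t) :=
      evalSpan_mono Finset.subset_union_left (sub_residual_mem s x)
    have h3 := Submodule.starProjection_eq_self_iff.2 h2
    rw [map_sub] at h3
    rw [derivResidual, hp]
    have h4 : (evalSpan F (s ∪ t)).starProjection (F' x) =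
      F' x - v + (evalSpan F (s ∪ t)).starProjection v := by rw [← h3]; abel
    rw [h4]; abel
  have hpm : p ∈ evalSpan F (s ∪ t) := Submodule.starProjection_apply_mem _ _
  obtain ⟨a, ha, b, hb, hab⟩ := mem_evalSpan_union.1 hpm
  -- Since `v` is orthogonal to the values on `s`, the correction `p` only sees its part `b` carried
  -- by the distant points, which is nearly orthogonal to `v`; near orthogonality of `a` and `b`
  -- also gives `‖b‖ ≤ 2 ‖p‖`.
  have h5 : ‖p‖ ^ 2 = inner ℝ v b := by
    have h6 : inner ℝ (v - p) p = 0 := Submodule.starProjection_inner_eq_zero _ _ hpm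
    rw [inner_sub_left, real_inner_self_eq_norm_sq] at h6
    have h7 : inner ℝ v a = 0 := inner_residual_eq_zero x ha
    have h8 : inner ℝ v p = inner ℝ v b := by rw [← hab, inner_add_right, h7, zero_add]
    linarith
  have h9 := hang v (derivResidual_mem_jetSet hx) b (Or.inl hb)
  have h10 := hang a (Or.inl ha) b (Or.inl hb)
  have h11 : ‖p‖ ^ 2 = ‖a‖ ^ 2 + 2 * inner ℝ a b + ‖b‖ ^ 2 := by
    rw [← hab]; exact norm_add_sq_real a b
  have h12 : ‖b‖ ≤ 2 * ‖p‖ := by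
    refine le_of_sq_le_sq ?_ (by positivity)
    have h13 : -(1 / 2 * (‖a‖ * ‖b‖)) ≤ inner ℝ a b := by
      have : ε * ‖a‖ * ‖b‖ ≤ 1 / 2 * (‖a‖ * ‖b‖) := by
        rw [mul_assoc]; gcongr
      linarith [neg_abs_le (inner ℝ a b)]
    nlinarith [sq_nonneg (‖a‖ - ‖b‖), sq_nonneg ‖a‖]
  rw [h1, sub_sub_cancel_left, norm_neg]
  have h14 : ‖p‖ ^ 2 ≤ 2 * ε * ‖v‖ * ‖p‖ := by
    rw [h5]
    calc _ ≤ ε * ‖v‖ * ‖b‖ := (le_abs_self _).trans h9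
      _ ≤ ε * ‖v‖ * (2 * ‖p‖) := by gcongr
      _ = _ := by ring
  rcases eq_or_lt_of_le (norm_nonneg p) with h0 | h0
  · rw [← h0]; positivity
  · rw [pow_two] at h14
    exact le_of_mul_le_mul_right h14 h0

/-- Almost orthogonality of the residuals at points in different classes. -/
theorem abs_inner_derivResidual_sub_le [DecidableEq ℝ] {γ : Type*} [DecidableEq γ] {s : Finset ℝ}
    (b : ℝ → γ) {ε : ℝ} (hε : ε ≤ 1 / 2) (hε0 : 0 ≤ ε)
    (hang : ∀ t₁ t₂ : Finset ℝ, t₁ ⊆ s → t₂ ⊆ s → (∀ i ∈ t₁, ∀ j ∈ t₂, b i ≠ b j) →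
      ∀ u ∈ jetSet F F' t₁, ∀ v ∈ jetSet F F' t₂, |inner ℝ u v| ≤ ε * ‖u‖ * ‖v‖) {x y : ℝ}
    (hx : x ∈ s) (hy : y ∈ s) :
    |inner ℝ (derivResidual F F' s x) (derivResidual F F' s y) -
      if b x = b y then inner ℝ (derivResidual F F' (s.filter (b · = b x)) x)
        (derivResidual F F' (s.filter (b · = b y)) y) else 0| ≤
      7 * ε * ‖derivResidual F F' (s.filter (b · = b x)) x‖ *
        ‖derivResidual F F' (s.filter (b · = b y)) y‖ := by
  have key : ∀ z ∈ s, ‖derivResidual F F' s z - derivResidual F F' (s.filter (b · = b z)) z‖ ≤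
      2 * ε * ‖derivResidual F F' (s.filter (b · = b z)) z‖ := by
    intro z hz
    have h1 := norm_derivResidual_sub_le (s := s.filter (b · = b z))
      (t := s.filter (¬ b · = b z)) hε hε0 (hang _ _ (Finset.filter_subset _ _)
        (Finset.filter_subset _ _) (fun i hi j hj => by
          rw [(Finset.mem_filter.1 hi).2]
          exact Ne.symm (Finset.mem_filter.1 hj).2)) (x := z) (by simp [hz])
    rwa [Finset.filter_union_filter_not_eq] at h1
  set u := derivResidual F F' s x
  set v := derivResidual F F' s y
  set u' := derivResidual F F' (s.filter (b · = b x)) x with hu'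
  set v' := derivResidual F F' (s.filter (b · = b y)) y with hv'
  have h1 : ‖u - u'‖ ≤ 2 * ε * ‖u'‖ := key x hx
  have h2 : ‖v - v'‖ ≤ 2 * ε * ‖v'‖ := key y hy
  have h3 : |inner ℝ u' v' - if b x = b y then inner ℝ u' v' else 0| ≤ ε * ‖u'‖ * ‖v'‖ := by
    split_ifs with hb
    · rw [sub_self, abs_zero]; positivity
    · rw [sub_zero]
      refine hang _ _ (Finset.filter_subset _ _) (Finset.filter_subset _ _) (fun i hi j hj => by
          rw [(Finset.mem_filter.1 hi).2, (Finset.mem_filter.1 hj).2]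
          exact hb) _ (derivResidual_mem_jetSet (by simp [hx])) _
          (derivResidual_mem_jetSet (by simp [hy]))
  have h4 : inner ℝ u v - inner ℝ u' v' =
      inner ℝ (u - u') (v - v') + inner ℝ (u - u') v' + inner ℝ u' (v - v') := by
    simp only [inner_sub_left, inner_sub_right]; ring
  have h5 : |inner ℝ u v - inner ℝ u' v'| ≤ 6 * ε * ‖u'‖ * ‖v'‖ := by
    rw [h4]
    refine (abs_add_le _ _).trans ((add_le_add_left (abs_add_le _ _) _).trans ?_)
    have e1 := (abs_real_inner_le_norm (u - u') (v - v')).trans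
      (mul_le_mul h1 h2 (norm_nonneg _) (by positivity))
    have e2 := (abs_real_inner_le_norm (u - u') v').trans
      (mul_le_mul_of_nonneg_right h1 (norm_nonneg _))
    have e3 := (abs_real_inner_le_norm u' (v - v')).trans
      (mul_le_mul_of_nonneg_left h2 (norm_nonneg _))
    have e4 : 2 * ε * ‖u'‖ * (2 * ε * ‖v'‖) ≤ 2 * ε * ‖u'‖ * (1 * ‖v'‖) := by
      gcongr; linarith
    nlinarith
  calc _ ≤ |inner ℝ u v - inner ℝ u' v'| +
        |inner ℝ u' v' - if b x = b y then inner ℝ u' v' else 0| := abs_sub_le _ _ _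
    _ ≤ _ := by nlinarith

end

/-! ### Determinants of Gram matrices. -/

/-- A positive definite real matrix factors through an invertible matrix. -/
theorem Matrix.PosDef.exists_eq_mul_transpose {ι : Type*} [Fintype ι] [DecidableEq ι]
    {B : Matrix ι ι ℝ} (hB : B.PosDef) : ∃ A : Matrix ι ι ℝ, A.det ≠ 0 ∧ B = A * A.transpose := by
  open scoped MatrixOrder in
  obtain ⟨A, hA⟩ := CStarAlgebra.nonneg_iff_eq_star_mul_self.1 hB.posSemidef.nonneg
  have hA' : B = A.transpose * A := by
    rw [hA, Matrix.star_eq_conjTranspose, Matrix.conjTranspose_eq_transpose_of_trivial]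
  refine ⟨A.transpose, ?_, by rw [Matrix.transpose_transpose]; exact hA'⟩
  have h1 := hB.det_pos.ne'
  rw [hA', Matrix.det_mul] at h1
  exact left_ne_zero_of_mul h1

/-- After a change of basis turning `B` into the identity, all eigenvalues of `G` lie within `δ` of
`1`, and the determinant is their product. -/
theorem det_bounds_of_quadratic_form_le {ι : Type*} [Fintype ι] [DecidableEq ι]
    {B G : Matrix ι ι ℝ} (hB : B.PosDef) (hG : G.IsHermitian) {δ : ℝ} (hδ : δ ≤ 1)
    (h : ∀ a : ι → ℝ, |a ⬝ᵥ G.mulVec a - a ⬝ᵥ B.mulVec a| ≤ δ * (a ⬝ᵥ B.mulVec a)) :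
    (1 - δ) ^ Fintype.card ι * B.det ≤ G.det ∧ G.det ≤ (1 + δ) ^ Fintype.card ι * B.det := by
  obtain ⟨A, hA, rfl⟩ := hB.exists_eq_mul_transpose
  have hu : IsUnit A.det := isUnit_iff_ne_zero.2 hA
  set H : Matrix ι ι ℝ := A⁻¹ * G * (A⁻¹).transpose with hH
  have hHh : H.IsHermitian := by
    have hG' : G.transpose = G := by
      rw [← Matrix.conjTranspose_eq_transpose_of_trivial]; exact hG
    rw [Matrix.IsHermitian, Matrix.conjTranspose_eq_transpose_of_trivial, hH]
    simp only [Matrix.transpose_mul, Matrix.transpose_transpose, hG', Matrix.mul_assoc]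
  have hdet : G.det = H.det * (A * A.transpose).det := by
    simp only [hH, Matrix.det_mul, Matrix.det_transpose, Matrix.det_nonsing_inv,
      Ring.inverse_eq_inv']
    field_simp
  have hquad : ∀ x : ι → ℝ, |x ⬝ᵥ H.mulVec x - x ⬝ᵥ x| ≤ δ * (x ⬝ᵥ x) := by
    intro x
    have h1 := h ((A⁻¹).transpose.mulVec x)
    have e1 : (A⁻¹).transpose.mulVec x ⬝ᵥ G.mulVec ((A⁻¹).transpose.mulVec x) =
        x ⬝ᵥ H.mulVec x := by
      rw [hH, ← Matrix.mulVec_mulVec, ← Matrix.mulVec_mulVec, Matrix.mulVec_transpose,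
        Matrix.dotProduct_mulVec x]
    have e2 : (A⁻¹).transpose.mulVec x ⬝ᵥ (A * A.transpose).mulVec ((A⁻¹).transpose.mulVec x) =
        x ⬝ᵥ x := by
      rw [Matrix.mulVec_mulVec, Matrix.mul_assoc, ← Matrix.transpose_mul,
        Matrix.nonsing_inv_mul _ hu, Matrix.transpose_one, Matrix.mul_one, Matrix.mulVec_transpose,
        ← Matrix.dotProduct_mulVec, Matrix.mulVec_mulVec, Matrix.nonsing_inv_mul _ hu,
        Matrix.one_mulVec]
    rwa [e1, e2] at h1
  have heig : ∀ i, |hHh.eigenvalues i - 1| ≤ δ := by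
    intro i
    have h1 := hquad (hHh.eigenvectorBasis i)
    have h2 : (hHh.eigenvectorBasis i : ι → ℝ) ⬝ᵥ (hHh.eigenvectorBasis i : ι → ℝ) = 1 := by
      have := hHh.eigenvectorBasis.orthonormal.1 i
      rw [EuclideanSpace.norm_eq, Real.sqrt_eq_one] at this
      simpa [dotProduct, pow_two] using this
    rw [hHh.mulVec_eigenvectorBasis, dotProduct_smul, h2] at h1
    simpa using h1
  have hd : H.det = ∏ i, hHh.eigenvalues i := by simpa using hHh.det_eq_prod_eigenvalues
  have hpos : 0 < (A * A.transpose).det := hB.det_pos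
  rw [hdet, hd]
  constructor
  · refine mul_le_mul_of_nonneg_right ?_ hpos.le
    rw [← Finset.card_univ, ← Finset.prod_const]
    exact Finset.prod_le_prod (fun i _ => by linarith)
      fun i _ => by linarith [(abs_le.1 (heig i)).1]
  · refine mul_le_mul_of_nonneg_right ?_ hpos.le
    rw [← Finset.card_univ, ← Finset.prod_const]
    exact Finset.prod_le_prod (fun i _ => by linarith [(abs_le.1 (heig i)).1])
      fun i _ => by linarith [(abs_le.1 (heig i)).2]

/-- The determinant of a matrix that vanishes between different classes of indices. -/
theorem det_eq_prod_of_classes {γ : Type*} [LinearOrder γ] (s : Finset ℝ) (b : ℝ → γ)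
    (K : ℝ → ℝ → ℝ) :
    (Matrix.of fun i j : s => if b i = b j then K i j else 0).det =
      ∏ c ∈ s.image b, (Matrix.of fun i j : s.filter (b · = c) => K i j).det := by
  classical
  have htri : Matrix.BlockTriangular (Matrix.of fun i j : s => if b i = b j then K i j else 0)
      (fun i : s => b i) := by
    intro i j hij
    simp [(ne_of_gt hij)]
  have himg : Finset.univ.image (fun i : s => b i) = s.image b := by
    ext c; simp
  rw [htri.det, himg]
  refine Finset.prod_congr rfl fun c _ => ?_
  let e : s.filter (b · = c) ≃ {i : s // b i = c} :=
    { toFun := fun i => ⟨⟨i, (Finset.mem_filter.1 i.2).1⟩, (Finset.mem_filter.1 i.2).2⟩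
      invFun := fun i => ⟨i.1, Finset.mem_filter.2 ⟨i.1.2, i.2⟩⟩
      left_inv := fun _ => rfl
      right_inv := fun _ => rfl }
  rw [← Matrix.det_submatrix_equiv_self e]
  congr 1
  ext i j
  have hi := (Finset.mem_filter.1 i.2).2
  have hj := (Finset.mem_filter.1 j.2).2
  simp [e, Matrix.toSquareBlock_def, hi, hj]

/-- The product of the distances between the points of `s`, truncated at `1`. -/
noncomputable def truncatedVandermonde (s : Finset ℝ) : ℝ :=
  ∏ y ∈ s, ∏ t ∈ s with t < y, min |y - t| 1

theorem truncatedVandermonde_pos (s : Finset ℝ) : 0 < truncatedVandermonde s := by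
  refine Finset.prod_pos fun y _ => Finset.prod_pos fun t ht => ?_
  have := (Finset.mem_filter.1 ht).2
  exact lt_min (abs_pos.2 (by linarith)) one_pos

/-- Each unordered pair occurs twice on the left. This is why derivative residuals contribute the
square of the Vandermonde product. -/
theorem prod_prod_erase_eq_truncatedVandermonde_sq (s : Finset ℝ) :
    ∏ y ∈ s, ∏ t ∈ s.erase y, min |y - t| 1 = truncatedVandermonde s ^ 2 := by
  have h1 : ∀ y ∈ s, ∏ t ∈ s.erase y, min |y - t| 1 =
      (∏ t ∈ s with t < y, min |y - t| 1) * ∏ t ∈ s with y < t, min |y - t| 1 := by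
    intro y hy
    rw [← Finset.prod_union]
    · refine Finset.prod_congr ?_ fun _ _ => rfl
      ext t
      simp only [Finset.mem_erase, Finset.mem_union, Finset.mem_filter, ← and_or_left,
        ← ne_iff_lt_or_gt]
      exact and_comm
    · exact Finset.disjoint_filter.2 fun t _ h1 h2 => lt_asymm h1 h2
  rw [Finset.prod_congr rfl h1, Finset.prod_mul_distrib, pow_two, truncatedVandermonde]
  congr 1
  simp_rw [Finset.prod_filter]
  rw [Finset.prod_comm]
  exact Finset.prod_congr rfl fun y _ => Finset.prod_congr rfl fun t _ => by rw [abs_sub_comm]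

section

variable {E : Type*} [NormedAddCommGroup E] [InnerProductSpace ℝ E] {k : ℕ} {κ : ℝ → ℝ}
  {F F' : ℝ → E}

/-- The matrix of a kernel `κ (x - y)` on a finite set of points. -/
def kernelMatrix (κ : ℝ → ℝ) (s : Finset ℝ) : Matrix s s ℝ := Matrix.of fun i j => κ (i - j)

/-- Gram–Schmidt in increasing order of the points: the change of basis is unitriangular, so the
determinant is the product of squared distances to the span of the preceding values. -/
theorem det_kernelMatrix (hF : ∀ s t, inner ℝ (F s) (F t) = κ (s - t)) (s : Finset ℝ) :
    (kernelMatrix κ s).det = ∏ y ∈ s,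
      ‖F y - (evalSpan F (s.filter (· < y))).starProjection (F y)‖ ^ 2 := by
  classical
  set g : ℝ → E := fun y => F y - (evalSpan F (s.filter (· < y))).starProjection (F y) with hg
  have hmem : ∀ y, (evalSpan F (s.filter (· < y))).starProjection (F y) ∈
      evalSpan F (s.filter (· < y)) := fun y => Submodule.starProjection_apply_mem _ _
  choose a ha using fun y => mem_evalSpan.1 (hmem y)
  set T : Matrix s s ℝ := Matrix.of fun i j =>
    if i = j then 1 else if (j : ℝ) < i then -a i j else 0 with hT
  have hgT : ∀ i : s, g i = ∑ j : s, T i j • F j := by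
    intro i
    simp only [hg]
    rw [ha, Finset.sum_filter, ← Finset.sum_coe_sort s (fun t => if t < (i : ℝ) then a i t • F t
      else 0)]
    have : F i = ∑ j : s, if i = j then F j else 0 := by simp
    conv_lhs => rw [this]
    rw [← Finset.sum_sub_distrib]
    refine Finset.sum_congr rfl fun j _ => ?_
    simp only [hT, Matrix.of_apply]
    by_cases h : i = j
    · subst h; simp
    · by_cases h' : (j : ℝ) < i <;> simp [h, h']
  have hdetT : T.det = 1 := by
    rw [Matrix.det_of_isLowerTriangular T]
    · simp [hT]
    · intro i j hij
      have hij' : i < j := by simpa using hij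
      simp [hT, hij'.ne, hij'.not_gt]
  have hlt : ∀ y ∈ s, ∀ t ∈ s, t < y → inner ℝ (g y) (g t) = 0 := by
    intro y hy t ht h
    refine Submodule.starProjection_inner_eq_zero _ _ (Submodule.sub_mem _ ?_ ?_)
    · exact apply_mem_evalSpan (by simp [ht, h])
    · exact evalSpan_mono (fun z hz => by
        simp only [Finset.mem_filter] at hz ⊢
        exact ⟨hz.1, hz.2.trans h⟩) (hmem t)
  have hmat : Matrix.diagonal (fun i : s => ‖g i‖ ^ 2) =
      T * kernelMatrix κ s * T.transpose := by
    ext i j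
    have e1 : (T * kernelMatrix κ s * T.transpose) i j = inner ℝ (g i) (g j) := by
      rw [hgT, hgT, inner_sum, Matrix.mul_apply]
      refine Finset.sum_congr rfl fun l _ => ?_
      rw [sum_inner, Matrix.mul_apply, Matrix.transpose_apply, Finset.sum_mul]
      refine Finset.sum_congr rfl fun p _ => ?_
      rw [inner_smul_left, inner_smul_right, hF, kernelMatrix]
      simp
      ring
    rw [e1]
    rcases lt_trichotomy i j with h | h | h
    · rw [Matrix.diagonal_apply_ne _ h.ne, real_inner_comm]
      exact (hlt j j.2 i i.2 h).symm
    · subst h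
      rw [Matrix.diagonal_apply_eq, real_inner_self_eq_norm_sq]
    · rw [Matrix.diagonal_apply_ne _ h.ne']
      exact (hlt i i.2 j j.2 h).symm
  have hdet := congrArg Matrix.det hmat
  rw [Matrix.det_diagonal, Matrix.det_mul, Matrix.det_mul, Matrix.det_transpose, hdetT, one_mul,
    mul_one] at hdet
  rw [← hdet, ← Finset.prod_coe_sort s (fun y => ‖g y‖ ^ 2)]

theorem NondegenerateCurve.exists_det_bounds (h : NondegenerateCurve k κ F F') :
    ∃ c C : ℝ, 0 < c ∧ 0 < C ∧ ∀ s : Finset ℝ, s.card ≤ k →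
      c * truncatedVandermonde s ^ 2 ≤ (kernelMatrix κ s).det ∧
      (kernelMatrix κ s).det ≤ C * truncatedVandermonde s ^ 2 := by
  obtain ⟨c, hc0, hc⟩ := h.exists_le_norm
  obtain ⟨C, hC0, hC⟩ := h.exists_norm_le
  refine ⟨min 1 (c ^ 2) ^ k, max 1 (C ^ 2) ^ k, by positivity, by positivity, fun s hs => ?_⟩
  have hy : ∀ y, y ∉ s.filter (· < y) := fun y => by simp
  have hcard : ∀ y, (s.filter (· < y)).card ≤ k := fun y => (Finset.card_filter_le _ _).trans hs
  rw [det_kernelMatrix h.inner_eq, truncatedVandermonde, ← Finset.prod_pow]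
  constructor
  · calc min 1 (c ^ 2) ^ k * ∏ y ∈ s, (∏ t ∈ s with t < y, min |y - t| 1) ^ 2
        ≤ min 1 (c ^ 2) ^ s.card * ∏ y ∈ s, (∏ t ∈ s with t < y, min |y - t| 1) ^ 2 := by
          refine mul_le_mul_of_nonneg_right ?_ (Finset.prod_nonneg fun y _ => by positivity)
          exact pow_le_pow_of_le_one (by positivity) (min_le_left _ _) hs
      _ = ∏ y ∈ s, (min 1 (c ^ 2) * (∏ t ∈ s with t < y, min |y - t| 1) ^ 2) := by
          rw [Finset.prod_mul_distrib, Finset.prod_const]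
      _ ≤ _ := by
          refine Finset.prod_le_prod (fun y _ => by positivity) fun y _ => ?_
          have h1 := hc _ (hcard y) y (hy y)
            (F y - (evalSpan F (s.filter (· < y))).starProjection (F y)) (by
              rw [sub_sub_cancel]; exact Submodule.starProjection_apply_mem _ _)
          calc _ ≤ c ^ 2 * (∏ t ∈ s with t < y, min |y - t| 1) ^ 2 := by
                gcongr; exact min_le_right _ _
            _ = (c * ∏ t ∈ s with t < y, min |y - t| 1) ^ 2 := by ring
            _ ≤ _ := by gcongr
  · calc _ ≤ ∏ y ∈ s, (max 1 (C ^ 2) * (∏ t ∈ s with t < y, min |y - t| 1) ^ 2) := by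
          refine Finset.prod_le_prod (fun y _ => by positivity) fun y _ => ?_
          obtain ⟨v, hv, hvn⟩ := hC _ (hcard y) y (hy y)
          have h1 : ‖F y - (evalSpan F (s.filter (· < y))).starProjection (F y)‖ ≤ ‖v‖ := by
            rw [Submodule.starProjection_minimal]
            refine (ciInf_le ⟨0, ?_⟩ ⟨F y - v, hv⟩).trans ?_
            · rintro _ ⟨z, rfl⟩; exact norm_nonneg _
            · simp
          calc _ ≤ (C * ∏ t ∈ s with t < y, min |y - t| 1) ^ 2 := by
                gcongr; exact h1.trans hvn
            _ = C ^ 2 * (∏ t ∈ s with t < y, min |y - t| 1) ^ 2 := by ring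
            _ ≤ _ := by gcongr; exact le_max_right _ _
      _ = max 1 (C ^ 2) ^ s.card * ∏ y ∈ s, (∏ t ∈ s with t < y, min |y - t| 1) ^ 2 := by
          rw [Finset.prod_mul_distrib, Finset.prod_const]
      _ ≤ _ := by
          refine mul_le_mul_of_nonneg_right ?_ (Finset.prod_nonneg fun y _ => by positivity)
          exact pow_le_pow_right₀ (le_max_left _ _) hs

theorem NondegenerateCurve.det_kernelMatrix_pos (h : NondegenerateCurve k κ F F') {s : Finset ℝ}
    (hs : s.card ≤ k) : 0 < (kernelMatrix κ s).det := by
  obtain ⟨c, C, hc, -, hb⟩ := h.exists_det_bounds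
  exact (mul_pos hc (pow_pos (truncatedVandermonde_pos s) 2)).trans_le (hb s hs).1

theorem dotProduct_gram_mulVec {ι : Type*} [Fintype ι] (v : ι → E) (a : ι → ℝ) :
    a ⬝ᵥ (Matrix.gram ℝ v).mulVec a = ‖∑ i, a i • v i‖ ^ 2 := by
  rw [← real_inner_self_eq_norm_sq, sum_inner]
  simp only [dotProduct, Matrix.mulVec, inner_sum, inner_smul_left, inner_smul_right,
    Matrix.gram_apply, Finset.mul_sum]
  exact Finset.sum_congr rfl fun i _ => Finset.sum_congr rfl fun j _ => by simp; ring

theorem kernelMatrix_eq_gram (hF : ∀ s t, inner ℝ (F s) (F t) = κ (s - t)) (s : Finset ℝ) :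
    kernelMatrix κ s = Matrix.gram ℝ (fun i : s => F i) := by
  ext i j
  simp [kernelMatrix, hF]

theorem NondegenerateCurve.posDef_kernelMatrix (h : NondegenerateCurve k κ F F') {s : Finset ℝ}
    (hs : s.card ≤ k) : (kernelMatrix κ s).PosDef := by
  have h1 : (kernelMatrix κ s).PosSemidef := by
    rw [kernelMatrix_eq_gram h.inner_eq]; exact Matrix.posSemidef_gram ℝ _
  exact h1.posDef_iff_det_ne_zero.2 (h.det_kernelMatrix_pos hs).ne'

/-- Comparison of the determinant with the product over classes of almost orthogonal points. -/
theorem NondegenerateCurve.det_kernelMatrix_classes (h : NondegenerateCurve k κ F F')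
    {γ : Type*} [LinearOrder γ] {s : Finset ℝ} (hs : s.card ≤ k) (b : ℝ → γ) {ε : ℝ}
    (hε : 0 ≤ ε) (hεk : k * ε ≤ 1)
    (hang : ∀ t₁ t₂ : Finset ℝ, t₁ ⊆ s → t₂ ⊆ s → (∀ i ∈ t₁, ∀ j ∈ t₂, b i ≠ b j) →
      ∀ u ∈ evalSpan F t₁, ∀ v ∈ evalSpan F t₂, |inner ℝ u v| ≤ ε * ‖u‖ * ‖v‖) :
    (1 - k * ε) ^ s.card * ∏ c ∈ s.image b, (kernelMatrix κ (s.filter (b · = c))).det ≤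
        (kernelMatrix κ s).det ∧
      (kernelMatrix κ s).det ≤
        (1 + k * ε) ^ s.card * ∏ c ∈ s.image b, (kernelMatrix κ (s.filter (b · = c))).det := by
  classical
  set B : Matrix s s ℝ := Matrix.of fun i j => if b i = b j then κ (i - j) else 0 with hBdef
  have hBdet : B.det = ∏ c ∈ s.image b, (kernelMatrix κ (s.filter (b · = c))).det :=
    det_eq_prod_of_classes s b fun x y => κ (x - y)
  -- `u a c` is the part of the combination carried by the class `c`; the block form is the sum of
  -- the squared norms of these parts.
  set u : (s → ℝ) → γ → E := fun a c => ∑ i : s, (if b i = c then a i else 0) • F i with hu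
  have humem : ∀ a c, u a c ∈ evalSpan F (s.filter (b · = c)) := by
    intro a c
    refine Submodule.sum_mem _ fun i _ => ?_
    split_ifs with hc
    · exact Submodule.smul_mem _ _ (apply_mem_evalSpan (by simp [hc]))
    · simp
  have hinner : ∀ a c d, inner ℝ (u a c) (u a d) =
      ∑ i : s, ∑ j : s, if b i = c ∧ b j = d then a i * a j * κ (i - j) else 0 := by
    intro a c d
    rw [hu]
    simp only
    rw [sum_inner]
    refine Finset.sum_congr rfl fun i _ => ?_
    rw [inner_sum]
    refine Finset.sum_congr rfl fun j _ => ?_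
    rw [inner_smul_left, inner_smul_right, h.inner_eq]
    by_cases h1 : b i = c <;> by_cases h2 : b j = d <;> simp [h1, h2]
    ring
  have hBform : ∀ a : s → ℝ, a ⬝ᵥ B.mulVec a = ∑ c ∈ s.image b, ‖u a c‖ ^ 2 := by
    intro a
    simp_rw [← real_inner_self_eq_norm_sq, hinner]
    rw [Finset.sum_comm]
    simp only [dotProduct, Matrix.mulVec, Finset.mul_sum]
    refine Finset.sum_congr rfl fun i _ => ?_
    rw [Finset.sum_comm]
    refine Finset.sum_congr rfl fun j _ => ?_
    rw [Finset.sum_eq_single (b i)]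
    · by_cases hij : b i = b j
      · simp [hBdef, hij]; ring
      · simp [hBdef, hij, Ne.symm hij]
    · intro c _ hc
      simp [Ne.symm hc]
    · intro hc
      exact absurd (Finset.mem_image_of_mem b i.2) hc
  have hBpos : B.PosDef := by
    have hherm : B.IsHermitian := by
      ext i j
      simp only [hBdef, Matrix.conjTranspose_apply, Matrix.of_apply, star_trivial]
      rw [← h.inner_eq, ← h.inner_eq, real_inner_comm]
      simp only [eq_comm]
    have hsemi : B.PosSemidef := Matrix.PosSemidef.of_dotProduct_mulVec_nonneg hherm fun a => by
      rw [star_trivial, hBform]; positivity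
    refine hsemi.posDef_iff_det_ne_zero.2 ?_
    rw [hBdet]
    exact Finset.prod_ne_zero_iff.2 fun c _ =>
      (h.det_kernelMatrix_pos ((Finset.card_filter_le _ _).trans hs)).ne'
  have hG := (h.posDef_kernelMatrix hs).isHermitian
  have hcard : Fintype.card s = s.card := Fintype.card_coe s
  rw [← hBdet, ← hcard]
  refine det_bounds_of_quadratic_form_le hBpos hG hεk fun a => ?_
  have hsum : ∑ i : s, a i • F i = ∑ c ∈ s.image b, u a c := by
    rw [hu]
    simp only
    rw [Finset.sum_comm]
    refine Finset.sum_congr rfl fun i _ => ?_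
    rw [Finset.sum_eq_single (b i)]
    · simp
    · intro c _ hc; simp [Ne.symm hc]
    · intro hc; exact absurd (Finset.mem_image_of_mem b i.2) hc
  rw [kernelMatrix_eq_gram h.inner_eq, dotProduct_gram_mulVec, hBform, hsum,
    ← real_inner_self_eq_norm_sq, sum_inner]
  simp_rw [inner_sum]
  rw [← Finset.sum_sub_distrib]
  have hterm : ∀ c ∈ s.image b, |∑ d ∈ s.image b, inner ℝ (u a c) (u a d) - ‖u a c‖ ^ 2| ≤
      ∑ d ∈ s.image b, ε * ‖u a c‖ * ‖u a d‖ := by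
    intro c hc
    rw [← Finset.add_sum_erase _ _ hc, real_inner_self_eq_norm_sq, add_sub_cancel_left]
    refine (Finset.abs_sum_le_sum_abs _ _).trans ?_
    refine (Finset.sum_le_sum (g := fun d => ε * ‖u a c‖ * ‖u a d‖) fun d hd => ?_).trans
      (Finset.sum_le_sum_of_subset_of_nonneg (Finset.erase_subset _ _)
        fun d _ _ => by positivity)
    refine hang _ _ (Finset.filter_subset _ _) (Finset.filter_subset _ _) (fun i hi j hj => ?_)
      _ (humem a c) _ (humem a d)
    rw [(Finset.mem_filter.1 hi).2, (Finset.mem_filter.1 hj).2]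
    exact (Finset.mem_erase.1 hd).1.symm
  refine (Finset.abs_sum_le_sum_abs _ _).trans ((Finset.sum_le_sum hterm).trans ?_)
  have e1 : ∑ c ∈ s.image b, ∑ d ∈ s.image b, ε * ‖u a c‖ * ‖u a d‖ =
      ε * (∑ c ∈ s.image b, ‖u a c‖) ^ 2 := by
    rw [pow_two, Finset.sum_mul_sum, Finset.mul_sum]
    refine Finset.sum_congr rfl fun c _ => ?_
    rw [Finset.mul_sum]
    exact Finset.sum_congr rfl fun d _ => by ring
  rw [e1]
  -- There are at most `k` classes, which accounts for the factor `k` in the relative error `k ε`.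
  have e2 : (∑ c ∈ s.image b, ‖u a c‖) ^ 2 ≤ k * ∑ c ∈ s.image b, ‖u a c‖ ^ 2 := by
    refine (sq_sum_le_card_mul_sum_sq (s := s.image b) (f := fun c => ‖u a c‖)).trans ?_
    gcongr
    exact_mod_cast Finset.card_image_le.trans hs
  calc _ ≤ ε * (k * ∑ c ∈ s.image b, ‖u a c‖ ^ 2) := by gcongr
    _ = _ := by ring

end

/-! ### Gaussian vectors and expectations of products of absolute values. -/

/-- `ν` has the characteristic function of a centered Gaussian vector of covariance `S`. -/
def IsGaussianVector {ι : Type*} [Fintype ι] (ν : Measure (ι → ℝ)) (S : Matrix ι ι ℝ) : Prop :=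
  ∀ a : ι → ℝ, ∫ x, Complex.exp ((a ⬝ᵥ x : ℝ) * Complex.I) ∂ν =
    Complex.exp (-((a ⬝ᵥ S.mulVec a : ℝ) : ℂ) / 2)

theorem aestronglyMeasurable_prod_abs {ι : Type*} [Fintype ι] (ν : Measure (ι → ℝ)) :
    AEStronglyMeasurable (fun x => ∏ i, |x i|) ν :=
  (by fun_prop : Continuous fun x : ι → ℝ => ∏ i, |x i|).aestronglyMeasurable

theorem measurable_comp_equiv {ι κ : Type*} (e : κ → ι) :
    Measurable fun x : ι → ℝ => x ∘ e :=
  measurable_pi_lambda _ fun i => measurable_pi_apply (e i)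

theorem measurable_sigma_uncurry {o : Type*} {β : o → Type*} :
    Measurable fun (x : ∀ c, β c → ℝ) (p : Σ c, β c) => x p.1 p.2 :=
  measurable_pi_lambda _ fun p => (measurable_pi_apply p.2).comp (measurable_pi_apply p.1)

theorem IsGaussianVector.unique {ι : Type*} [Fintype ι] {ν ν' : Measure (ι → ℝ)}
    [IsProbabilityMeasure ν] [IsProbabilityMeasure ν'] {S : Matrix ι ι ℝ}
    (h : IsGaussianVector ν S) (h' : IsGaussianVector ν' S) : ν = ν' := by
  classical
  refine Measure.ext_of_charFunDual ?_
  ext L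
  have hL : ∀ x : ι → ℝ, L x = (fun i => L (Pi.single i 1)) ⬝ᵥ x := by
    intro x
    conv_lhs => rw [pi_eq_sum_univ' x, map_sum]
    simp only [dotProduct, map_smul, smul_eq_mul]
    exact Finset.sum_congr rfl fun i _ => mul_comm _ _
  rw [charFunDual_apply, charFunDual_apply]
  have h1 := h fun i => L (Pi.single i 1)
  have h2 := h' fun i => L (Pi.single i 1)
  rw [← h2] at h1
  calc _ = _ := integral_congr_ae (Eventually.of_forall fun x => by rw [hL x])
    _ = _ := h1
    _ = _ := integral_congr_ae (Eventually.of_forall fun x => by rw [hL x])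

theorem IsGaussianVector.map {ι κ : Type*} [Fintype ι] [Fintype κ] {ν : Measure (ι → ℝ)}
    {S : Matrix ι ι ℝ} (h : IsGaussianVector ν S) (A : Matrix κ ι ℝ) :
    IsGaussianVector (ν.map A.mulVec) (A * S * A.transpose) := by
  intro a
  have hm : Measurable (A.mulVec : (ι → ℝ) → κ → ℝ) :=
    (LinearMap.continuous_of_finiteDimensional (Matrix.mulVecLin A)).measurable
  rw [integral_map hm.aemeasurable (by fun_prop)]
  have e1 : ∀ x, a ⬝ᵥ A.mulVec x = A.transpose.mulVec a ⬝ᵥ x := fun x => by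
    rw [Matrix.dotProduct_mulVec, Matrix.mulVec_transpose]
  have e2 : a ⬝ᵥ (A * S * A.transpose).mulVec a =
      A.transpose.mulVec a ⬝ᵥ S.mulVec (A.transpose.mulVec a) := by
    rw [← Matrix.mulVec_mulVec, ← Matrix.mulVec_mulVec, Matrix.dotProduct_mulVec a,
      Matrix.mulVec_transpose]
  simp_rw [e1]
  rw [h, e2]

theorem IsGaussianVector.map_reindex {ι κ : Type*} [Fintype ι] [Fintype κ] {ν : Measure (ι → ℝ)}
    {S : Matrix ι ι ℝ} (h : IsGaussianVector ν S) (e : κ ≃ ι) :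
    IsGaussianVector (ν.map fun x => x ∘ e) (S.submatrix e e) := by
  intro a
  rw [integral_map (measurable_comp_equiv e).aemeasurable (by fun_prop)]
  have e1 : ∀ x : ι → ℝ, a ⬝ᵥ (x ∘ e) = (a ∘ e.symm) ⬝ᵥ x := fun x => by
    simp only [dotProduct]
    rw [← e.sum_comp]
    simp
  have e2 : a ⬝ᵥ (S.submatrix e e).mulVec a = (a ∘ e.symm) ⬝ᵥ S.mulVec (a ∘ e.symm) := by
    simp only [dotProduct, Matrix.mulVec, Matrix.submatrix_apply]
    rw [← e.sum_comp]
    refine Finset.sum_congr rfl fun i _ => ?_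
    rw [← e.sum_comp (fun j => S (e i) j * (a ∘ e.symm) j)]
    simp
  simp_rw [e1]
  rw [h, e2]

theorem IsGaussianVector.map_add_smul {ι : Type*} [Fintype ι] {ν τ : Measure (ι → ℝ)}
    [IsProbabilityMeasure ν] [IsProbabilityMeasure τ] {S T : Matrix ι ι ℝ}
    (h : IsGaussianVector ν S) (h' : IsGaussianVector τ T) (c : ℝ) :
    IsGaussianVector ((ν.prod τ).map fun p => p.1 + c • p.2) (S + c ^ 2 • T) := by
  intro a
  rw [integral_map (by fun_prop) (by fun_prop)]
  have e1 : ∀ p : (ι → ℝ) × (ι → ℝ), Complex.exp ((a ⬝ᵥ (p.1 + c • p.2) : ℝ) * Complex.I) =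
      Complex.exp ((a ⬝ᵥ p.1 : ℝ) * Complex.I) *
        Complex.exp (((c • a) ⬝ᵥ p.2 : ℝ) * Complex.I) := fun p => by
    rw [← Complex.exp_add, dotProduct_add, dotProduct_smul, smul_dotProduct]
    push_cast
    ring_nf
  simp_rw [e1]
  rw [integral_prod_mul (fun x => Complex.exp ((a ⬝ᵥ x : ℝ) * Complex.I))
    (fun y => Complex.exp (((c • a) ⬝ᵥ y : ℝ) * Complex.I)), h, h', ← Complex.exp_add,
    Matrix.add_mulVec, Matrix.smul_mulVec, dotProduct_add, dotProduct_smul, Matrix.mulVec_smul,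
    dotProduct_smul, smul_dotProduct]
  congr 1
  simp only [smul_eq_mul]
  push_cast
  ring

theorem IsGaussianVector.map_eval {ι : Type*} [Fintype ι] {ν : Measure (ι → ℝ)}
    [IsProbabilityMeasure ν] {S : Matrix ι ι ℝ} (h : IsGaussianVector ν S) (i : ι)
    (hi : 0 ≤ S i i) : ν.map (fun x => x i) = gaussianReal 0 (S i i).toNNReal := by
  classical
  have : IsProbabilityMeasure (ν.map fun x => x i) :=
    Measure.isProbabilityMeasure_map (measurable_pi_apply i).aemeasurable
  refine Measure.ext_of_charFun ?_
  ext t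
  rw [charFun_gaussianReal, charFun_apply_real,
    integral_map (measurable_pi_apply i).aemeasurable (by fun_prop)]
  have h1 := h (Pi.single i t)
  simp only [single_dotProduct, Matrix.mulVec_single, Pi.smul_apply, MulOpposite.smul_eq_mul_unop,
    MulOpposite.unop_op, Matrix.col_apply] at h1
  push_cast at h1
  rw [h1, Real.coe_toNNReal _ hi]
  congr 1
  push_cast
  ring

/-- The law of a centered Gaussian vector of covariance `S`. -/
noncomputable def gaussianVector {ι : Type*} [Fintype ι] [DecidableEq ι] (S : Matrix ι ι ℝ) :
    Measure (ι → ℝ) := (multivariateGaussian 0 S).map WithLp.ofLp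

instance {ι : Type*} [Fintype ι] [DecidableEq ι] (S : Matrix ι ι ℝ) :
    IsProbabilityMeasure (gaussianVector S) :=
  Measure.isProbabilityMeasure_map (by fun_prop)

theorem isGaussianVector_gaussianVector {ι : Type*} [Fintype ι] [DecidableEq ι]
    {S : Matrix ι ι ℝ} (hS : S.PosSemidef) : IsGaussianVector (gaussianVector S) S := by
  intro a
  rw [gaussianVector, integral_map (by fun_prop) (by fun_prop)]
  have h := charFun_multivariateGaussian (μ := 0) hS (WithLp.toLp 2 a)
  rw [charFun_apply] at h
  simp only [inner_zero_right, Complex.ofReal_zero, zero_mul, zero_sub] at h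
  rw [neg_div, ← h]
  refine integral_congr_ae (Eventually.of_forall fun x => ?_)
  simp only
  congr 3

/-- The expectation of `∏ i, |x i|` for a centered Gaussian vector of covariance `S`. -/
noncomputable def absMoment {ι : Type*} [Fintype ι] [DecidableEq ι] (S : Matrix ι ι ℝ) : ℝ :=
  ∫ x, ∏ i, |x i| ∂gaussianVector S

theorem IsGaussianVector.integral_prod_abs {ι : Type*} [Fintype ι] [DecidableEq ι]
    {ν : Measure (ι → ℝ)} [IsProbabilityMeasure ν] {S : Matrix ι ι ℝ} (hS : S.PosSemidef)
    (h : IsGaussianVector ν S) : ∫ x, ∏ i, |x i| ∂ν = absMoment S := by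
  rw [absMoment, h.unique (isGaussianVector_gaussianVector hS)]

theorem absMoment_nonneg {ι : Type*} [Fintype ι] [DecidableEq ι] (S : Matrix ι ι ℝ) :
    0 ≤ absMoment S :=
  integral_nonneg fun _ => Finset.prod_nonneg fun _ _ => abs_nonneg _

theorem absMoment_submatrix {ι κ : Type*} [Fintype ι] [DecidableEq ι] [Fintype κ]
    [DecidableEq κ] {S : Matrix ι ι ℝ} (hS : S.PosSemidef) (e : κ ≃ ι) :
    absMoment (S.submatrix e e) = absMoment S := by
  have hp : IsProbabilityMeasure ((gaussianVector S).map fun x => x ∘ e) :=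
    Measure.isProbabilityMeasure_map (measurable_comp_equiv e).aemeasurable
  rw [← ((isGaussianVector_gaussianVector hS).map_reindex e).integral_prod_abs (hS.submatrix e),
    integral_map (measurable_comp_equiv e).aemeasurable (aestronglyMeasurable_prod_abs _)]
  simp only [Function.comp_apply, absMoment]
  exact integral_congr_ae (Eventually.of_forall fun x => e.prod_comp fun i => |x i|)

theorem absMoment_scale {ι : Type*} [Fintype ι] [DecidableEq ι] {S : Matrix ι ι ℝ}
    (hS : S.PosSemidef) (d : ι → ℝ) :
    absMoment (Matrix.of fun i j => d i * S i j * d j) = (∏ i, |d i|) * absMoment S := by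
  have e1 : (Matrix.of fun i j => d i * S i j * d j) =
      Matrix.diagonal d * S * (Matrix.diagonal d).transpose := by
    ext i j; simp [Matrix.diagonal_transpose, Matrix.mul_diagonal, Matrix.diagonal_mul]
  have hm : Measurable ((Matrix.diagonal d).mulVec : (ι → ℝ) → ι → ℝ) :=
    (LinearMap.continuous_of_finiteDimensional (Matrix.mulVecLin (Matrix.diagonal d))).measurable
  have hp : IsProbabilityMeasure ((gaussianVector S).map (Matrix.diagonal d).mulVec) :=
    Measure.isProbabilityMeasure_map hm.aemeasurable
  have hps : (Matrix.diagonal d * S * (Matrix.diagonal d).transpose).PosSemidef := by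
    have := hS.mul_mul_conjTranspose_same (Matrix.diagonal d)
    rwa [Matrix.conjTranspose_eq_transpose_of_trivial] at this
  rw [e1, ← ((isGaussianVector_gaussianVector hS).map (Matrix.diagonal d)).integral_prod_abs hps,
    integral_map hm.aemeasurable (aestronglyMeasurable_prod_abs _), absMoment, ← integral_const_mul]
  refine integral_congr_ae (Eventually.of_forall fun x => ?_)
  simp only [Matrix.mulVec_diagonal, abs_mul, Finset.prod_mul_distrib]

/-- Uncorrelated Gaussian blocks are independent: the product measure has the right characteristic
function, and the integrand splits over the blocks. -/
theorem absMoment_blockDiagonal {o : Type*} [Fintype o] [DecidableEq o] {β : o → Type*}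
    [∀ c, Fintype (β c)] [∀ c, DecidableEq (β c)] {M : ∀ c, Matrix (β c) (β c) ℝ}
    (hM : ∀ c, (M c).PosSemidef) (hB : (Matrix.blockDiagonal' M).PosSemidef) :
    absMoment (Matrix.blockDiagonal' M) = ∏ c, absMoment (M c) := by
  set ν := (Measure.pi fun c => gaussianVector (M c)).map
    (fun (x : ∀ c, β c → ℝ) (p : Σ c, β c) => x p.1 p.2) with hν
  have hp : IsProbabilityMeasure ν :=
    Measure.isProbabilityMeasure_map measurable_sigma_uncurry.aemeasurable
  have hG : IsGaussianVector ν (Matrix.blockDiagonal' M) := by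
    intro a
    rw [hν, integral_map measurable_sigma_uncurry.aemeasurable (by fun_prop)]
    have e1 : ∀ x : ∀ c, β c → ℝ,
        Complex.exp ((a ⬝ᵥ (fun p : Σ c, β c => x p.1 p.2) : ℝ) * Complex.I) =
        ∏ c, Complex.exp (((fun i => a ⟨c, i⟩) ⬝ᵥ x c : ℝ) * Complex.I) := by
      intro x
      rw [← Complex.exp_sum, ← Finset.sum_mul]
      congr 2
      simp only [dotProduct, Fintype.sum_sigma]
      push_cast
      rfl
    simp_rw [e1]
    rw [integral_fintype_prod_eq_prod (fun c (y : β c → ℝ) =>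
      Complex.exp (((fun i => a ⟨c, i⟩) ⬝ᵥ y : ℝ) * Complex.I))]
    simp_rw [fun c => isGaussianVector_gaussianVector (hM c) (fun i => a ⟨c, i⟩)]
    rw [← Complex.exp_sum]
    congr 1
    rw [← Finset.sum_div, Finset.sum_neg_distrib]
    congr 2
    simp only [dotProduct, Fintype.sum_sigma, Matrix.mulVec]
    push_cast
    refine Finset.sum_congr rfl fun c _ => Finset.sum_congr rfl fun i _ => ?_
    congr 1
    rw [Finset.sum_eq_single c]
    · simp [Matrix.blockDiagonal'_apply_eq]
    · intro d _ hd
      exact Finset.sum_eq_zero fun j _ => by rw [Matrix.blockDiagonal'_apply_ne _ _ _ hd.symm]; simp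
    · simp
  rw [← hG.integral_prod_abs hB, hν,
    integral_map measurable_sigma_uncurry.aemeasurable (aestronglyMeasurable_prod_abs _)]
  simp only [Fintype.prod_sigma]
  rw [integral_fintype_prod_eq_prod (fun c (y : β c → ℝ) => ∏ i, |y i|)]
  rfl

/-- Moments of a standard Gaussian variable. -/
noncomputable def gaussianAbsMoment (p : ℕ) : ℝ := ∫ z, |z| ^ p ∂gaussianReal 0 1

theorem integrable_abs_pow_gaussianReal (v : NNReal) (p : ℕ) :
    Integrable (fun z : ℝ => |z| ^ p) (gaussianReal 0 v) := by
  have h : MemLp id p (gaussianReal 0 v) := memLp_id_gaussianReal p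
  simpa using h.integrable_norm_pow'

theorem integral_abs_pow_gaussianReal (v : NNReal) (p : ℕ) :
    ∫ z, |z| ^ p ∂gaussianReal 0 v = √v ^ p * gaussianAbsMoment p := by
  have h := gaussianReal_map_const_mul (μ := 0) (v := 1) (√(v : ℝ))
  have e : NNReal.mk (√(v : ℝ) ^ 2) (sq_nonneg _) * 1 = v := by
    rw [mul_one]; ext; simp
  rw [mul_zero, e] at h
  rw [← h, integral_map (by fun_prop) (by fun_prop), gaussianAbsMoment, ← integral_const_mul]
  simp only [abs_mul, mul_pow, abs_of_nonneg (Real.sqrt_nonneg _)]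

theorem gaussianAbsMoment_nonneg (p : ℕ) : 0 ≤ gaussianAbsMoment p :=
  integral_nonneg fun _ => by positivity

section

variable {ι : Type*} [Fintype ι] {ν : Measure (ι → ℝ)} [IsProbabilityMeasure ν]
  {S : Matrix ι ι ℝ}

theorem IsGaussianVector.integrable_abs_pow (h : IsGaussianVector ν S) {i : ι} (hi : 0 ≤ S i i)
    (p : ℕ) : Integrable (fun x => |x i| ^ p) ν := by
  have h1 := integrable_abs_pow_gaussianReal (S i i).toNNReal p
  rw [← h.map_eval i hi] at h1
  exact h1.comp_measurable (measurable_pi_apply i)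

theorem IsGaussianVector.integral_abs_pow (h : IsGaussianVector ν S) {i : ι} (hi : 0 ≤ S i i)
    (p : ℕ) : ∫ x, |x i| ^ p ∂ν = √(S i i) ^ p * gaussianAbsMoment p := by
  have h1 := integral_abs_pow_gaussianReal (S i i).toNNReal p
  rw [← h.map_eval i hi, integral_map (measurable_pi_apply i).aemeasurable (by fun_prop),
    Real.coe_toNNReal _ hi] at h1
  exact h1

end

theorem prod_le_one_add_sum_pow {ι : Type*} [Fintype ι] (z : ι → ℝ) (hz : ∀ i, 0 ≤ z i) :
    ∏ i, z i ≤ 1 + ∑ i, z i ^ Fintype.card ι := by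
  rcases isEmpty_or_nonempty ι with h | h
  · simp
  obtain ⟨m, -, hm⟩ := Finset.exists_max_image Finset.univ z Finset.univ_nonempty
  calc ∏ i, z i ≤ ∏ _i : ι, z m := Finset.prod_le_prod (fun i _ => hz i) fun i hi => hm i hi
    _ = z m ^ Fintype.card ι := by simp
    _ ≤ ∑ i, z i ^ Fintype.card ι := Finset.single_le_sum
        (f := fun i => z i ^ Fintype.card ι) (fun i _ => pow_nonneg (hz i) _) (Finset.mem_univ m)
    _ ≤ _ := by linarith

theorem IsGaussianVector.integrable_prod_abs {ι : Type*} [Fintype ι] {ν : Measure (ι → ℝ)}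
    [IsProbabilityMeasure ν] {S : Matrix ι ι ℝ} (h : IsGaussianVector ν S)
    (hS : ∀ i, 0 ≤ S i i) : Integrable (fun x => ∏ i, |x i|) ν := by
  have hint : Integrable (fun x : ι → ℝ => 1 + ∑ i, |x i| ^ Fintype.card ι) ν :=
    (integrable_const _).add (integrable_finsetSum _ fun i _ => h.integrable_abs_pow (hS i) _)
  refine hint.mono' (aestronglyMeasurable_prod_abs _) (Eventually.of_forall fun x => ?_)
  rw [Real.norm_of_nonneg (Finset.prod_nonneg fun _ _ => abs_nonneg _)]
  exact prod_le_one_add_sum_pow _ fun _ => abs_nonneg _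

theorem absMoment_le_of_diag_eq_one {ι : Type*} [Fintype ι] [DecidableEq ι] {S : Matrix ι ι ℝ}
    (hS : S.PosSemidef) (h1 : ∀ i, S i i = 1) :
    absMoment S ≤ 1 + Fintype.card ι * gaussianAbsMoment (Fintype.card ι) := by
  have h := isGaussianVector_gaussianVector hS
  have h0 : ∀ i, 0 ≤ S i i := fun i => by rw [h1]; exact zero_le_one
  calc absMoment S ≤ ∫ x, (1 + ∑ i, |x i| ^ Fintype.card ι) ∂gaussianVector S :=
        integral_mono (h.integrable_prod_abs h0)
          ((integrable_const _).add (integrable_finsetSum _ fun i _ =>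
            h.integrable_abs_pow (h0 i) _))
          fun x => prod_le_one_add_sum_pow _ fun _ => abs_nonneg _
    _ = _ := by
        rw [integral_add (integrable_const _) (integrable_finsetSum _ fun i _ =>
          h.integrable_abs_pow (h0 i) _), integral_finsetSum _ fun i _ =>
          h.integrable_abs_pow (h0 i) _]
        simp [h.integral_abs_pow (h0 _), h1]

/-- Each coordinate lies in `[-δ, δ]` with probability at most `δ`. With `δ = 1 / (2 (n + 1))` a
union bound, insensitive to correlations, leaves probability at least `1/2` that every factor
exceeds `δ`. -/
theorem le_absMoment_of_diag_eq_one {ι : Type*} [Fintype ι] [DecidableEq ι] {S : Matrix ι ι ℝ}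
    (hS : S.PosSemidef) (h1 : ∀ i, S i i = 1) :
    (2 * (Fintype.card ι + 1 : ℝ))⁻¹ ^ Fintype.card ι / 2 ≤ absMoment S := by
  have h := isGaussianVector_gaussianVector hS
  have h0 : ∀ i, 0 ≤ S i i := fun i => by rw [h1]; exact zero_le_one
  set n := Fintype.card ι
  set δ : ℝ := (2 * (n + 1 : ℝ))⁻¹ with hδ
  have hδ0 : 0 < δ := by positivity
  set A : Set (ι → ℝ) := ⋃ i, {x | x i ∈ Icc (-δ) δ} with hA
  have hAm : MeasurableSet A := MeasurableSet.iUnion fun i =>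
    measurableSet_Icc.preimage (measurable_pi_apply i)
  have hAi : ∀ i, gaussianVector S {x | x i ∈ Icc (-δ) δ} ≤ ENNReal.ofReal δ := by
    intro i
    have e := h.map_eval i (h0 i)
    have e2 : gaussianVector S {x | x i ∈ Icc (-δ) δ} = gaussianReal 0 1 (Icc (-δ) δ) := by
      rw [h1, Real.toNNReal_one] at e
      rw [← e, Measure.map_apply (by fun_prop) measurableSet_Icc]
      rfl
    rw [e2]
    refine (gaussianReal_Icc_le one_ne_zero).trans (ENNReal.ofReal_le_ofReal ?_)
    have : 2 ≤ √(2 * Real.pi * (1 : NNReal)) := by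
      rw [Real.le_sqrt (by norm_num) (by positivity)]
      simp
      linarith [Real.pi_gt_three]
    rw [div_le_iff₀ (by linarith)]
    nlinarith
  have hAr : (gaussianVector S).real A ≤ 1 / 2 := by
    have h2 : gaussianVector S A ≤ ENNReal.ofReal (1 / 2) := by
      refine (measure_iUnion_le _).trans ?_
      rw [tsum_fintype]
      refine (Finset.sum_le_sum fun i _ => hAi i).trans ?_
      rw [Finset.sum_const, nsmul_eq_mul, ← ENNReal.ofReal_natCast,
        ← ENNReal.ofReal_mul (by positivity)]
      refine ENNReal.ofReal_le_ofReal ?_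
      rw [Finset.card_univ, hδ, ← div_eq_mul_inv, div_le_div_iff₀ (by positivity) two_pos]
      linarith
    exact ENNReal.toReal_le_of_le_ofReal (by norm_num) h2
  have hAc : 1 / 2 ≤ (gaussianVector S).real Aᶜ := by
    rw [probReal_compl_eq_one_sub hAm]; linarith
  calc δ ^ n / 2 ≤ (gaussianVector S).real Aᶜ * δ ^ n := by
        have := pow_pos hδ0 n
        nlinarith
    _ = ∫ x, Aᶜ.indicator (fun _ => δ ^ n) x ∂gaussianVector S := by
        rw [integral_indicator_const _ hAm.compl, smul_eq_mul]
    _ ≤ absMoment S := by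
        refine integral_mono ((integrable_const _).indicator hAm.compl)
          (h.integrable_prod_abs h0) fun x => ?_
        by_cases hx : x ∈ A
        · rw [indicator_of_notMem (by simpa using hx)]
          exact Finset.prod_nonneg fun _ _ => abs_nonneg _
        · rw [indicator_of_mem (by simpa using hx)]
          simp only [hA, mem_iUnion, not_exists, mem_ofPred_eq, mem_Icc, not_and_or, not_le] at hx
          calc δ ^ n = ∏ _i : ι, δ := by simp [n]
            _ ≤ _ := Finset.prod_le_prod (fun _ _ => hδ0.le) fun i _ => by
                rcases hx i with h3 | h3
                · rw [abs_of_neg (by linarith)]; linarith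
                · exact h3.le.trans (le_abs_self _)

theorem abs_prod_add_sub_prod_le {ι : Type*} (s : Finset ι) (x y : ι → ℝ) (c : ℝ) (hc0 : 0 ≤ c)
    (hc : c ≤ 1) :
    |(∏ i ∈ s, |x i + c * y i|) - (∏ i ∈ s, |x i|)| ≤ c * s.card * ∏ i ∈ s, (|x i| + |y i|) := by
  classical
  have hle : ∀ i, |x i + c * y i| ≤ |x i| + |y i| := fun i => by
    refine (abs_add_le _ _).trans ?_
    rw [abs_mul, abs_of_nonneg hc0]
    have := mul_le_of_le_one_left (abs_nonneg (y i)) hc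
    linarith
  induction s using Finset.induction_on with
  | empty => simp
  | insert i s hi ih =>
    rw [Finset.prod_insert hi, Finset.prod_insert hi, Finset.prod_insert hi,
      Finset.card_insert_of_notMem hi]
    set A := ∏ i ∈ s, |x i + c * y i| with hA
    set B := ∏ i ∈ s, |x i|
    set D := ∏ i ∈ s, (|x i| + |y i|)
    have hD0 : 0 ≤ D := Finset.prod_nonneg fun _ _ => by positivity
    have hA0 : 0 ≤ A := Finset.prod_nonneg fun _ _ => by positivity
    have hAD : A ≤ D := Finset.prod_le_prod (fun _ _ => abs_nonneg _) fun i _ => hle i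
    have e : |x i + c * y i| * A - |x i| * B =
        (|x i + c * y i| - |x i|) * A + |x i| * (A - B) := by ring
    rw [e]
    refine (abs_add_le _ _).trans ?_
    rw [abs_mul, abs_mul, abs_abs, abs_of_nonneg hA0]
    have h1 : |(|x i + c * y i| - |x i|)| ≤ c * |y i| := by
      refine (abs_abs_sub_abs_le _ _).trans ?_
      rw [add_sub_cancel_left, abs_mul, abs_of_nonneg hc0]
    have h2 : |(|x i + c * y i| - |x i|)| * A ≤ c * |y i| * D := by gcongr
    have h3 : |x i| * |A - B| ≤ |x i| * (c * s.card * D) := by gcongr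
    push_cast
    have h4 : 0 ≤ c * |x i| * D := by positivity
    have h5 : 0 ≤ c * s.card * |y i| * D := by positivity
    nlinarith

/-- `S + c² T` is the covariance of `X + c Y` with `X` and `Y` independent, and telescoping the
product gives an error linear in `c`. In terms of the size `c²` of the perturbation this is a square
root. -/
theorem abs_absMoment_add_smul_sub_le {ι : Type*} [Fintype ι] [DecidableEq ι]
    {S T : Matrix ι ι ℝ} (hS : S.PosSemidef) (hT : T.PosSemidef) {K : ℝ}
    (hSK : ∀ i, S i i ≤ K) (hTK : ∀ i, T i i ≤ K) {c : ℝ} (hc0 : 0 ≤ c) (hc : c ≤ 1) :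
    |absMoment (S + c ^ 2 • T) - absMoment S| ≤ c * (Fintype.card ι *
      (1 + Fintype.card ι * (2 ^ Fintype.card ι *
        (2 * (√K ^ Fintype.card ι * gaussianAbsMoment (Fintype.card ι)))))) := by
  have hSg := isGaussianVector_gaussianVector hS
  have hTg := isGaussianVector_gaussianVector hT
  have hS0 : ∀ i, 0 ≤ S i i := fun i => hS.diag_nonneg
  have hT0 : ∀ i, 0 ≤ T i i := fun i => hT.diag_nonneg
  set ν := gaussianVector S
  set τ := gaussianVector T
  set n := Fintype.card ι with hn
  have hp : IsProbabilityMeasure ((ν.prod τ).map fun p => p.1 + c • p.2) :=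
    Measure.isProbabilityMeasure_map (by fun_prop)
  have hsum := hSg.map_add_smul hTg c
  have hST : (S + c ^ 2 • T).PosSemidef := hS.add (hT.smul (sq_nonneg c))
  have hST0 : ∀ i, 0 ≤ (S + c ^ 2 • T) i i := fun i => hST.diag_nonneg
  have e1 : absMoment (S + c ^ 2 • T) = ∫ p, ∏ i, |p.1 i + c * p.2 i| ∂ν.prod τ := by
    rw [← hsum.integral_prod_abs hST, integral_map (by fun_prop) (aestronglyMeasurable_prod_abs _)]
    rfl
  have i1 : Integrable (fun p : (ι → ℝ) × (ι → ℝ) => ∏ i, |p.1 i + c * p.2 i|) (ν.prod τ) :=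
    (hsum.integrable_prod_abs hST0).comp_measurable
      (f := fun p : (ι → ℝ) × (ι → ℝ) => p.1 + c • p.2) (by fun_prop)
  have i2 : Integrable (fun p : (ι → ℝ) × (ι → ℝ) => ∏ i, |p.1 i|) (ν.prod τ) :=
    (hSg.integrable_prod_abs hS0).comp_fst τ
  have e2 : absMoment S = ∫ p, ∏ i, |p.1 i| ∂ν.prod τ := by
    rw [← hSg.integral_prod_abs hS, integral_fun_fst (fun x : ι → ℝ => ∏ i, |x i|)]
    simp
  have i3 : ∀ i, Integrable (fun p : (ι → ℝ) × (ι → ℝ) => |p.1 i| ^ n) (ν.prod τ) := fun i =>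
    (hSg.integrable_abs_pow (hS0 i) n).comp_fst τ
  have i4 : ∀ i, Integrable (fun p : (ι → ℝ) × (ι → ℝ) => |p.2 i| ^ n) (ν.prod τ) := fun i =>
    (hTg.integrable_abs_pow (hT0 i) n).comp_snd ν
  have i6 : ∀ i, Integrable (fun p : (ι → ℝ) × (ι → ℝ) => 2 ^ n * (|p.1 i| ^ n + |p.2 i| ^ n))
      (ν.prod τ) := fun i => ((i3 i).add (i4 i)).const_mul _
  have i5 : Integrable (fun p : (ι → ℝ) × (ι → ℝ) =>
      c * (n * (1 + ∑ i, 2 ^ n * (|p.1 i| ^ n + |p.2 i| ^ n)))) (ν.prod τ) :=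
    (((integrable_const _).add (integrable_finsetSum _ fun i _ => i6 i)).const_mul _).const_mul _
  have hbound : ∀ p : (ι → ℝ) × (ι → ℝ), |(∏ i, |p.1 i + c * p.2 i|) - (∏ i, |p.1 i|)| ≤
      c * (n * (1 + ∑ i, 2 ^ n * (|p.1 i| ^ n + |p.2 i| ^ n))) := by
    intro p
    refine (abs_prod_add_sub_prod_le Finset.univ p.1 p.2 c hc0 hc).trans ?_
    rw [Finset.card_univ, mul_assoc]
    gcongr
    refine (prod_le_one_add_sum_pow _ fun i => by positivity).trans ?_
    gcongr with i
    have h2 : (|p.1 i| + |p.2 i|) ^ n ≤ (2 * max |p.1 i| |p.2 i|) ^ n := by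
      gcongr
      linarith [le_max_left |p.1 i| |p.2 i|, le_max_right |p.1 i| |p.2 i|]
    refine h2.trans ?_
    rw [mul_pow]
    gcongr
    rcases max_choice |p.1 i| |p.2 i| with h3 | h3 <;> rw [h3]
    · have : 0 ≤ |p.2 i| ^ n := by positivity
      linarith
    · have : 0 ≤ |p.1 i| ^ n := by positivity
      linarith
  have hm : ∀ {M : ℝ}, 0 ≤ M → M ≤ K → √M ^ n * gaussianAbsMoment n ≤
      √K ^ n * gaussianAbsMoment n := fun h0 h1 => by
    have := gaussianAbsMoment_nonneg n
    gcongr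
  have e3 : ∀ i, ∫ p : (ι → ℝ) × (ι → ℝ), |p.1 i| ^ n ∂ν.prod τ ≤ √K ^ n * gaussianAbsMoment n := by
    intro i
    rw [integral_fun_fst (fun x : ι → ℝ => |x i| ^ n), hSg.integral_abs_pow (hS0 i)]
    simpa using hm (hS0 i) (hSK i)
  have e4 : ∀ i, ∫ p : (ι → ℝ) × (ι → ℝ), |p.2 i| ^ n ∂ν.prod τ ≤ √K ^ n * gaussianAbsMoment n := by
    intro i
    rw [integral_fun_snd (fun x : ι → ℝ => |x i| ^ n), hTg.integral_abs_pow (hT0 i)]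
    simpa using hm (hT0 i) (hTK i)
  rw [e1, e2, ← integral_sub i1 i2]
  refine abs_integral_le_integral_abs.trans ((integral_mono (i1.sub i2).abs i5 hbound).trans ?_)
  rw [integral_const_mul, integral_const_mul, integral_add (integrable_const _)
    (integrable_finsetSum _ fun i _ => i6 i), integral_finsetSum _ fun i _ => i6 i]
  simp only [integral_const, probReal_univ, one_smul, integral_const_mul]
  gcongr
  calc ∑ i, 2 ^ n * ∫ p : (ι → ℝ) × (ι → ℝ), (|p.1 i| ^ n + |p.2 i| ^ n) ∂ν.prod τ
      ≤ ∑ _i : ι, 2 ^ n * (2 * (√K ^ n * gaussianAbsMoment n)) := by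
        refine Finset.sum_le_sum fun i _ => ?_
        rw [integral_add (i3 i) (i4 i)]
        have := e3 i
        have := e4 i
        gcongr
        linarith
    _ = _ := by simp [hn]

theorem posSemidef_add_smul_one {ι : Type*} [Fintype ι] [DecidableEq ι] {N : Matrix ι ι ℝ}
    (hN : N.IsHermitian) (h : ∀ i j, |N i j| ≤ 1) :
    (N + (Fintype.card ι : ℝ) • (1 : Matrix ι ι ℝ)).PosSemidef := by
  refine Matrix.PosSemidef.of_dotProduct_mulVec_nonneg (hN.add ?_) fun a => ?_
  · rw [Matrix.IsHermitian, Matrix.conjTranspose_smul, Matrix.conjTranspose_one, star_trivial]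
  · rw [star_trivial, Matrix.add_mulVec, Matrix.smul_mulVec, Matrix.one_mulVec, dotProduct_add,
      dotProduct_smul, smul_eq_mul]
    have h1 : -(∑ i, |a i|) ^ 2 ≤ a ⬝ᵥ N.mulVec a := by
      rw [pow_two, Finset.sum_mul_sum, ← Finset.sum_neg_distrib]
      simp only [dotProduct, Matrix.mulVec, Finset.mul_sum]
      refine Finset.sum_le_sum fun i _ => ?_
      rw [← Finset.sum_neg_distrib]
      refine Finset.sum_le_sum fun j _ => ?_
      have : |a i * (N i j * a j)| ≤ |a i| * |a j| := by
        rw [abs_mul, abs_mul]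
        have := mul_le_of_le_one_left (abs_nonneg (a j)) (h i j)
        gcongr
      linarith [neg_abs_le (a i * (N i j * a j))]
    have h2 : (∑ i, |a i|) ^ 2 ≤ Fintype.card ι * (a ⬝ᵥ a) := by
      refine (sq_sum_le_card_mul_sum_sq (s := Finset.univ) (f := fun i => |a i|)).trans ?_
      simp [dotProduct, pow_two]
    linarith

/-- The matrix `(T - S) / ε` has entries at most `1`, so adding `n` times the identity makes it a
covariance `W`, and `S + ε W = T + ε n I`. Both moments are thus compared to that of a common noisy
vector with noise amplitude `√ε`: this is the origin of the exponent `1/2` in the theorem.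
Degenerate covariances are allowed. -/
theorem exists_abs_absMoment_sub_le (n : ℕ) : ∃ C : ℝ, 0 < C ∧ ∀ (ι : Type) [Fintype ι]
    [DecidableEq ι] (S T : Matrix ι ι ℝ) (ε : ℝ), Fintype.card ι = n → S.PosSemidef →
    T.PosSemidef → (∀ i, S i i ≤ 2) → (∀ i, T i i ≤ 2) → 0 ≤ ε → ε ≤ 1 →
    (∀ i j, |S i j - T i j| ≤ ε) → |absMoment S - absMoment T| ≤ C * √ε := by
  set D : ℝ := n * (1 + n * (2 ^ n * (2 * (√(n + 2) ^ n * gaussianAbsMoment n)))) with hD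
  have hD0 : 0 ≤ D := by
    have := gaussianAbsMoment_nonneg n
    positivity
  refine ⟨2 * D + 1, by positivity, ?_⟩
  intro ι _ _ S T ε hcard hS hT hS2 hT2 hε0 hε1 hdiff
  rcases hε0.eq_or_lt with rfl | hεpos
  · have : S = T := by
      ext i j
      have := hdiff i j
      rw [abs_nonpos_iff] at this
      linarith
    simp [this]
  set N : Matrix ι ι ℝ := ε⁻¹ • (T - S) with hN
  have hNh : N.IsHermitian := by
    rw [hN, Matrix.IsHermitian, Matrix.conjTranspose_smul, star_trivial]
    rw [(hT.isHermitian.sub hS.isHermitian).eq]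
  have hN1 : ∀ i j, |N i j| ≤ 1 := by
    intro i j
    simp only [hN, Matrix.smul_apply, Matrix.sub_apply, smul_eq_mul, abs_mul, abs_inv,
      abs_of_pos hεpos]
    rw [inv_mul_le_iff₀ hεpos, mul_one, abs_sub_comm]
    exact hdiff i j
  have hW := posSemidef_add_smul_one hNh hN1
  set W := N + (Fintype.card ι : ℝ) • (1 : Matrix ι ι ℝ) with hWdef
  have hI : ((Fintype.card ι : ℝ) • (1 : Matrix ι ι ℝ)).PosSemidef :=
    Matrix.PosSemidef.one.smul (by positivity)
  have hsq : √ε ^ 2 = ε := Real.sq_sqrt hε0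
  have hs1 : √ε ≤ 1 := Real.sqrt_le_one.2 hε1
  -- The common covariance reached from both sides.
  have heq : S + √ε ^ 2 • W = T + √ε ^ 2 • ((Fintype.card ι : ℝ) • (1 : Matrix ι ι ℝ)) := by
    rw [hsq, hWdef, hN, smul_add, smul_smul, mul_inv_cancel₀ hεpos.ne', one_smul]
    abel
  have hn0 : (0:ℝ) ≤ n := by positivity
  have h1 := abs_absMoment_add_smul_sub_le hS hW (K := n + 2)
    (fun i => (hS2 i).trans (by linarith)) (fun i => by
      have := (abs_le.1 (hN1 i i)).2
      simp only [hWdef, Matrix.add_apply, Matrix.smul_apply, Matrix.one_apply_eq, smul_eq_mul,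
        mul_one, hcard]
      linarith) (Real.sqrt_nonneg ε) hs1
  have h2 := abs_absMoment_add_smul_sub_le hT hI (K := n + 2)
    (fun i => (hT2 i).trans (by linarith)) (fun i => by
      simp only [Matrix.smul_apply, Matrix.one_apply_eq, smul_eq_mul, mul_one, hcard]
      linarith) (Real.sqrt_nonneg ε) hs1
  rw [hcard, ← hD] at h1 h2
  rw [heq, hcard] at h1
  calc |absMoment S - absMoment T| ≤ _ := abs_sub_le _
        (absMoment (T + √ε ^ 2 • ((Fintype.card ι : ℝ) • (1 : Matrix ι ι ℝ)))) _
    _ ≤ √ε * D + √ε * D := by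
        rw [abs_sub_comm, hcard]; exact add_le_add h1 h2
    _ ≤ _ := by nlinarith [Real.sqrt_nonneg ε]

section scaling

variable {ι : Type*} [Fintype ι] [DecidableEq ι]

theorem posSemidef_scale {S : Matrix ι ι ℝ} (hS : S.PosSemidef) (d : ι → ℝ) :
    (Matrix.of fun i j => d i * S i j * d j).PosSemidef := by
  have e1 : (Matrix.of fun i j => d i * S i j * d j) =
      Matrix.diagonal d * S * (Matrix.diagonal d).conjTranspose := by
    ext i j
    simp [Matrix.mul_diagonal, Matrix.diagonal_mul]
  rw [e1]
  exact hS.mul_mul_conjTranspose_same _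

theorem absMoment_eq_prod_mul_normalized {S : Matrix ι ι ℝ} (hS : S.PosSemidef) {σ : ι → ℝ}
    (hσ : ∀ i, 0 < σ i) : absMoment S =
      (∏ i, σ i) * absMoment (Matrix.of fun i j => (σ i)⁻¹ * S i j * (σ j)⁻¹) := by
  have h := absMoment_scale (posSemidef_scale hS fun i => (σ i)⁻¹) σ
  have e : (Matrix.of fun i j => σ i *
      (Matrix.of fun i j => (σ i)⁻¹ * S i j * (σ j)⁻¹) i j * σ j) = S := by
    ext i j
    have := (hσ i).ne'
    have := (hσ j).ne'
    simp only [Matrix.of_apply]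
    field_simp
  rw [e] at h
  rw [h]
  congr 1
  exact Finset.prod_congr rfl fun i _ => abs_of_pos (hσ i)

end scaling

/-- Rescaling to unit variances reduces to the two bounds that hold uniformly over all correlation
matrices. -/
theorem exists_absMoment_bounds (n : ℕ) : ∃ c C : ℝ, 0 < c ∧ 0 < C ∧ ∀ (ι : Type) [Fintype ι]
    [DecidableEq ι] (S : Matrix ι ι ℝ) (σ : ι → ℝ), Fintype.card ι = n → S.PosSemidef →
    (∀ i, 0 < σ i) → (∀ i, S i i = σ i ^ 2) →
    c * ∏ i, σ i ≤ absMoment S ∧ absMoment S ≤ C * ∏ i, σ i := by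
  have hn := gaussianAbsMoment_nonneg n
  refine ⟨(2 * (n + 1 : ℝ))⁻¹ ^ n / 2, 1 + n * gaussianAbsMoment n, by positivity,
    by positivity, ?_⟩
  intro ι _ _ S σ hcard hS hσ hSσ
  have hp : 0 < ∏ i, σ i := Finset.prod_pos fun i _ => hσ i
  have hps := posSemidef_scale hS fun i => (σ i)⁻¹
  have h1 : ∀ i, (Matrix.of fun i j => (σ i)⁻¹ * S i j * (σ j)⁻¹) i i = 1 := fun i => by
    have := (hσ i).ne'
    simp only [Matrix.of_apply, hSσ]
    field_simp
  rw [absMoment_eq_prod_mul_normalized hS hσ]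
  have h2 := le_absMoment_of_diag_eq_one hps h1
  have h3 := absMoment_le_of_diag_eq_one hps h1
  rw [hcard] at h2 h3
  constructor
  · rw [mul_comm]; gcongr
  · rw [mul_comm]; gcongr

theorem exists_abs_absMoment_sub_le_scaled (n : ℕ) : ∃ C : ℝ, 0 < C ∧ ∀ (ι : Type) [Fintype ι]
    [DecidableEq ι] (S T : Matrix ι ι ℝ) (σ : ι → ℝ) (ε : ℝ), Fintype.card ι = n →
    S.PosSemidef → T.PosSemidef → (∀ i, 0 < σ i) → (∀ i, T i i = σ i ^ 2) → 0 ≤ ε → ε ≤ 1 →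
    (∀ i j, |S i j - T i j| ≤ ε * σ i * σ j) →
    |absMoment S - absMoment T| ≤ C * √ε * ∏ i, σ i := by
  obtain ⟨C, hC0, hC⟩ := exists_abs_absMoment_sub_le n
  refine ⟨C, hC0, ?_⟩
  intro ι _ _ S T σ ε hcard hS hT hσ hTσ hε0 hε1 hdiff
  have hp : 0 < ∏ i, σ i := Finset.prod_pos fun i _ => hσ i
  have hT1 : ∀ i, (Matrix.of fun i j => (σ i)⁻¹ * T i j * (σ j)⁻¹) i i = 1 := fun i => by
    have := (hσ i).ne'
    simp only [Matrix.of_apply, hTσ]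
    field_simp
  have hd : ∀ i j, |(Matrix.of fun i j => (σ i)⁻¹ * S i j * (σ j)⁻¹) i j -
      (Matrix.of fun i j => (σ i)⁻¹ * T i j * (σ j)⁻¹) i j| ≤ ε := by
    intro i j
    have hi := hσ i
    have hj := hσ j
    have e : (Matrix.of fun i j => (σ i)⁻¹ * S i j * (σ j)⁻¹) i j -
      (Matrix.of fun i j => (σ i)⁻¹ * T i j * (σ j)⁻¹) i j = (S i j - T i j) / (σ i * σ j) := by
      simp only [Matrix.of_apply]
      field_simp
    rw [e, abs_div, abs_of_pos (mul_pos hi hj), div_le_iff₀ (mul_pos hi hj), ← mul_assoc]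
    exact hdiff i j
  have h1 := hC ι _ _ ε hcard (posSemidef_scale hS fun i => (σ i)⁻¹)
    (posSemidef_scale hT fun i => (σ i)⁻¹) (fun i => by
      have := (abs_le.1 (hd i i)).2
      rw [hT1] at this
      linarith) (fun i => by rw [hT1]; norm_num) hε0 hε1 hd
  rw [absMoment_eq_prod_mul_normalized hS hσ, absMoment_eq_prod_mul_normalized hT hσ, ← mul_sub,
    abs_mul, abs_of_pos hp, mul_comm]
  gcongr

theorem absMoment_eq_prod_of_classes {γ : Type*} [DecidableEq γ] (s : Finset ℝ) (b : ℝ → γ)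
    (K : ℝ → ℝ → ℝ)
    (hK : (Matrix.of fun i j : s => if b i = b j then K i j else 0).PosSemidef) :
    absMoment (Matrix.of fun i j : s => if b i = b j then K i j else 0) =
      ∏ c ∈ s.image b, absMoment (Matrix.of fun i j : s.filter (b · = c) => K i j) := by
  classical
  let e : (Σ c : s.image b, s.filter (b · = (c : γ))) ≃ s :=
    { toFun := fun p => ⟨p.2, (Finset.mem_filter.1 p.2.2).1⟩
      invFun := fun i => ⟨⟨b i, Finset.mem_image_of_mem b i.2⟩,
        ⟨i, Finset.mem_filter.2 ⟨i.2, rfl⟩⟩⟩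
      left_inv := by
        rintro ⟨⟨c, hc⟩, ⟨i, hi⟩⟩
        obtain rfl := (Finset.mem_filter.1 hi).2
        rfl
      right_inv := fun _ => rfl }
  have hsub : (Matrix.of fun i j : s => if b i = b j then K i j else 0).submatrix e e =
      Matrix.blockDiagonal' fun c : s.image b =>
        (Matrix.of fun i j : s.filter (b · = (c : γ)) => K i j) := by
    ext ⟨c, i⟩ ⟨d, j⟩
    have hi := (Finset.mem_filter.1 i.2).2
    have hj := (Finset.mem_filter.1 j.2).2
    by_cases hcd : c = d
    · subst hcd
      simp [Matrix.blockDiagonal'_apply_eq, e, hi, hj]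
    · rw [Matrix.blockDiagonal'_apply_ne _ _ _ hcd]
      simp only [Matrix.submatrix_apply, Matrix.of_apply]
      rw [if_neg]
      change ¬ b i = b j
      rw [hi, hj]
      exact fun h => hcd (Subtype.ext h)
  have hps : ∀ c : s.image b,
      (Matrix.of fun i j : s.filter (b · = (c : γ)) => K i j).PosSemidef := by
    intro c
    have h1 := hK.submatrix (fun i : s.filter (b · = (c : γ)) =>
      (⟨i, (Finset.mem_filter.1 i.2).1⟩ : s))
    convert h1 using 1
    ext i j
    simp [(Finset.mem_filter.1 i.2).2, (Finset.mem_filter.1 j.2).2]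
  have hB := hK.submatrix e
  rw [← absMoment_submatrix hK e]
  rw [hsub] at hB ⊢
  rw [absMoment_blockDiagonal hps hB, ← Finset.prod_coe_sort (s.image b)
    fun c => absMoment (Matrix.of fun i j : s.filter (b · = c) => K i j)]

/-! ### Gaussian densities. -/

/-- The density of a nondegenerate centered Gaussian vector. -/
noncomputable def gaussianDensity {ι : Type*} [Fintype ι] [DecidableEq ι] (S : Matrix ι ι ℝ)
    (x : ι → ℝ) : ℝ :=
  (√(2 * Real.pi))⁻¹ ^ Fintype.card ι * (√S.det)⁻¹ * Real.exp (-(x ⬝ᵥ S⁻¹.mulVec x) / 2)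

section density

variable {ι : Type*} [Fintype ι] [DecidableEq ι]

theorem gaussianDensity_nonneg (S : Matrix ι ι ℝ) (x : ι → ℝ) : 0 ≤ gaussianDensity S x := by
  unfold gaussianDensity; positivity

theorem continuous_gaussianDensity (S : Matrix ι ι ℝ) : Continuous (gaussianDensity S) := by
  unfold gaussianDensity
  have : Continuous fun x : ι → ℝ => S⁻¹.mulVec x :=
    LinearMap.continuous_of_finiteDimensional (Matrix.mulVecLin S⁻¹)
  have h2 : Continuous fun x : ι → ℝ => x ⬝ᵥ S⁻¹.mulVec x := by
    simp only [dotProduct]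
    fun_prop
  fun_prop

theorem gaussianDensity_one (x : ι → ℝ) :
    gaussianDensity (1 : Matrix ι ι ℝ) x = ∏ i, gaussianPDFReal 0 1 (x i) := by
  simp only [gaussianDensity, gaussianPDFReal, Finset.prod_mul_distrib, ← Real.exp_sum]
  simp [dotProduct, Finset.sum_div, ← Finset.sum_neg_distrib, pow_two, neg_div]

theorem gaussianVector_one_eq_withDensity :
    gaussianVector (1 : Matrix ι ι ℝ) =
      volume.withDensity fun x => ENNReal.ofReal (gaussianDensity 1 x) := by
  have hint : Integrable (gaussianDensity (1 : Matrix ι ι ℝ)) := by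
    simp_rw [funext gaussianDensity_one]
    exact Integrable.fintype_prod fun i => integrable_gaussianPDFReal 0 1
  have hm : Measurable fun x => ENNReal.ofReal (gaussianDensity (1 : Matrix ι ι ℝ) x) :=
    (continuous_gaussianDensity 1).measurable.ennreal_ofReal
  have hp : IsProbabilityMeasure
      ((volume : Measure (ι → ℝ)).withDensity fun x => ENNReal.ofReal (gaussianDensity 1 x)) := by
    constructor
    rw [withDensity_apply _ MeasurableSet.univ, Measure.restrict_univ,
      ← ofReal_integral_eq_lintegral_ofReal hint (Eventually.of_forall (gaussianDensity_nonneg 1))]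
    simp_rw [gaussianDensity_one]
    rw [integral_fintype_prod_volume_eq_prod]
    simp [integral_gaussianPDFReal_eq_one]
  refine (isGaussianVector_gaussianVector Matrix.PosSemidef.one).unique fun a => ?_
  rw [integral_withDensity_eq_integral_toReal_smul hm (Eventually.of_forall fun x => by simp)]
  have e1 : ∀ x : ι → ℝ, (ENNReal.ofReal (gaussianDensity (1 : Matrix ι ι ℝ) x)).toReal •
      Complex.exp ((a ⬝ᵥ x : ℝ) * Complex.I) =
      ∏ i, (gaussianPDFReal 0 1 (x i) : ℂ) * Complex.exp (a i * x i * Complex.I) := by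
    intro x
    rw [ENNReal.toReal_ofReal (gaussianDensity_nonneg _ _), gaussianDensity_one,
      Finset.prod_mul_distrib, ← Complex.exp_sum, Complex.real_smul, ← Finset.sum_mul]
    simp [dotProduct]
  simp_rw [e1]
  rw [integral_fintype_prod_volume_eq_prod (fun i (y : ℝ) =>
    (gaussianPDFReal 0 1 y : ℂ) * Complex.exp (a i * y * Complex.I))]
  have e2 : ∀ i, ∫ y : ℝ, (gaussianPDFReal 0 1 y : ℂ) * Complex.exp (a i * y * Complex.I) =
      Complex.exp (-(a i) ^ 2 / 2) := by
    intro i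
    have h := charFun_gaussianReal (μ := 0) (v := 1) (a i)
    rw [charFun_apply_real, integral_gaussianReal_eq_integral_smul one_ne_zero] at h
    simp only [Complex.real_smul] at h
    rw [h]
    congr 1
    simp
    ring
  simp_rw [e2]
  rw [← Complex.exp_sum]
  congr 1
  rw [Matrix.one_mulVec, ← Finset.sum_div]
  simp [dotProduct, pow_two]

/-- Writing `S = A Aᵀ`, the vector is the image under `A` of a standard one, and the Jacobian `|det
A|` is the square root of `det S`. -/
theorem gaussianVector_eq_withDensity {S : Matrix ι ι ℝ} (hS : S.PosDef) :
    gaussianVector S = volume.withDensity fun x => ENNReal.ofReal (gaussianDensity S x) := by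
  obtain ⟨A, hA, rfl⟩ := hS.exists_eq_mul_transpose
  have hu : IsUnit A.det := isUnit_iff_ne_zero.2 hA
  have hm : Measurable (A.mulVec : (ι → ℝ) → ι → ℝ) :=
    (LinearMap.continuous_of_finiteDimensional (Matrix.mulVecLin A)).measurable
  have hp : IsProbabilityMeasure ((gaussianVector (1 : Matrix ι ι ℝ)).map A.mulVec) :=
    Measure.isProbabilityMeasure_map hm.aemeasurable
  have h1 := (isGaussianVector_gaussianVector (Matrix.PosSemidef.one (n := ι) (R := ℝ))).map A
  rw [Matrix.mul_one] at h1
  rw [← h1.unique (isGaussianVector_gaussianVector hS.posSemidef)]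
  have hd : ∀ x, gaussianDensity (1 : Matrix ι ι ℝ) x =
      |A.det| * gaussianDensity (A * A.transpose) (A.mulVec x) := by
    intro x
    have e1 : √(A * A.transpose).det = |A.det| := by
      rw [Matrix.det_mul, Matrix.det_transpose, ← pow_two, Real.sqrt_sq_eq_abs]
    have e2 : A.mulVec x ⬝ᵥ (A * A.transpose)⁻¹.mulVec (A.mulVec x) = x ⬝ᵥ x := by
      rw [Matrix.mul_inv_rev, ← Matrix.mulVec_mulVec, Matrix.mulVec_mulVec (M := A⁻¹),
        Matrix.nonsing_inv_mul _ hu, Matrix.one_mulVec, ← Matrix.transpose_nonsing_inv,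
        Matrix.mulVec_transpose, dotProduct_comm, ← Matrix.dotProduct_mulVec,
        Matrix.mulVec_mulVec, Matrix.nonsing_inv_mul _ hu, Matrix.one_mulVec]
    unfold gaussianDensity
    rw [e1, e2]
    have := abs_pos.2 hA
    simp
    field_simp
  rw [gaussianVector_one_eq_withDensity]
  ext E hE
  rw [Measure.map_apply hm hE, withDensity_apply _ (hm hE), withDensity_apply _ hE]
  have hvol := Real.map_matrix_volume_pi_eq_smul_volume_pi hA
  have hmd : Measurable fun x => ENNReal.ofReal (gaussianDensity (A * A.transpose) x) :=
    (continuous_gaussianDensity _).measurable.ennreal_ofReal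
  have hvol2 : (volume : Measure (ι → ℝ)) =
      ENNReal.ofReal |A.det| • Measure.map A.mulVec volume := by
    have : Measure.map A.mulVec (volume : Measure (ι → ℝ)) = ENNReal.ofReal |A.det⁻¹| • volume :=
      hvol
    rw [this, smul_smul, ← ENNReal.ofReal_mul (abs_nonneg _), ← abs_mul, mul_inv_cancel₀ hA]
    simp
  conv_rhs => rw [hvol2, Measure.restrict_smul, lintegral_smul_measure,
    setLIntegral_map hE hmd hm]
  rw [smul_eq_mul, ← lintegral_const_mul' _ _ ENNReal.ofReal_ne_top]
  refine lintegral_congr fun x => ?_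
  rw [hd, ENNReal.ofReal_mul (abs_nonneg _)]

theorem absMoment_eq_integral_density {S : Matrix ι ι ℝ} (hS : S.PosDef) :
    absMoment S = ∫ x, (∏ i, |x i|) * gaussianDensity S x := by
  rw [absMoment, gaussianVector_eq_withDensity hS, integral_withDensity_eq_integral_toReal_smul
    (continuous_gaussianDensity S).measurable.ennreal_ofReal
    (Eventually.of_forall fun x => by simp)]
  refine integral_congr_ae (Eventually.of_forall fun x => ?_)
  simp only [smul_eq_mul]
  rw [ENNReal.toReal_ofReal (gaussianDensity_nonneg _ _), mul_comm]

end density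

/-! ### The Kac–Rice density: repulsion and clustering. -/

theorem exists_pos_le_of_le (c : ℕ → ℝ) (hc : ∀ n, 0 < c n) (k : ℕ) :
    ∃ c₀ : ℝ, 0 < c₀ ∧ ∀ n ≤ k, c₀ ≤ c n := by
  induction k with
  | zero => exact ⟨c 0, hc 0, fun n hn => by rw [Nat.le_zero.1 hn]⟩
  | succ k ih =>
    obtain ⟨c₀, h0, h⟩ := ih
    refine ⟨min c₀ (c (k + 1)), lt_min h0 (hc _), fun n hn => ?_⟩
    rcases Nat.le_succ_iff.1 hn with h1 | h1
    · exact (min_le_left _ _).trans (h n h1)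
    · rw [h1]; exact min_le_right _ _

theorem exists_le_of_le (c : ℕ → ℝ) (hc : ∀ n, 0 < c n) (k : ℕ) :
    ∃ c₀ : ℝ, 0 < c₀ ∧ ∀ n ≤ k, c n ≤ c₀ := by
  refine ⟨∑ n ∈ Finset.range (k + 1), c n, Finset.sum_pos (fun n _ => hc n) ⟨0, by simp⟩,
    fun n hn => Finset.single_le_sum (f := c) (fun n _ => (hc n).le) (by simp; omega)⟩

/-- Pairs in different classes are at distance at least `1`, so their truncated factor is `1`. -/
theorem prod_truncatedVandermonde_classes {γ : Type*} [DecidableEq γ] (s : Finset ℝ) (b : ℝ → γ)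
    (h : ∀ x ∈ s, ∀ y ∈ s, b x ≠ b y → 1 ≤ |x - y|) :
    ∏ c ∈ s.image b, truncatedVandermonde (s.filter (b · = c)) = truncatedVandermonde s := by
  have h1 : truncatedVandermonde s =
      ∏ y ∈ s, ∏ t ∈ (s.filter (b · = b y)) with t < y, min |y - t| 1 := by
    refine Finset.prod_congr rfl fun y hy => ?_
    rw [Finset.filter_filter]
    refine (Finset.prod_subset ?_ ?_).symm
    · intro t ht
      simp only [Finset.mem_filter] at ht ⊢
      exact ⟨ht.1, ht.2.2⟩
    · intro t ht ht'
      simp only [Finset.mem_filter, not_and] at ht ht'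
      have : b y ≠ b t := fun hb => ht' ht.1 hb.symm ht.2
      exact min_eq_right (h y hy t ht.1 this)
  rw [h1, ← Finset.prod_fiberwise_of_maps_to (g := b) (t := s.image b)
    (fun y hy => Finset.mem_image_of_mem b hy)]
  refine Finset.prod_congr rfl fun c _ => Finset.prod_congr rfl fun y hy => ?_
  rw [(Finset.mem_filter.1 hy).2]

section

variable {E : Type*} [NormedAddCommGroup E] [InnerProductSpace ℝ E] {k : ℕ} {κ : ℝ → ℝ}
  {F F' : ℝ → E}

/-- The Gram matrix of the derivatives of the curve, after removing the values of the curve. -/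
noncomputable def residualMatrix (F F' : ℝ → E) (s : Finset ℝ) : Matrix s s ℝ :=
  Matrix.gram ℝ fun i : s => derivResidual F F' s i

/-- The Kac–Rice density of the zeros of the process at the points of `s`. -/
noncomputable def kacRiceDensity (κ : ℝ → ℝ) (F F' : ℝ → E) (s : Finset ℝ) : ℝ :=
  (√(2 * Real.pi))⁻¹ ^ s.card * (√(kernelMatrix κ s).det)⁻¹ * absMoment (residualMatrix F F' s)

theorem posSemidef_residualMatrix (s : Finset ℝ) : (residualMatrix F F' s).PosSemidef :=
  Matrix.posSemidef_gram ℝ _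

theorem NondegenerateCurve.norm_derivResidual_pos (h : NondegenerateCurve k κ F F')
    {s : Finset ℝ} (hs : s.card ≤ k) {x : ℝ} (hx : x ∈ s) : 0 < ‖derivResidual F F' s x‖ := by
  obtain ⟨c, C, hc, -, hb⟩ := h.exists_norm_residual
  refine lt_of_lt_of_le (mul_pos hc (Finset.prod_pos fun t ht => ?_)) (hb s hs x hx).1
  exact lt_min (abs_pos.2 (sub_ne_zero.2 (Finset.mem_erase.1 ht).1.symm)) one_pos

theorem residualMatrix_diag (s : Finset ℝ) (i : s) :
    residualMatrix F F' s i i = ‖derivResidual F F' s i‖ ^ 2 := by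
  rw [residualMatrix, Matrix.gram_apply, real_inner_self_eq_norm_sq]

/-- With `V` the truncated Vandermonde product, the determinant is of order `V²`, hence contributes
`V⁻¹`, while the moment is of the order of the product of the residual norms, that is `V²`.
Constants depend on the cardinality only and are made uniform over cardinalities up to `k`. -/
theorem NondegenerateCurve.exists_kacRiceDensity_bounds (h : NondegenerateCurve k κ F F') :
    ∃ c C : ℝ, 0 < c ∧ 0 < C ∧ ∀ s : Finset ℝ, s.card ≤ k →
      c * truncatedVandermonde s ≤ kacRiceDensity κ F F' s ∧
      kacRiceDensity κ F F' s ≤ C * truncatedVandermonde s := by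
  obtain ⟨c₁, C₁, hc₁, hC₁, hdet⟩ := h.exists_det_bounds
  obtain ⟨c₂, C₂, hc₂, hC₂, hres⟩ := h.exists_norm_residual
  choose c₃ C₃ hc₃ hC₃ hmom using exists_absMoment_bounds
  set q : ℝ := (√(2 * Real.pi))⁻¹ with hq
  have hq0 : 0 < q := by positivity
  obtain ⟨c, hc0, hc⟩ := exists_pos_le_of_le (fun n => q ^ n * (√C₁)⁻¹ * (c₃ n * c₂ ^ n))
    (fun n => by have := hc₃ n; positivity) k
  obtain ⟨C, hC0, hC⟩ := exists_le_of_le (fun n => q ^ n * (√c₁)⁻¹ * (C₃ n * C₂ ^ n))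
    (fun n => by have := hC₃ n; positivity) k
  refine ⟨c, C, hc0, hC0, fun s hs => ?_⟩
  set D := truncatedVandermonde s with hD
  have hD0 : 0 < D := truncatedVandermonde_pos s
  obtain ⟨hd1, hd2⟩ := hdet s hs
  have hdpos := h.det_kernelMatrix_pos hs
  obtain ⟨hm1, hm2⟩ := hmom s.card s (residualMatrix F F' s)
    (fun i => ‖derivResidual F F' s i‖) (Fintype.card_coe s) (posSemidef_residualMatrix s)
    (fun i => h.norm_derivResidual_pos hs i.2) (residualMatrix_diag s)
  rw [Finset.prod_coe_sort s (fun i => ‖derivResidual F F' s i‖)] at hm1 hm2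
  have hp1 : c₂ ^ s.card * D ^ 2 ≤ ∏ i ∈ s, ‖derivResidual F F' s i‖ := by
    rw [hD, ← prod_prod_erase_eq_truncatedVandermonde_sq, ← Finset.prod_const,
      ← Finset.prod_mul_distrib]
    exact Finset.prod_le_prod (fun i _ => by positivity) fun i hi => (hres s hs i hi).1
  have hp2 : ∏ i ∈ s, ‖derivResidual F F' s i‖ ≤ C₂ ^ s.card * D ^ 2 := by
    rw [hD, ← prod_prod_erase_eq_truncatedVandermonde_sq, ← Finset.prod_const,
      ← Finset.prod_mul_distrib]
    exact Finset.prod_le_prod (fun i _ => by positivity) fun i hi => (hres s hs i hi).2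
  have hs1 : (√C₁)⁻¹ * D⁻¹ ≤ (√(kernelMatrix κ s).det)⁻¹ := by
    rw [← mul_inv]
    refine inv_anti₀ (Real.sqrt_pos.2 hdpos) ?_
    rw [← Real.sqrt_sq hD0.le, ← Real.sqrt_mul hC₁.le]
    exact Real.sqrt_le_sqrt hd2
  have hs2 : (√(kernelMatrix κ s).det)⁻¹ ≤ (√c₁)⁻¹ * D⁻¹ := by
    rw [← mul_inv]
    refine inv_anti₀ (by positivity) ?_
    rw [← Real.sqrt_sq hD0.le, ← Real.sqrt_mul hc₁.le]
    exact Real.sqrt_le_sqrt hd1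
  have hc3 := hc₃ s.card
  have hC3 := hC₃ s.card
  constructor
  · calc c * D ≤ (q ^ s.card * (√C₁)⁻¹ * (c₃ s.card * c₂ ^ s.card)) * D := by
          gcongr; exact hc _ hs
      _ = q ^ s.card * ((√C₁)⁻¹ * D⁻¹) * (c₃ s.card * (c₂ ^ s.card * D ^ 2)) := by
          field_simp
      _ ≤ _ := by
          rw [kacRiceDensity]
          gcongr
          exact (mul_le_mul_of_nonneg_left hp1 hc3.le).trans hm1
  · calc kacRiceDensity κ F F' s
        ≤ q ^ s.card * ((√c₁)⁻¹ * D⁻¹) * (C₃ s.card * (C₂ ^ s.card * D ^ 2)) := by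
          rw [kacRiceDensity]
          have := absMoment_nonneg (residualMatrix F F' s)
          gcongr
          exact hm2.trans (mul_le_mul_of_nonneg_left hp2 hC3.le)
      _ = (q ^ s.card * (√c₁)⁻¹ * (C₃ s.card * C₂ ^ s.card)) * D := by
          field_simp
      _ ≤ _ := by gcongr; exact hC _ hs

theorem abs_sqrt_sub_one_le {u : ℝ} (hu : 0 ≤ u) : |√u - 1| ≤ |u - 1| := by
  have h1 : u - 1 = (√u - 1) * (√u + 1) := by
    have := Real.sq_sqrt hu
    nlinarith
  rw [h1, abs_mul]
  refine le_mul_of_one_le_right (abs_nonneg _) ?_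
  rw [abs_of_nonneg (by positivity)]
  linarith [Real.sqrt_nonneg u]

theorem one_add_pow_le (n : ℕ) {u : ℝ} (hu0 : 0 ≤ u) (hu1 : u ≤ 1) :
    (1 + u) ^ n ≤ 1 + (2 ^ n - 1) * u := by
  induction n with
  | zero => simp
  | succ n ih =>
    have h2 : (1:ℝ) ≤ 2 ^ n := one_le_pow₀ (by norm_num)
    rw [pow_succ, pow_succ]
    have h3 : 0 ≤ (2 ^ n - 1) * u := mul_nonneg (by linarith) hu0
    nlinarith [mul_le_mul_of_nonneg_left hu1 h3]

theorem natCast_le_two_pow (k : ℕ) : (k : ℝ) ≤ 2 ^ k := by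
  exact_mod_cast Nat.lt_two_pow_self.le

set_option maxHeartbeats 800000 in
/-- Clustering of the Kac–Rice density when the classes of points are almost orthogonal. -/
theorem NondegenerateCurve.exists_cluster_of_small (h : NondegenerateCurve k κ F F') :
    ∃ C ε₀ : ℝ, 0 < C ∧ 0 < ε₀ ∧ ∀ (γ : Type) [LinearOrder γ] (s : Finset ℝ) (b : ℝ → γ) (ε : ℝ),
      s.card = k → 0 ≤ ε → ε ≤ ε₀ →
      (∀ t₁ t₂ : Finset ℝ, t₁ ⊆ s → t₂ ⊆ s → (∀ i ∈ t₁, ∀ j ∈ t₂, b i ≠ b j) →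
        ∀ u ∈ jetSet F F' t₁, ∀ v ∈ jetSet F F' t₂, |inner ℝ u v| ≤ ε * ‖u‖ * ‖v‖) →
      |(∏ c ∈ s.image b, kacRiceDensity κ F F' (s.filter (b · = c))) /
        kacRiceDensity κ F F' s - 1| ≤ C * √ε := by
  classical
  obtain ⟨c₃, C₃, hc₃, hC₃, hmom⟩ := exists_absMoment_bounds k
  obtain ⟨C₄, hC₄, hdiff⟩ := exists_abs_absMoment_sub_le_scaled k
  set A : ℝ := C₄ * √7 * 2 ^ k / c₃ with hA
  have hA0 : 0 < A := by positivity
  -- The condition `ε ≤ 1/14` gives `7 ε ≤ 1/2`, so residual norms at least half survive; the other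
  -- one gives `k ε ≤ 1/2` for the determinant.
  refine ⟨A + 2 ^ k * k * (1 + A), min (1 / 14) (1 / (2 * (k + 1))), by positivity, by positivity,
    ?_⟩
  intro γ _ s b ε hs hε0 hε hang
  have hε1 : ε ≤ 1 / 14 := hε.trans (min_le_left _ _)
  have hεk : k * ε ≤ 1 / 2 := by
    have h1 : ε ≤ 1 / (2 * (k + 1)) := hε.trans (min_le_right _ _)
    rw [le_div_iff₀ (by positivity)] at h1
    nlinarith
  have hsk : s.card ≤ k := hs.le
  have hfk : ∀ c, (s.filter (b · = c)).card ≤ k := fun c => (Finset.card_filter_le _ _).trans hsk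
  set K : ℝ → ℝ → ℝ := fun x y => inner ℝ (derivResidual F F' (s.filter (b · = b x)) x)
    (derivResidual F F' (s.filter (b · = b y)) y) with hK
  -- This is the covariance that the residuals would have if the classes were independent, each
  -- residual being computed within its own class.
  set SB : Matrix s s ℝ := Matrix.of fun i j => if b i = b j then K i j else 0 with hSB
  set σ : s → ℝ := fun i => ‖derivResidual F F' (s.filter (b · = b i)) i‖ with hσ
  have hσ0 : ∀ i, 0 < σ i := fun i => h.norm_derivResidual_pos (hfk _) (by simp)
  have hSBform : ∀ a : s → ℝ, a ⬝ᵥ SB.mulVec a = ∑ c ∈ s.image b,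
      ‖∑ i : s, (if b i = c then a i else 0) • derivResidual F F' (s.filter (b · = b i)) i‖ ^ 2 := by
    intro a
    have hg : ∀ c, ‖∑ i : s, (if b i = c then a i else 0) •
        derivResidual F F' (s.filter (b · = b i)) i‖ ^ 2 = _ := fun c =>
      (dotProduct_gram_mulVec (fun i : s => derivResidual F F' (s.filter (b · = b i)) i)
        (fun i : s => if b i = c then a i else 0)).symm
    simp_rw [hg]
    simp only [dotProduct, Matrix.mulVec, Finset.mul_sum]
    conv_rhs => rw [Finset.sum_comm]
    refine Finset.sum_congr rfl fun i _ => ?_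
    conv_rhs => rw [Finset.sum_comm]
    refine Finset.sum_congr rfl fun j _ => ?_
    rw [Finset.sum_eq_single (b i)]
    · by_cases hij : b i = b j
      · simp [hSB, hK, hij]
      · simp [hSB, hij, Ne.symm hij]
    · intro c _ hc
      simp [Ne.symm hc]
    · intro hc
      exact absurd (Finset.mem_image_of_mem b i.2) hc
  have hSBps : SB.PosSemidef := by
    refine Matrix.PosSemidef.of_dotProduct_mulVec_nonneg ?_ fun a => by
      rw [star_trivial, hSBform]; positivity
    ext i j
    simp only [hSB, hK, Matrix.conjTranspose_apply, Matrix.of_apply, star_trivial]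
    rw [real_inner_comm]
    simp only [eq_comm]
  have hSBdiag : ∀ i, SB i i = σ i ^ 2 := fun i => by
    simp only [hSB, hK, Matrix.of_apply, if_true, hσ]
    rw [real_inner_self_eq_norm_sq]
  have hSBprod : absMoment SB =
      ∏ c ∈ s.image b, absMoment (residualMatrix F F' (s.filter (b · = c))) := by
    rw [hSB, absMoment_eq_prod_of_classes s b K hSBps]
    refine Finset.prod_congr rfl fun c _ => ?_
    congr 1
    ext i j
    have hi := (Finset.mem_filter.1 i.2).2
    have hj := (Finset.mem_filter.1 j.2).2
    simp only [hK, Matrix.of_apply, residualMatrix, Matrix.gram_apply, hi, hj]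
  have hentry : ∀ i j, |residualMatrix F F' s i j - SB i j| ≤ 7 * ε * σ i * σ j := fun i j =>
    abs_inner_derivResidual_sub_le b (by linarith) hε0 hang i.2 j.2
  have hΦ := hdiff s (residualMatrix F F' s) SB σ (7 * ε) (by rw [Fintype.card_coe, hs])
    (posSemidef_residualMatrix s) hSBps hσ0 hSBdiag (by positivity) (by linarith) hentry
  have hlow := (hmom s (residualMatrix F F' s) (fun i => ‖derivResidual F F' s i‖)
    (by rw [Fintype.card_coe, hs]) (posSemidef_residualMatrix s)
    (fun i => h.norm_derivResidual_pos hsk i.2) (residualMatrix_diag s)).1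
  have hσle : ∀ i : s, σ i / 2 ≤ ‖derivResidual F F' s i‖ := by
    intro i
    have h1 := (abs_le.1 (hentry i i)).1
    rw [residualMatrix_diag, hSBdiag] at h1
    refine le_of_sq_le_sq ?_ (norm_nonneg _)
    have := sq_nonneg (σ i)
    nlinarith
  have hprodσ : (∏ i, σ i) / 2 ^ k ≤ ∏ i : s, ‖derivResidual F F' s i‖ := by
    have e : (∏ i, σ i) / 2 ^ k = ∏ i, (σ i / 2) := by
      rw [Finset.prod_div_distrib, Finset.prod_const, Finset.card_univ, Fintype.card_coe, hs]
    rw [e]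
    exact Finset.prod_le_prod (fun i _ => by have := hσ0 i; positivity) fun i _ => hσle i
  have hprodpos : 0 < ∏ i, σ i := Finset.prod_pos fun i _ => hσ0 i
  set Φ := absMoment (residualMatrix F F' s) with hΦdef
  have hΦlow : c₃ * ((∏ i, σ i) / 2 ^ k) ≤ Φ := (mul_le_mul_of_nonneg_left hprodσ hc₃.le).trans hlow
  have hΦpos : 0 < Φ := lt_of_lt_of_le (by positivity) hΦlow
  have hr : |absMoment SB / Φ - 1| ≤ A * √ε := by
    have e : absMoment SB / Φ - 1 = (absMoment SB - Φ) / Φ := by field_simp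
    rw [e, abs_div, abs_of_pos hΦpos, div_le_iff₀ hΦpos, abs_sub_comm]
    refine hΦ.trans ?_
    rw [Real.sqrt_mul (by norm_num)]
    calc C₄ * (√7 * √ε) * ∏ i, σ i = A * √ε * (c₃ * ((∏ i, σ i) / 2 ^ k)) := by
          rw [hA]; field_simp
      _ ≤ _ := by gcongr
  obtain ⟨hdet1, hdet2⟩ := h.det_kernelMatrix_classes hsk b hε0 (by linarith)
    (fun t₁ t₂ h1 h2 h3 u hu v hv => hang t₁ t₂ h1 h2 h3 u (Or.inl hu) v (Or.inl hv))
  set dB := ∏ c ∈ s.image b, (kernelMatrix κ (s.filter (b · = c))).det with hdB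
  set dG := (kernelMatrix κ s).det with hdG
  have hdG0 : 0 < dG := h.det_kernelMatrix_pos hsk
  have hdB0 : 0 < dB := Finset.prod_pos fun c _ => h.det_kernelMatrix_pos (hfk c)
  rw [hs] at hdet1 hdet2
  -- The determinants contribute an error linear in `ε`; the loss of a square root only comes from
  -- the moments.
  have hq : |√(dG / dB) - 1| ≤ 2 ^ k * (k * ε) := by
    refine (abs_sqrt_sub_one_le (by positivity)).trans ?_
    have hkε : 0 ≤ k * ε := by positivity
    have h2k := natCast_le_two_pow k
    rw [abs_le]
    constructor
    · have h1 : 1 - k * (k * ε) ≤ (1 - k * ε) ^ k := by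
        have := one_add_mul_le_pow (a := -(k * ε)) (by linarith) k
        rw [← sub_eq_add_neg] at this
        linarith
      have h2 : (1 - k * ε) ^ k ≤ dG / dB := by rw [le_div_iff₀ hdB0]; exact hdet1
      nlinarith
    · have h1 := one_add_pow_le k hkε (by linarith)
      have h2 : dG / dB ≤ (1 + k * ε) ^ k := by rw [div_le_iff₀ hdB0]; exact hdet2
      linarith [hkε]
  have hcard : ∑ c ∈ s.image b, (s.filter (b · = c)).card = s.card :=
    (Finset.card_eq_sum_card_image b s).symm
  -- The powers of `2π` cancel because the cardinalities of the classes add up to that of `s`.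
  have hratio : (∏ c ∈ s.image b, kacRiceDensity κ F F' (s.filter (b · = c))) /
      kacRiceDensity κ F F' s = √(dG / dB) * (absMoment SB / Φ) := by
    simp only [kacRiceDensity]
    rw [Finset.prod_mul_distrib, Finset.prod_mul_distrib, ← hSBprod, Finset.prod_pow_eq_pow_sum,
      hcard, Finset.prod_inv_distrib, ← Real.sqrt_prod _ fun c _ => (h.det_kernelMatrix_pos (hfk c)).le,
      ← hdB, ← hdG, ← hΦdef, Real.sqrt_div hdG0.le]
    have := Real.sqrt_pos.2 hdG0
    have := Real.sqrt_pos.2 hdB0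
    have := Real.sqrt_pos.2 (by positivity : 0 < 2 * Real.pi)
    field_simp
  rw [hratio]
  set q := √(dG / dB)
  set r := absMoment SB / Φ - 1 with hrdef
  have hsq1 : √ε ≤ 1 := Real.sqrt_le_one.2 (by linarith)
  have hεs : ε ≤ √ε := by
    have := Real.sq_sqrt hε0
    nlinarith [Real.sqrt_nonneg ε]
  have e : q * (absMoment SB / Φ) - 1 = r + (q - 1) * (1 + r) := by rw [hrdef]; ring
  rw [e]
  refine (abs_add_le _ _).trans ?_
  rw [abs_mul]
  have h1r : |1 + r| ≤ 1 + A := by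
    refine (abs_add_le _ _).trans ?_
    rw [abs_one]
    have : A * √ε ≤ A := mul_le_of_le_one_right hA0.le hsq1
    linarith
  have h2 : |q - 1| * |1 + r| ≤ 2 ^ k * (k * √ε) * (1 + A) := by
    gcongr
    exact hq.trans (by gcongr)
  linarith

/-- When `ε` exceeds the threshold, `√ε / √ε₀ ≥ 1` and it suffices that the ratio be bounded. It is,
because both sides are comparable to the same Vandermonde product, the classes being more than `1`
apart. -/
theorem NondegenerateCurve.exists_cluster (h : NondegenerateCurve k κ F F') :
    ∃ C : ℝ, 0 < C ∧ ∀ (η : ℝ) (γ : Type) [LinearOrder γ] (s : Finset ℝ) (b : ℝ → γ), 1 ≤ η →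
      s.card = k → (∀ x ∈ s, ∀ y ∈ s, b x ≠ b y → η < |x - y|) →
      ∃ e : ℝ, |e| ≤ C * √(ckNorm κ k η) ∧
        ∏ c ∈ s.image b, kacRiceDensity κ F F' (s.filter (b · = c)) =
          kacRiceDensity κ F F' s * (1 + e) := by
  obtain ⟨C₁, ε₀, hC₁, hε₀, hsmall⟩ := h.exists_cluster_of_small
  obtain ⟨C₂, hC₂, hang⟩ := h.exists_abs_inner_le
  obtain ⟨c, C, hc, hC, hb⟩ := h.exists_kacRiceDensity_bounds
  set M : ℝ := max 1 C ^ k / c + 1 with hM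
  have hM0 : 0 < M := by positivity
  refine ⟨(C₁ + M / √ε₀) * √C₂, by positivity, ?_⟩
  intro η γ _ s b hη hs hsep
  have hsk : s.card ≤ k := hs.le
  have hD0 := truncatedVandermonde_pos s
  have hpos : 0 < kacRiceDensity κ F F' s := (mul_pos hc hD0).trans_le (hb s hsk).1
  refine ⟨(∏ c ∈ s.image b, kacRiceDensity κ F F' (s.filter (b · = c))) /
    kacRiceDensity κ F F' s - 1, ?_, by field_simp; ring⟩
  set ε := C₂ * ckNorm κ k η with hε
  have hN := ckNorm_nonneg κ k η
  have hε0 : 0 ≤ ε := by positivity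
  have e1 : √C₂ * √(ckNorm κ k η) = √ε := by rw [← Real.sqrt_mul hC₂.le]
  rw [mul_assoc, e1, add_mul]
  rcases le_or_gt ε ε₀ with hle | hgt
  · refine (hsmall γ s b ε hs hε0 hle ?_).trans ?_
    · intro t₁ t₂ h1 h2 h3 u hu v hv
      have hdis : Disjoint t₁ t₂ := Finset.disjoint_left.2 fun i hi hj => h3 i hi i hj rfl
      have hcard : t₁.card + t₂.card ≤ k := by
        rw [← Finset.card_union_of_disjoint hdis, ← hs]
        exact Finset.card_le_card (Finset.union_subset h1 h2)
      exact hang η hη t₁ t₂ hcard (fun x hx y hy => hsep x (h1 hx) y (h2 hy) (h3 x hx y hy)) u hu v hv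
    · have : 0 ≤ M / √ε₀ * √ε := by positivity
      linarith
  · have h1 : ∏ c ∈ s.image b, kacRiceDensity κ F F' (s.filter (b · = c)) ≤
        max 1 C ^ k * truncatedVandermonde s := by
      calc _ ≤ ∏ c ∈ s.image b, (max 1 C * truncatedVandermonde (s.filter (b · = c))) := by
            refine Finset.prod_le_prod (fun c' _ => ?_) fun c' _ => ?_
            · exact (mul_pos hc (truncatedVandermonde_pos _)).le.trans
                (hb _ ((Finset.card_filter_le _ _).trans hsk)).1
            · refine (hb _ ((Finset.card_filter_le _ _).trans hsk)).2.trans ?_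
              exact mul_le_mul_of_nonneg_right (le_max_right _ _) (truncatedVandermonde_pos _).le
        _ = max 1 C ^ (s.image b).card * truncatedVandermonde s := by
            rw [Finset.prod_mul_distrib, Finset.prod_const, prod_truncatedVandermonde_classes s b
              fun x hx y hy hxy => hη.trans (hsep x hx y hy hxy).le]
        _ ≤ _ := by
            refine mul_le_mul_of_nonneg_right ?_ hD0.le
            exact pow_le_pow_right₀ (le_max_left _ _) (Finset.card_image_le.trans hsk)
    have h0 : 0 ≤ ∏ c ∈ s.image b, kacRiceDensity κ F F' (s.filter (b · = c)) :=
      Finset.prod_nonneg fun c' _ => (mul_pos hc (truncatedVandermonde_pos _)).le.trans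
        (hb _ ((Finset.card_filter_le _ _).trans hsk)).1
    have h2 : (∏ c ∈ s.image b, kacRiceDensity κ F F' (s.filter (b · = c))) /
        kacRiceDensity κ F F' s ≤ max 1 C ^ k / c := by
      rw [div_le_div_iff₀ hpos hc]
      calc _ ≤ max 1 C ^ k * truncatedVandermonde s * c := by gcongr
        _ = max 1 C ^ k * (c * truncatedVandermonde s) := by ring
        _ ≤ _ := by gcongr; exact (hb s hsk).1
    have h3 : 0 ≤ (∏ c ∈ s.image b, kacRiceDensity κ F F' (s.filter (b · = c))) /
        kacRiceDensity κ F F' s := div_nonneg h0 hpos.le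
    have h4 : 1 ≤ √ε / √ε₀ := by
      rw [one_le_div (Real.sqrt_pos.2 hε₀)]
      exact Real.sqrt_le_sqrt hgt.le
    have h5 : M ≤ M / √ε₀ * √ε := by
      calc M = M * 1 := (mul_one _).symm
        _ ≤ M * (√ε / √ε₀) := by gcongr
        _ = _ := by ring
    have h6 : 0 ≤ C₁ * √ε := by positivity
    rw [abs_le]
    have : 0 ≤ max 1 C ^ k / c := by positivity
    constructor <;> linarith
end

/-! ### Joint law of values and derivatives. -/

section jets

variable {E : Type*} [NormedAddCommGroup E] [InnerProductSpace ℝ E] {k : ℕ} {κ : ℝ → ℝ}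
  {F F' : ℝ → E}

theorem inner_deriv_left (hF : ∀ s t, inner ℝ (F s) (F t) = κ (s - t))
    (hF' : ∀ t, HasStrictDerivAt F (F' t) t) (s t : ℝ) :
    HasDerivAt κ (inner ℝ (F' s) (F t)) (s - t) := by
  have h1 : HasDerivAt (fun u => inner ℝ (F u) (F t)) (inner ℝ (F' s) (F t)) s := by
    simpa using (hF' s).hasDerivAt.inner ℝ (hasDerivAt_const s (F t))
  simp_rw [hF] at h1
  have h2 : HasDerivAt (fun u : ℝ => u + t) 1 (s - t) := (hasDerivAt_id _).add_const t
  have h3 := HasDerivAt.comp (s - t) (h₂ := fun u => κ (u - t)) (h := fun u => u + t)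
    (by simpa using h1) h2
  simpa [Function.comp_def] using h3

theorem inner_deriv_eq (hF : ∀ s t, inner ℝ (F s) (F t) = κ (s - t))
    (hF' : ∀ t, HasStrictDerivAt F (F' t) t) (hκ : ContDiff ℝ 2 κ) (s t : ℝ) :
    inner ℝ (F' s) (F t) = iteratedDeriv 1 κ (s - t) ∧
    inner ℝ (F s) (F' t) = -iteratedDeriv 1 κ (s - t) ∧
    inner ℝ (F' s) (F' t) = -iteratedDeriv 2 κ (s - t) := by
  have h1 : ∀ s t, inner ℝ (F' s) (F t) = deriv κ (s - t) := fun s t =>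
    ((inner_deriv_left hF hF' s t).deriv).symm
  have hsub : HasDerivAt (fun u : ℝ => s - u) (-1) t := by
    simpa using (hasDerivAt_id t).const_sub s
  refine ⟨by rw [iteratedDeriv_one, h1], ?_, ?_⟩
  · have h2 : HasDerivAt (fun u => inner ℝ (F s) (F u)) (inner ℝ (F s) (F' t)) t := by
      simpa using (hasDerivAt_const t (F s)).inner ℝ (hF' t).hasDerivAt
    simp_rw [hF] at h2
    have h3 := HasDerivAt.comp t (inner_deriv_left hF hF' s t) hsub
    rw [iteratedDeriv_one, ← h1]
    have := h2.unique h3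
    linarith
  · have h2 : HasDerivAt (fun u => inner ℝ (F' s) (F u)) (inner ℝ (F' s) (F' t)) t := by
      simpa using (hasDerivAt_const t (F' s)).inner ℝ (hF' t).hasDerivAt
    simp_rw [h1] at h2
    have hd : DifferentiableAt ℝ (deriv κ) (s - t) := by
      have : ContDiff ℝ 1 (deriv κ) := by
        have := contDiff_iteratedDeriv_of_add (j := 1) (l := 1) (n := 2) hκ (by norm_num)
        rwa [iteratedDeriv_one] at this
      exact (this.differentiable (by norm_num)).differentiableAt
    have h3 := HasDerivAt.comp t hd.hasDerivAt hsub
    rw [iteratedDeriv_succ, iteratedDeriv_one]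
    have := h2.unique h3
    linarith

/-- The squared norm of a combination of values and derivatives is the spectral form with orders `0`
and `1`, which is definite. -/
theorem linearIndependent_jets {μ : Measure ℝ} [IsProbabilityMeasure μ]
    (hμ : ∀ t, charFun μ t = κ t) (hκ : Tendsto κ atTop (𝓝 0)) (hk : 1 ≤ k)
    (hm : MemLp id ((2 * k : ℕ) : ℝ≥0∞) μ) (hF : ∀ s t, inner ℝ (F s) (F t) = κ (s - t))
    (hF' : ∀ t, HasStrictDerivAt F (F' t) t) {ι : Type*} [Fintype ι] (x : ι → ℝ)
    (hx : Function.Injective x) :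
    LinearIndependent ℝ (Sum.elim (fun i => F (x i)) (fun i => F' (x i))) := by
  classical
  have hκc : ContDiff ℝ 2 κ :=
    (contDiff_of_spectral hμ hm).of_le (by exact_mod_cast (by omega : 2 ≤ 2 * k))
  rw [Fintype.linearIndependent_iff]
  intro b hb
  set o : ι ⊕ ι → ℕ := Sum.elim (fun _ => 0) (fun _ => 1) with ho
  set z : ι ⊕ ι → ℝ := Sum.elim x x with hz
  have hent : ∀ i j, inner ℝ (Sum.elim (fun i => F (x i)) (fun i => F' (x i)) i)
      (Sum.elim (fun i => F (x i)) (fun i => F' (x i)) j) =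
      (-1) ^ o j * iteratedDeriv (o i + o j) κ (z i - z j) := by
    have h := fun s t => inner_deriv_eq hF hF' hκc s t
    rintro (i | i) (j | j) <;> simp only [ho, hz, Sum.elim_inl, Sum.elim_inr]
    · simp [hF]
    · rw [(h _ _).2.1]; simp
    · rw [(h _ _).1]; simp
    · rw [(h _ _).2.2]; simp
  have hzero : ∑ i, ∑ j, b i * b j * ((-1) ^ o j * iteratedDeriv (o i + o j) κ (z i - z j)) = 0 := by
    have h1 : inner ℝ (∑ i, b i • Sum.elim (fun i => F (x i)) (fun i => F' (x i)) i)
        (∑ i, b i • Sum.elim (fun i => F (x i)) (fun i => F' (x i)) i) = 0 := by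
      rw [hb, inner_zero_left]
    rw [sum_inner] at h1
    rw [← h1]
    refine Finset.sum_congr rfl fun i _ => ?_
    rw [inner_sum]
    refine Finset.sum_congr rfl fun j _ => ?_
    rw [inner_smul_left, inner_smul_right, hent]
    simp
    ring
  intro i
  refine eq_zero_of_spectral_form_eq_zero hμ hκ hm Finset.univ o z b ?_ ?_ hzero i
    (Finset.mem_univ i)
  · rintro (i | i) - <;> simp [ho]; omega
  · rintro (i | i) - (j | j) - h1 h2 <;> simp [ho, hz] at h1 h2 ⊢ <;> exact hx h2

end jets

section block

variable {E : Type*} [NormedAddCommGroup E] [InnerProductSpace ℝ E] {ι : Type*} [Fintype ι]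
  [DecidableEq ι]

/-- Regression of `g` on `f`, with `w` the part orthogonal to `f`, read as a block factorization. -/
theorem gram_sumElim_eq_mul {f g w : ι → E} {m : Matrix ι ι ℝ}
    (hg : ∀ i, g i = w i + ∑ j, m i j • f j) (hw : ∀ i j, inner ℝ (w i) (f j) = 0) :
    Matrix.gram ℝ (Sum.elim f g) = Matrix.fromBlocks 1 0 m 1 *
      Matrix.fromBlocks (Matrix.gram ℝ f) 0 0 (Matrix.gram ℝ w) *
        (Matrix.fromBlocks 1 0 m 1).transpose := by
  have h1 : ∀ i j, inner ℝ (f i) (g j) = (Matrix.gram ℝ f * m.transpose) i j := by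
    intro i j
    rw [hg, inner_add_right, real_inner_comm, hw, zero_add, inner_sum, Matrix.mul_apply]
    simp [inner_smul_right, mul_comm]
  have h2 : ∀ i j, inner ℝ (g i) (f j) = (m * Matrix.gram ℝ f) i j := by
    intro i j
    rw [hg, inner_add_left, hw, zero_add, sum_inner, Matrix.mul_apply]
    simp [inner_smul_left]
  have h3 : ∀ i j, inner ℝ (g i) (g j) =
      (m * Matrix.gram ℝ f * m.transpose + Matrix.gram ℝ w) i j := by
    intro i j
    have h4 : inner ℝ (g i) (w j) = inner ℝ (w i) (w j) := by
      have hw' : ∀ i j, inner ℝ (f j) (w i) = 0 := fun i j => by rw [real_inner_comm]; exact hw i j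
      rw [hg, inner_add_left, sum_inner]
      simp [inner_smul_left, hw']
    rw [hg j, inner_add_right, h4, inner_sum, Matrix.add_apply, Matrix.mul_apply, add_comm]
    simp [inner_smul_right, h2, mul_comm]
  rw [Matrix.fromBlocks_transpose, Matrix.fromBlocks_multiply, Matrix.fromBlocks_multiply]
  ext (i | i) (j | j)
  · simp
  · simp [h1]
  · simp [h2]
  · simp [h3]

/-- The joint density at `(0, v)` is the density of the values at `0` times the conditional density
of the derivatives, whose covariance is that of the residuals. -/
theorem gaussianDensity_gram_sumElim {f g w : ι → E} {m : Matrix ι ι ℝ}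
    (hg : ∀ i, g i = w i + ∑ j, m i j • f j) (hw : ∀ i j, inner ℝ (w i) (f j) = 0)
    (hG : 0 < (Matrix.gram ℝ f).det) (hS : 0 < (Matrix.gram ℝ w).det) (v : ι → ℝ) :
    gaussianDensity (Matrix.gram ℝ (Sum.elim f g)) (Sum.elim 0 v) =
      (√(2 * Real.pi))⁻¹ ^ Fintype.card ι * (√(Matrix.gram ℝ f).det)⁻¹ *
        gaussianDensity (Matrix.gram ℝ w) v := by
  set G := Matrix.gram ℝ f
  set S := Matrix.gram ℝ w
  set L : Matrix (ι ⊕ ι) (ι ⊕ ι) ℝ := Matrix.fromBlocks 1 0 m 1 with hL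
  set D : Matrix (ι ⊕ ι) (ι ⊕ ι) ℝ := Matrix.fromBlocks G 0 0 S with hD
  have hLdet : L.det = 1 := by rw [hL, Matrix.det_fromBlocks_zero₁₂]; simp
  have hLu : IsUnit L.det := by rw [hLdet]; exact isUnit_one
  have hGu : IsUnit G.det := isUnit_iff_ne_zero.2 hG.ne'
  have hSu : IsUnit S.det := isUnit_iff_ne_zero.2 hS.ne'
  have hDdet : D.det = G.det * S.det := by rw [hD, Matrix.det_fromBlocks_zero₁₂]
  have hDinv : D⁻¹ = Matrix.fromBlocks G⁻¹ 0 0 S⁻¹ := by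
    refine Matrix.inv_eq_right_inv ?_
    rw [hD, Matrix.fromBlocks_multiply]
    simp [Matrix.mul_nonsing_inv _ hGu, Matrix.mul_nonsing_inv _ hSu]
  have hLv : L⁻¹.mulVec (Sum.elim (0 : ι → ℝ) v) = Sum.elim (0 : ι → ℝ) v := by
    have h1 : L.mulVec (Sum.elim (0 : ι → ℝ) v) = Sum.elim (0 : ι → ℝ) v := by
      rw [hL, Matrix.fromBlocks_mulVec]
      ext (i | i) <;> simp [Function.comp_def, Matrix.mulVec, dotProduct]
    conv_lhs => rw [← h1]
    rw [Matrix.mulVec_mulVec, Matrix.nonsing_inv_mul _ hLu, Matrix.one_mulVec]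
  have hquad : Sum.elim (0 : ι → ℝ) v ⬝ᵥ (L * D * L.transpose)⁻¹.mulVec (Sum.elim (0 : ι → ℝ) v) =
      v ⬝ᵥ S⁻¹.mulVec v := by
    rw [Matrix.mul_inv_rev, Matrix.mul_inv_rev, ← Matrix.mulVec_mulVec, ← Matrix.mulVec_mulVec,
      hLv, ← Matrix.transpose_nonsing_inv, Matrix.mulVec_transpose, dotProduct_comm,
      ← Matrix.dotProduct_mulVec, hLv, hDinv, Matrix.fromBlocks_mulVec, dotProduct_comm]
    simp [Function.comp_def, dotProduct]
  have hdet : (L * D * L.transpose).det = G.det * S.det := by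
    rw [Matrix.det_mul, Matrix.det_mul, Matrix.det_transpose, hLdet, hDdet]; ring
  rw [gram_sumElim_eq_mul hg hw]
  simp only [gaussianDensity]
  rw [hquad, hdet, Fintype.card_sum, Real.sqrt_mul hG.le, mul_inv, pow_add]
  ring

end block

/-! ### Asymptotic probability of sign changes on short intervals. -/

section process

variable {Ω : Type*} [MeasurableSpace Ω] {P : Measure Ω} {k : ℕ} {f : ℝ → Ω → ℝ}

theorem IsNormalizedStationaryGaussian.aemeasurable (hf : IsNormalizedStationaryGaussian k f P)
    (t : ℝ) : AEMeasurable (f t) P := (hf.memLp t).aestronglyMeasurable.aemeasurable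

theorem IsNormalizedStationaryGaussian.aemeasurable_combination
    (hf : IsNormalizedStationaryGaussian k f P) {I J : Type*} [Fintype I] [Fintype J]
    (a : I → J → ℝ) (t : J → ℝ) : AEMeasurable (fun ω i => ∑ j, a i j * f (t j) ω) P :=
  aemeasurable_pi_lambda _ fun i => Finset.aemeasurable_fun_sum _ fun j _ =>
    (hf.aemeasurable (t j)).const_mul (a i j)

theorem IsNormalizedStationaryGaussian.isGaussianVector_combination
    (hf : IsNormalizedStationaryGaussian k f P) {I J : Type*} [Fintype I] [Fintype J]
    (a : I → J → ℝ) (t : J → ℝ) :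
    IsGaussianVector (P.map fun ω i => ∑ j, a i j * f (t j) ω)
      (Matrix.gram ℝ fun i => ∑ j, a i j • hf.curve (t j)) := by
  intro c
  rw [integral_map (hf.aemeasurable_combination a t) (by fun_prop)]
  set d : J → ℝ := fun j => ∑ i, c i * a i j with hd
  have e1 : ∀ ω, (c ⬝ᵥ fun i => ∑ j, a i j * f (t j) ω) = ∑ j, d j * f (t j) ω := by
    intro ω
    simp only [dotProduct, hd, Finset.mul_sum, Finset.sum_mul]
    rw [Finset.sum_comm]
    exact Finset.sum_congr rfl fun j _ => Finset.sum_congr rfl fun i _ => by ring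
  have e2 : c ⬝ᵥ (Matrix.gram ℝ fun i => ∑ j, a i j • hf.curve (t j)).mulVec c =
      ‖∑ j, d j • hf.curve (t j)‖ ^ 2 := by
    rw [dotProduct_gram_mulVec]
    congr 2
    simp only [hd, Finset.smul_sum, Finset.sum_smul, smul_smul]
    rw [Finset.sum_comm]
  have hlaw := hf.hasGaussianLaw_sum Finset.univ d t
  have h0 := hf.integral_sum Finset.univ d t
  have hmap := hlaw.map_eq_gaussianReal
  rw [h0, ← integral_sq_eq_variance hlaw h0, hf.integral_sum_sq,
    ← norm_sq_sum_smul_eq hf.inner_curve] at hmap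
  have hch := charFun_gaussianReal (μ := 0)
    (v := (‖∑ j, d j • hf.curve (t j)‖ ^ 2).toNNReal) 1
  rw [← hmap, charFun_apply_real, integral_map hlaw.aemeasurable (by fun_prop)] at hch
  simp_rw [e1]
  rw [e2]
  simp only [Complex.ofReal_one, one_mul] at hch
  rw [hch, Real.coe_toNNReal _ (sq_nonneg _)]
  congr 1
  simp
  ring

/-- Probability of an event that depends on a nondegenerate combination of values. -/
theorem IsNormalizedStationaryGaussian.measure_combination_mem
    (hf : IsNormalizedStationaryGaussian k f P) {I J : Type*} [Fintype I] [DecidableEq I]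
    [Fintype J] (a : I → J → ℝ) (t : J → ℝ) {A : Set (I → ℝ)} (hA : MeasurableSet A)
    (hS : (Matrix.gram ℝ fun i => ∑ j, a i j • hf.curve (t j)).PosDef) :
    P.real {ω | (fun i => ∑ j, a i j * f (t j) ω) ∈ A} =
      ∫ x, A.indicator (gaussianDensity
        (Matrix.gram ℝ fun i => ∑ j, a i j • hf.curve (t j))) x := by
  have hprob := hf.gaussian.isProbabilityMeasure
  have hm := hf.aemeasurable_combination a t
  have hp : IsProbabilityMeasure (P.map fun ω i => ∑ j, a i j * f (t j) ω) :=
    Measure.isProbabilityMeasure_map hm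
  have h1 := (hf.isGaussianVector_combination a t).unique
    (isGaussianVector_gaussianVector hS.posSemidef)
  have h2 : P.real {ω | (fun i => ∑ j, a i j * f (t j) ω) ∈ A} =
      (P.map fun ω i => ∑ j, a i j * f (t j) ω).real A := by
    rw [Measure.real, Measure.real, Measure.map_apply_of_aemeasurable hm hA]
    rfl
  rw [h2, h1, gaussianVector_eq_withDensity hS, Measure.real, withDensity_apply _ hA,
    integral_indicator hA, integral_eq_lintegral_of_nonneg_ae
      (Eventually.of_forall (gaussianDensity_nonneg _))
      (continuous_gaussianDensity _).aestronglyMeasurable]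

end process

section gaussianDensityBounds

variable {ι : Type*} [Fintype ι] [DecidableEq ι]

/-- Cauchy–Schwarz on each row of `A`, where `S = A Aᵀ` and `x = A y`. It yields a Gaussian tail
depending on `S` only through its trace. -/
theorem Matrix.PosDef.sum_sq_le {S : Matrix ι ι ℝ} (hS : S.PosDef) (x : ι → ℝ) :
    ∑ i, x i ^ 2 ≤ S.trace * (x ⬝ᵥ S⁻¹.mulVec x) := by
  obtain ⟨A, hA, rfl⟩ := hS.exists_eq_mul_transpose
  have hu : IsUnit A.det := isUnit_iff_ne_zero.2 hA
  obtain ⟨y, rfl⟩ : ∃ y, x = A.mulVec y :=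
    ⟨A⁻¹.mulVec x, by rw [Matrix.mulVec_mulVec, Matrix.mul_nonsing_inv _ hu, Matrix.one_mulVec]⟩
  have h1 : A.mulVec y ⬝ᵥ (A * A.transpose)⁻¹.mulVec (A.mulVec y) = ∑ i, y i ^ 2 := by
    rw [Matrix.mul_inv_rev, ← Matrix.mulVec_mulVec, Matrix.mulVec_mulVec y,
      Matrix.nonsing_inv_mul _ hu, Matrix.one_mulVec, ← Matrix.transpose_nonsing_inv,
      Matrix.mulVec_transpose, dotProduct_comm, ← Matrix.dotProduct_mulVec, Matrix.mulVec_mulVec,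
      Matrix.nonsing_inv_mul _ hu, Matrix.one_mulVec]
    simp [dotProduct, sq]
  rw [h1, Matrix.trace, Finset.sum_mul]
  refine Finset.sum_le_sum fun i _ => ?_
  have h2 : (A * A.transpose).diag i = ∑ j, A i j ^ 2 := by
    simp [Matrix.diag, Matrix.mul_apply, sq]
  rw [h2]
  exact Finset.sum_mul_sq_le_sq_mul_sq _ _ _

theorem gaussianDensity_le {S : Matrix ι ι ℝ} (hS : S.PosDef) {K d : ℝ} (hd : 0 < d)
    (htr : S.trace ≤ K) (hK : 0 < K) (hdet : d ≤ S.det) (x : ι → ℝ) :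
    gaussianDensity S x ≤ (√(2 * Real.pi))⁻¹ ^ Fintype.card ι * (√d)⁻¹ *
      Real.exp (-(∑ i, x i ^ 2) / (2 * K)) := by
  unfold gaussianDensity
  have h0 : 0 ≤ x ⬝ᵥ S⁻¹.mulVec x := by
    simpa using hS.inv.posSemidef.dotProduct_mulVec_nonneg x
  have h1 : (∑ i, x i ^ 2) / K ≤ x ⬝ᵥ S⁻¹.mulVec x := by
    rw [div_le_iff₀ hK, mul_comm]
    exact (hS.sum_sq_le x).trans (mul_le_mul_of_nonneg_right htr h0)
  have hs := Real.sqrt_pos.2 hd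
  have h2 : Real.exp (-(x ⬝ᵥ S⁻¹.mulVec x) / 2) ≤ Real.exp (-(∑ i, x i ^ 2) / (2 * K)) := by
    rw [Real.exp_le_exp, div_le_div_iff₀ two_pos (by positivity)]
    rw [div_le_iff₀ hK] at h1
    nlinarith
  have h3 : (√S.det)⁻¹ ≤ (√d)⁻¹ := inv_anti₀ hs (Real.sqrt_le_sqrt hdet)
  have h4 : 0 ≤ (√(2 * Real.pi))⁻¹ ^ Fintype.card ι := by positivity
  exact mul_le_mul (mul_le_mul_of_nonneg_left h3 h4) h2 (Real.exp_pos _).le (by positivity)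

theorem tendsto_gaussianDensity {α : Type*} {l : Filter α} {S : α → Matrix ι ι ℝ}
    {S₀ : Matrix ι ι ℝ} (hS : Tendsto S l (𝓝 S₀)) (h0 : 0 < S₀.det) {x : α → ι → ℝ} {x₀ : ι → ℝ}
    (hx : Tendsto x l (𝓝 x₀)) :
    Tendsto (fun p => gaussianDensity (S p) (x p)) l (𝓝 (gaussianDensity S₀ x₀)) := by
  have hdet : Tendsto (fun p => (S p).det) l (𝓝 S₀.det) :=
    ((Continuous.matrix_det continuous_id).tendsto S₀).comp hS
  have hadj : Tendsto (fun p => (S p).adjugate) l (𝓝 S₀.adjugate) :=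
    ((Continuous.matrix_adjugate continuous_id).tendsto S₀).comp hS
  have hinv : ∀ i j, Tendsto (fun p => (S p)⁻¹ i j) l (𝓝 (S₀⁻¹ i j)) := by
    intro i j
    simp only [Matrix.inv_def, Ring.inverse_eq_inv', Matrix.smul_apply, smul_eq_mul]
    exact (hdet.inv₀ h0.ne').mul (tendsto_pi_nhds.1 (tendsto_pi_nhds.1 hadj i) j)
  have hx' := tendsto_pi_nhds.1 hx
  have hquad : Tendsto (fun p => x p ⬝ᵥ (S p)⁻¹.mulVec (x p)) l (𝓝 (x₀ ⬝ᵥ S₀⁻¹.mulVec x₀)) := by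
    simp only [dotProduct, Matrix.mulVec]
    exact tendsto_finsetSum _ fun i _ => (hx' i).mul
      (tendsto_finsetSum _ fun j _ => (hinv i j).mul (hx' j))
  unfold gaussianDensity
  exact (tendsto_const_nhds.mul (hdet.sqrt.inv₀ (Real.sqrt_pos.2 h0).ne')).mul
    ((Real.continuous_exp.tendsto _).comp (hquad.neg.div_const 2))

end gaussianDensityBounds

section smallBall

variable {ι : Type*} [Fintype ι]

theorem measurableSet_forall_abs_lt (δ : ℝ) :
    MeasurableSet {x : ι ⊕ ι → ℝ | ∀ i, |x (Sum.inl i)| < δ * |x (Sum.inr i)|} := by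
  rw [show {x : ι ⊕ ι → ℝ | ∀ i, |x (Sum.inl i)| < δ * |x (Sum.inr i)|} =
    ⋂ i, {x | |x (Sum.inl i)| < δ * |x (Sum.inr i)|} by ext; simp]
  refine MeasurableSet.iInter fun i => measurableSet_lt ?_ ?_ <;> fun_prop

theorem integral_indicator_rescale [DecidableEq ι] {δ : ℝ} (hδ : 0 < δ) (g : (ι ⊕ ι → ℝ) → ℝ) :
    ∫ x, {x : ι ⊕ ι → ℝ | ∀ i, |x (Sum.inl i)| < δ * |x (Sum.inr i)|}.indicator g x =
      δ ^ Fintype.card ι * ∫ z, {x : ι ⊕ ι → ℝ | ∀ i, |x (Sum.inl i)| < |x (Sum.inr i)|}.indicator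
        (fun z => g (Sum.elim (fun i => δ * z (Sum.inl i)) (fun i => z (Sum.inr i)))) z := by
  set D : ι ⊕ ι → ℝ := Sum.elim (fun _ => δ) (fun _ => 1) with hD
  have hdet : (Matrix.diagonal D).det = δ ^ Fintype.card ι := by
    simp [hD]
  have hne : (Matrix.diagonal D).det ≠ 0 := by rw [hdet]; positivity
  have hemb : MeasurableEmbedding (Matrix.toLin' (Matrix.diagonal D)) := by
    have : (Matrix.toLin' (Matrix.diagonal D)).det ≠ 0 := by rwa [LinearMap.det_toLin']
    exact (LinearEquiv.ofIsUnitDet (f := Matrix.toLin' (Matrix.diagonal D)) (v := Pi.basisFun ℝ _)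
      (v' := Pi.basisFun ℝ _) (by simpa [LinearMap.det_toLin'] using hne)
      ).toContinuousLinearEquiv.toHomeomorph.measurableEmbedding
  conv_lhs => rw [← Real.smul_map_diagonal_volume_pi hne]
  rw [integral_smul_measure, hemb.integral_map, hdet, abs_of_pos (by positivity),
    ENNReal.toReal_ofReal (by positivity), smul_eq_mul]
  congr 1
  refine integral_congr_ae (Eventually.of_forall fun z => ?_)
  have h1 : Matrix.toLin' (Matrix.diagonal D) z =
      Sum.elim (fun i => δ * z (Sum.inl i)) (fun i => z (Sum.inr i)) := by
    ext (i | i) <;> simp [Matrix.toLin'_apply, Matrix.mulVec_diagonal, hD]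
  simp only [h1]
  unfold Set.indicator
  have h2 : (∀ i, |δ * z (Sum.inl i)| < δ * |z (Sum.inr i)|) ↔
      ∀ i, |z (Sum.inl i)| < |z (Sum.inr i)| := by
    refine forall_congr' fun i => ?_
    rw [abs_mul, abs_of_pos hδ, mul_lt_mul_iff_right₀ hδ]
  simp only [mem_ofPred_eq, Sum.elim_inl, Sum.elim_inr, h2]

theorem integrable_exp_neg_sum_sq {K : ℝ} (hK : 0 < K) :
    Integrable (fun x : ι → ℝ => Real.exp (-(∑ i, x i ^ 2) / K)) := by
  have h := Integrable.fintype_prod (μ := fun _ : ι => (volume : Measure ℝ))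
    (f := fun (_ : ι) (t : ℝ) => Real.exp (-K⁻¹ * t ^ 2))
    (fun _ => integrable_exp_neg_mul_sq (inv_pos.2 hK))
  refine h.congr (Eventually.of_forall fun x => ?_)
  simp only
  rw [← Real.exp_sum, ← Finset.mul_sum]
  congr 1
  field_simp

/-- For fixed `v`, the values range over a box of volume `∏ 2 |v_i|`; this is how the product of
absolute values of the derivatives enters the Kac–Rice formula. -/
theorem integral_indicator_forall_abs_lt {g : (ι → ℝ) → ℝ}
    (hg : Integrable ({x : ι ⊕ ι → ℝ | ∀ i, |x (Sum.inl i)| < |x (Sum.inr i)|}.indicator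
      fun x => g fun i => x (Sum.inr i))) :
    ∫ x, {x : ι ⊕ ι → ℝ | ∀ i, |x (Sum.inl i)| < |x (Sum.inr i)|}.indicator
      (fun x => g fun i => x (Sum.inr i)) x = 2 ^ Fintype.card ι * ∫ v, (∏ i, |v i|) * g v := by
  have hmp := volume_measurePreserving_sumPiEquivProdPi_symm (fun _ : ι ⊕ ι => ℝ)
  rw [← hmp.integral_comp (MeasurableEquiv.measurableEmbedding _)]
  have hint := (hmp.integrable_comp_emb (MeasurableEquiv.measurableEmbedding _)).2 hg
  have e : ∀ p : (ι → ℝ) × (ι → ℝ),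
      {x : ι ⊕ ι → ℝ | ∀ i, |x (Sum.inl i)| < |x (Sum.inr i)|}.indicator
        (fun x => g fun i => x (Sum.inr i))
          ((MeasurableEquiv.sumPiEquivProdPi (fun _ : ι ⊕ ι => ℝ)).symm p) =
      (Set.univ.pi fun i => Ioo (-|p.2 i|) (|p.2 i|)).indicator (fun _ => g p.2) p.1 := by
    intro p
    have h1 : (∀ i, |p.1 i| < |p.2 i|) ↔ p.1 ∈ Set.univ.pi fun i => Ioo (-|p.2 i|) (|p.2 i|) := by
      simp [Set.mem_pi, abs_lt]
    by_cases h2 : ∀ i, |p.1 i| < |p.2 i|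
    · rw [indicator_of_mem (h1.1 h2), indicator_of_mem (by exact h2)]
      rfl
    · rw [indicator_of_notMem (fun h3 => h2 (h1.2 h3)), indicator_of_notMem (by exact h2)]
  rw [Measure.volume_eq_prod, integral_congr_ae (Eventually.of_forall e)]
  rw [Measure.volume_eq_prod] at hint
  rw [integral_prod_symm _ (hint.congr (Eventually.of_forall e)), ← integral_const_mul]
  refine integral_congr_ae (Eventually.of_forall fun v => ?_)
  simp only
  rw [integral_indicator (MeasurableSet.univ_pi fun i => measurableSet_Ioo), setIntegral_const,
    Measure.real, Real.volume_pi_Ioo_toReal (by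
      intro i; simp only; linarith [abs_nonneg (v i)])]
  simp only [smul_eq_mul]
  rw [← mul_assoc, ← Finset.card_univ, ← Finset.prod_const, ← Finset.prod_mul_distrib]
  congr 2
  ext i
  ring

/-- Small ball asymptotics for degenerating constraints on a convergent family of Gaussian
vectors. -/
theorem tendsto_integral_indicator_gaussianDensity [DecidableEq ι] {α : Type*} {l : Filter α}
    [l.IsCountablyGenerated] {S : α → Matrix (ι ⊕ ι) (ι ⊕ ι) ℝ} {S₀ : Matrix (ι ⊕ ι) (ι ⊕ ι) ℝ}
    (hS : Tendsto S l (𝓝 S₀)) (hpsd : ∀ᶠ p in l, (S p).PosDef) (h0 : S₀.PosDef) {δ : α → ℝ}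
    (hδ : Tendsto δ l (𝓝[>] 0)) :
    Tendsto (fun p => (∫ x, {x : ι ⊕ ι → ℝ | ∀ i, |x (Sum.inl i)| < δ p * |x (Sum.inr i)|}.indicator
      (gaussianDensity (S p)) x) / (2 * δ p) ^ Fintype.card ι) l
      (𝓝 (∫ v, (∏ i, |v i|) * gaussianDensity S₀ (Sum.elim (0 : ι → ℝ) v))) := by
  set A := {x : ι ⊕ ι → ℝ | ∀ i, |x (Sum.inl i)| < |x (Sum.inr i)|} with hA
  have hAm : MeasurableSet A := by
    have := measurableSet_forall_abs_lt (ι := ι) 1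
    simp only [one_mul] at this
    exact this
  have hδ0 : Tendsto δ l (𝓝 0) := hδ.mono_right nhdsWithin_le_nhds
  have hδp : ∀ᶠ p in l, 0 < δ p := hδ.eventually self_mem_nhdsWithin
  set K := S₀.trace + 1 with hK
  have hK0 : 0 < K := by
    have : 0 ≤ S₀.trace := h0.posSemidef.trace_nonneg
    linarith
  have hd0 : 0 < S₀.det / 2 := half_pos h0.det_pos
  have htr : ∀ᶠ p in l, (S p).trace ≤ K := by
    have h1 : Tendsto (fun p => (S p).trace) l (𝓝 S₀.trace) :=
      ((Continuous.matrix_trace continuous_id).tendsto S₀).comp hS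
    exact (h1.eventually (gt_mem_nhds (by linarith))).mono fun p h => h.le
  have hdet : ∀ᶠ p in l, S₀.det / 2 ≤ (S p).det := by
    have h1 : Tendsto (fun p => (S p).det) l (𝓝 S₀.det) :=
      ((Continuous.matrix_det continuous_id).tendsto S₀).comp hS
    exact (h1.eventually (lt_mem_nhds (by linarith))).mono fun p h => h.le
  set C := (√(2 * Real.pi))⁻¹ ^ Fintype.card (ι ⊕ ι) * (√(S₀.det / 2))⁻¹ with hC
  -- Rescaling destroys the decay of the density in the first half of the coordinates, but on `A`
  -- these are dominated by the second half. Halving the exponent restores an integrable bound in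
  -- all coordinates.
  set B : (ι ⊕ ι → ℝ) → ℝ := fun x => C * Real.exp (-(∑ i, x i ^ 2) / (4 * K)) with hB
  have hBi : Integrable B := (integrable_exp_neg_sum_sq (by positivity)).const_mul C
  have hB0 : ∀ x, 0 ≤ B x := fun x => by positivity
  have hbound : ∀ T : Matrix (ι ⊕ ι) (ι ⊕ ι) ℝ, T.PosDef → T.trace ≤ K → S₀.det / 2 ≤ T.det →
      ∀ (r : ℝ) (z : ι ⊕ ι → ℝ), ‖A.indicator (fun z => gaussianDensity T
        (Sum.elim (fun i => r * z (Sum.inl i)) (fun i => z (Sum.inr i)))) z‖ ≤ B z := by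
    intro T hT h1 h2 r z
    by_cases hz : z ∈ A
    · rw [indicator_of_mem hz, Real.norm_of_nonneg (gaussianDensity_nonneg _ _)]
      refine (gaussianDensity_le hT hd0 h1 hK0 h2 _).trans ?_
      rw [hB]
      refine mul_le_mul_of_nonneg_left (Real.exp_le_exp.2 ?_) (by positivity)
      rw [div_le_div_iff₀ (by positivity) (by positivity)]
      simp only [Fintype.sum_sum_type, Sum.elim_inl, Sum.elim_inr]
      have h3 : ∑ i, z (Sum.inl i) ^ 2 ≤ ∑ i, z (Sum.inr i) ^ 2 :=
        Finset.sum_le_sum fun i _ => (sq_lt_sq.2 (hz i)).le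
      have h4 : 0 ≤ ∑ i, (r * z (Sum.inl i)) ^ 2 := Finset.sum_nonneg fun i _ => sq_nonneg _
      nlinarith
    · rw [indicator_of_notMem hz, norm_zero]
      exact hB0 z
  have hmeas : ∀ (T : Matrix (ι ⊕ ι) (ι ⊕ ι) ℝ) (r : ℝ),
      AEStronglyMeasurable (A.indicator (fun z : ι ⊕ ι → ℝ => gaussianDensity T
        (Sum.elim (fun i => r * z (Sum.inl i)) (fun i => z (Sum.inr i))))) volume := by
    intro T r
    refine (Continuous.aestronglyMeasurable ?_).indicator hAm
    refine (continuous_gaussianDensity T).comp (continuous_pi ?_)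
    rintro (i | i) <;> simp only [Sum.elim_inl, Sum.elim_inr] <;> fun_prop
  have hlim := tendsto_integral_filter_of_dominated_convergence (μ := volume) (l := l)
    (F := fun p => A.indicator (fun z => gaussianDensity (S p)
        (Sum.elim (fun i => δ p * z (Sum.inl i)) (fun i => z (Sum.inr i)))))
    (f := A.indicator (fun z => gaussianDensity S₀
        (Sum.elim (0 : ι → ℝ) (fun i => z (Sum.inr i))))) B
    (Eventually.of_forall fun p => hmeas _ _)
    (by
      filter_upwards [hpsd, htr, hdet] with p h1 h2 h3
      exact Eventually.of_forall (hbound _ h1 h2 h3 _)) hBi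
    (Eventually.of_forall fun z => by
      by_cases hz : z ∈ A
      · simp only [indicator_of_mem hz]
        refine tendsto_gaussianDensity hS h0.det_pos (tendsto_pi_nhds.2 ?_)
        rintro (i | i)
        · simpa using hδ0.mul_const (z (Sum.inl i))
        · exact tendsto_const_nhds
      · simp only [indicator_of_notMem hz]
        exact tendsto_const_nhds)
  have hint : Integrable (A.indicator (fun z => gaussianDensity S₀
        (Sum.elim (0 : ι → ℝ) (fun i => z (Sum.inr i))))) := by
    have e : (fun z : ι ⊕ ι → ℝ => gaussianDensity S₀
        (Sum.elim (0 : ι → ℝ) (fun i => z (Sum.inr i)))) = fun z => gaussianDensity S₀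
        (Sum.elim (fun i => 0 * z (Sum.inl i)) (fun i => z (Sum.inr i))) := by
      simp [Pi.zero_def]
    rw [e]
    exact Integrable.mono' hBi (hmeas _ _) (Eventually.of_forall
      (hbound S₀ h0 (by linarith) (by linarith) 0))
  rw [integral_indicator_forall_abs_lt (g := fun v => gaussianDensity S₀ (Sum.elim (0 : ι → ℝ) v))
    hint] at hlim
  have h2 : (2 : ℝ) ^ Fintype.card ι ≠ 0 := by positivity
  have := hlim.div_const ((2 : ℝ) ^ Fintype.card ι)
  rw [mul_div_cancel_left₀ _ h2] at this
  refine this.congr' ?_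
  filter_upwards [hδp] with p hp
  rw [integral_indicator_rescale hp, mul_pow, ← hA]
  field_simp

end smallBall

/-- Two numbers have opposite signs exactly when their sum is smaller than their difference in
absolute value. Expressed with mean and slope, the condition has a nondegenerate limit as `δ → 0`.
-/
theorem abs_half_add_lt_iff {δ : ℝ} (hδ : 0 < δ) (a b : ℝ) :
    |1 / 2 * a + 1 / 2 * b| < δ * |(2 * δ)⁻¹ * a + -(2 * δ)⁻¹ * b| ↔ b * a < 0 := by
  have h1 : (2 * δ)⁻¹ * a + -(2 * δ)⁻¹ * b = δ⁻¹ * ((a - b) / 2) := by field_simp; ring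
  rw [h1, abs_mul, abs_inv, abs_of_pos hδ, mul_inv_cancel_left₀ hδ.ne', ← sq_lt_sq]
  constructor <;> intro h <;> nlinarith

section localLimit

variable {Ω : Type*} [MeasurableSpace Ω] {P : Measure Ω} {k : ℕ} {f : ℝ → Ω → ℝ}

/-- Asymptotic probability of simultaneous sign changes of the process on short intervals. -/
theorem IsNormalizedStationaryGaussian.tendsto_measure_sign_change
    (hf : IsNormalizedStationaryGaussian k f P) {F' : ℝ → Lp ℝ 2 P}
    (hF' : ∀ t, HasStrictDerivAt hf.curve (F' t) t) {ι : Type*} [Fintype ι] [DecidableEq ι]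
    (x : ι → ℝ)
    (hx : LinearIndependent ℝ (Sum.elim (fun i => hf.curve (x i)) (fun i => F' (x i)))) :
    Tendsto (fun p : (ι → ℝ) × ℝ =>
      P.real {ω | ∀ i, f (p.1 i - p.2) ω * f (p.1 i + p.2) ω < 0} / (2 * p.2) ^ Fintype.card ι)
      (𝓝 x ×ˢ 𝓝[>] 0)
      (𝓝 (∫ v, (∏ i, |v i|) * gaussianDensity
        (Matrix.gram ℝ (Sum.elim (fun i => hf.curve (x i)) (fun i => F' (x i))))
        (Sum.elim (0 : ι → ℝ) v))) := by
  set l : Filter ((ι → ℝ) × ℝ) := 𝓝 x ×ˢ 𝓝[>] 0 with hl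
  set F := hf.curve with hF
  -- The rows produce the mean and the slope of the process between `p.1 i - p.2` and `p.1 i + p.2`.
  -- They converge in `L²` to the value and the derivative at `x i`, whose Gram matrix is
  -- invertible, although the two evaluation points merge. Letting the centers move as well makes
  -- the limit uniform near `x`.
  set a : (ι → ℝ) × ℝ → ι ⊕ ι → ι ⊕ ι → ℝ := fun p =>
    Sum.elim (fun i => Sum.elim (Pi.single i (1 / 2)) (Pi.single i (1 / 2)))
      (fun i => Sum.elim (Pi.single i (2 * p.2)⁻¹) (Pi.single i (-(2 * p.2)⁻¹))) with ha
  set t : (ι → ℝ) × ℝ → ι ⊕ ι → ℝ := fun p =>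
    Sum.elim (fun i => p.1 i + p.2) (fun i => p.1 i - p.2) with ht
  have hdir : Tendsto (fun p : (ι → ℝ) × ℝ => p.2) l (𝓝[>] 0) := tendsto_snd
  have hdir0 : Tendsto (fun p : (ι → ℝ) × ℝ => p.2) l (𝓝 0) := hdir.mono_right nhdsWithin_le_nhds
  have hpos : ∀ᶠ p in l, 0 < p.2 := hdir.eventually self_mem_nhdsWithin
  have hpt : ∀ i, Tendsto (fun p : (ι → ℝ) × ℝ => p.1 i) l (𝓝 (x i)) := fun i =>
    (tendsto_pi_nhds.1 (tendsto_fst (f := 𝓝 x) (g := 𝓝[>] (0 : ℝ)))) i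
  have hplus : ∀ i, Tendsto (fun p : (ι → ℝ) × ℝ => p.1 i + p.2) l (𝓝 (x i)) := fun i => by
    simpa using (hpt i).add hdir0
  have hminus : ∀ i, Tendsto (fun p : (ι → ℝ) × ℝ => p.1 i - p.2) l (𝓝 (x i)) := fun i => by
    simpa using (hpt i).sub hdir0
  have hcont : ∀ s, ContinuousAt F s := fun s => (hF' s).hasDerivAt.continuousAt
  have hvec : ∀ i, Tendsto (fun p => ∑ j, a p i j • F (t p j)) l
      (𝓝 (Sum.elim (fun i => F (x i)) (fun i => F' (x i)) i)) := by
    rintro (i | i)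
    · have h1 := (((hcont (x i)).tendsto.comp (hplus i)).const_smul (1 / 2 : ℝ)).add
        (((hcont (x i)).tendsto.comp (hminus i)).const_smul (1 / 2 : ℝ))
      rw [← add_smul, add_halves, one_smul] at h1
      refine h1.congr fun p => ?_
      simp [ha, ht, Fintype.sum_sum_type, Pi.single_apply, ite_smul]
    · have h1 : Tendsto (fun p : (ι → ℝ) × ℝ => (p.1 i + p.2, p.1 i - p.2)) l
          (𝓝[{p | p.1 ≠ p.2}] (x i, x i)) := by
        refine tendsto_nhdsWithin_iff.2 ⟨(hplus i).prodMk_nhds (hminus i), ?_⟩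
        filter_upwards [hpos] with p hp h2
        have h3 : p.1 i + p.2 = p.1 i - p.2 := h2
        linarith
      refine ((hF' (x i)).tendsto_slope_prod.comp h1).congr fun p => ?_
      simp only [Function.comp_apply, ha, ht, Fintype.sum_sum_type, Sum.elim_inr, Sum.elim_inl,
        Pi.single_apply, ite_smul, zero_smul, Finset.sum_ite_eq', Finset.mem_univ, if_true]
      rw [show p.1 i + p.2 - (p.1 i - p.2) = 2 * p.2 by ring, smul_sub, neg_smul, sub_eq_add_neg]
  set S : (ι → ℝ) × ℝ → Matrix (ι ⊕ ι) (ι ⊕ ι) ℝ := fun p =>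
    Matrix.gram ℝ fun i => ∑ j, a p i j • F (t p j) with hS
  have hlim : Tendsto S l
      (𝓝 (Matrix.gram ℝ (Sum.elim (fun i => F (x i)) (fun i => F' (x i))))) :=
    tendsto_pi_nhds.2 fun i => tendsto_pi_nhds.2 fun j => (hvec i).inner (hvec j)
  have hPD := Matrix.posDef_gram_of_linearIndependent hx
  have hpd : ∀ᶠ p in l, (S p).PosDef := by
    have h1 : Tendsto (fun p => (S p).det) l (𝓝 (Matrix.gram ℝ
        (Sum.elim (fun i => F (x i)) (fun i => F' (x i)))).det) :=
      ((Continuous.matrix_det continuous_id).tendsto _).comp hlim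
    filter_upwards [h1.eventually (lt_mem_nhds hPD.det_pos)] with p hp
    exact Matrix.posDef_gram_of_linearIndependent
      (Matrix.det_gram_ne_zero_iff_linearIndependent.1 hp.ne')
  refine (tendsto_integral_indicator_gaussianDensity hlim hpd hPD hdir).congr' ?_
  filter_upwards [hpd, hpos] with p h1 h2
  rw [← hf.measure_combination_mem (a p) (t p) (measurableSet_forall_abs_lt _) h1]
  congr 2
  ext ω
  simp only [mem_ofPred_eq]
  refine forall_congr' fun i => ?_
  rw [← abs_half_add_lt_iff h2]
  simp [ha, ht, Fintype.sum_sum_type, Pi.single_apply, ite_mul]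

/-- The limit of the sign change probabilities is the Kac-Rice density. -/
theorem integral_prod_abs_mul_gaussianDensity_eq_kacRiceDensity {E : Type*}
    [NormedAddCommGroup E] [InnerProductSpace ℝ E] {κ : ℝ → ℝ} {F F' : ℝ → E}
    (hF : ∀ s t, inner ℝ (F s) (F t) = κ (s - t)) (s : Finset ℝ)
    (hx : LinearIndependent ℝ (Sum.elim (fun i : s => F i) (fun i : s => F' i))) :
    ∫ v, (∏ i, |v i|) * gaussianDensity
      (Matrix.gram ℝ (Sum.elim (fun i : s => F i) (fun i : s => F' i)))
        (Sum.elim (0 : s → ℝ) v) = kacRiceDensity κ F F' s := by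
  have h1 : ∀ i : s, ∃ m : s → ℝ,
      F' i = derivResidual F F' s i + ∑ j : s, m j • F j := by
    intro i
    obtain ⟨a, ha⟩ := mem_evalSpan.1 (sub_residual_mem (F := F) (F' := F') s (i : ℝ))
    refine ⟨fun j => a j, ?_⟩
    rw [Finset.sum_coe_sort s fun j => a j • F j]
    rw [← ha]
    abel
  choose m hm using h1
  have hw : ∀ i j : s, inner ℝ (derivResidual F F' s i) (F j) = 0 := fun i j =>
    inner_residual_eq_zero _ (apply_mem_evalSpan j.2)
  have hdet := (Matrix.posDef_gram_of_linearIndependent hx).det_pos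
  rw [gram_sumElim_eq_mul (m := Matrix.of m) hm hw, Matrix.det_mul, Matrix.det_mul,
    Matrix.det_transpose, Matrix.det_fromBlocks_zero₁₂, Matrix.det_fromBlocks_zero₁₂] at hdet
  simp only [Matrix.det_one, one_mul, mul_one] at hdet
  have hG := (Matrix.posSemidef_gram ℝ fun i : s => F i).det_nonneg
  have hW := (Matrix.posSemidef_gram ℝ fun i : s => derivResidual F F' s i).det_nonneg
  have hG' := lt_of_le_of_ne hG fun h => by rw [← h] at hdet; simp at hdet
  have hW' := lt_of_le_of_ne hW fun h => by rw [← h] at hdet; simp at hdet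
  simp_rw [gaussianDensity_gram_sumElim (m := Matrix.of m) hm hw hG' hW']
  have hpd : (residualMatrix F F' s).PosDef := Matrix.posDef_gram_of_linearIndependent
      (Matrix.det_gram_ne_zero_iff_linearIndependent.1 hW'.ne')
  rw [kacRiceDensity, absMoment_eq_integral_density hpd, ← integral_const_mul,
    kernelMatrix_eq_gram hF, Fintype.card_coe]
  refine integral_congr_ae (Eventually.of_forall fun v => ?_)
  simp only [residualMatrix]
  ring

end localLimit

/-! ### Counting zeros by sign changes on a grid. -/

section counting

variable {g : ℝ → ℝ}

/-- The cells of a regular grid of mesh `h` starting at `a` on which `g` changes sign. -/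
noncomputable def signChanges (g : ℝ → ℝ) (a h : ℝ) (n : ℕ) : Finset ℕ :=
  (Finset.range n).filter fun j => g (a + j * h) * g (a + (j + 1) * h) < 0

/-- Each sign change produces a zero in the open cell, the endpoints being excluded since a product
with a zero value is not negative; different cells thus give different zeros. -/
theorem card_signChanges_le (hg : Continuous g) (a : ℝ) {h : ℝ} (hh : 0 < h) (n : ℕ) :
    ((signChanges g a h n).card : ℕ∞) ≤ ({t | g t = 0} ∩ Icc a (a + n * h)).encard := by
  have h1 : ∀ j ∈ signChanges g a h n, ∃ t, g t = 0 ∧ a + j * h < t ∧ t < a + (j + 1) * h := by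
    intro j hj
    have hneg := (Finset.mem_filter.1 hj).2
    have hle : a + j * h ≤ a + (j + 1) * h := by nlinarith
    have h0 : (0 : ℝ) ∈ uIcc (g (a + j * h)) (g (a + (j + 1) * h)) := by
      rw [mem_uIcc]
      rcases mul_neg_iff.1 hneg with h2 | h2
      · exact Or.inr ⟨h2.2.le, h2.1.le⟩
      · exact Or.inl ⟨h2.1.le, h2.2.le⟩
    obtain ⟨t, ht, ht0⟩ := intermediate_value_uIcc hg.continuousOn h0
    rw [uIcc_of_le hle] at ht
    refine ⟨t, ht0, lt_of_le_of_ne ht.1 ?_, lt_of_le_of_ne ht.2 ?_⟩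
    · rintro rfl; rw [ht0] at hneg; simp at hneg
    · rintro rfl; rw [ht0] at hneg; simp at hneg
  choose! ζ hζ0 hζ1 hζ2 using h1
  have hlt : ∀ i ∈ signChanges g a h n, ∀ j ∈ signChanges g a h n, i < j → ζ i < ζ j := by
    intro i hi j hj hij
    have h3 := hζ2 i hi
    have h4 := hζ1 j hj
    have h5 : (i : ℝ) + 1 ≤ j := by exact_mod_cast hij
    nlinarith
  have hinj : InjOn ζ (signChanges g a h n) := by
    intro i hi j hj hij
    rcases lt_trichotomy i j with h3 | h3 | h3
    · exact absurd hij (hlt i hi j hj h3).ne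
    · exact h3
    · exact absurd hij (hlt j hj i hi h3).ne'
  rw [← Finset.card_image_of_injOn hinj, ← Set.encard_coe_eq_coe_finsetCard]
  refine Set.encard_le_encard ?_
  intro t ht
  obtain ⟨j, hj, rfl⟩ := Finset.mem_image.1 (Finset.mem_coe.1 ht)
  refine ⟨hζ0 j hj, ?_, ?_⟩
  · have := hζ1 j hj
    have h3 : 0 ≤ (j : ℝ) * h := by positivity
    linarith
  · have h3 : (j : ℝ) + 1 ≤ n := by
      exact_mod_cast Finset.mem_range.1 (Finset.mem_filter.1 hj).1
    have := hζ2 j hj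
    nlinarith

theorem HasDerivAt.eventually_mul_neg {d t : ℝ} (hd : HasDerivAt g d t) (hne : d ≠ 0)
    (h0 : g t = 0) :
    ∀ᶠ h in 𝓝[>] (0 : ℝ), ∀ u v, t - h ≤ u → u < t → t < v → v ≤ t + h → g u * g v < 0 := by
  have h1 := (hasDerivAt_iff_isLittleO.1 hd).def (half_pos (abs_pos.2 hne))
  obtain ⟨r, hr, hball⟩ := Metric.eventually_nhds_iff.1 h1
  filter_upwards [Ioo_mem_nhdsGT hr] with h hh u v hu1 hu2 hv1 hv2
  have hu := hball (y := u) (by rw [Real.dist_eq, abs_lt]; constructor <;> linarith [hh.2])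
  have hv := hball (y := v) (by rw [Real.dist_eq, abs_lt]; constructor <;> linarith [hh.2])
  simp only [h0, sub_zero, smul_eq_mul, Real.norm_eq_abs] at hu hv
  rw [abs_of_neg (sub_neg.2 hu2)] at hu
  rw [abs_of_pos (sub_pos.2 hv1)] at hv
  have hu' := abs_le.1 hu
  have hv' := abs_le.1 hv
  rcases lt_or_gt_of_ne hne with hd0 | hd0
  · rw [abs_of_neg hd0] at hu' hv'
    have e1 : 0 < g u := by nlinarith
    have e2 : g v < 0 := by nlinarith
    exact mul_neg_of_pos_of_neg e1 e2
  · rw [abs_of_pos hd0] at hu' hv'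
    have e1 : g u < 0 := by nlinarith
    have e2 : 0 < g v := by nlinarith
    exact mul_neg_of_neg_of_pos e1 e2

theorem finite_zeros (hg : Continuous g) {a b : ℝ}
    (hd : ∀ t, g t = 0 → ∃ d, d ≠ 0 ∧ HasDerivAt g d t) : ({t | g t = 0} ∩ Icc a b).Finite := by
  by_contra hinf
  obtain ⟨t, -, ht⟩ := (Set.not_finite.1 hinf).exists_accPt_of_subset_isCompact isCompact_Icc
    inter_subset_right
  rw [accPt_iff_frequently_nhdsNE] at ht
  have ht0 : g t = 0 := by
    by_contra hne
    obtain ⟨y, hy1, hy2⟩ := (ht.and_eventually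
      ((hg.continuousAt.eventually_ne hne).filter_mono nhdsWithin_le_nhds)).exists
    exact hy2 hy1.1
  obtain ⟨d, hd0, hd1⟩ := hd t ht0
  have := hd1.eventually_ne (c := 0) hd0
  obtain ⟨y, hy1, hy2⟩ := (ht.and_eventually this).exists
  exact hy2 hy1.1

/-- There are finitely many zeros, all simple. For a fine mesh the function changes sign across each
zero and has no other zero within one mesh; no grid point being a zero, each zero lies inside its
own cell. -/
theorem eventually_encard_le_card_signChanges (hg : Continuous g) {a b : ℝ} (hab : a < b)
    (hd : ∀ t, g t = 0 → ∃ d, d ≠ 0 ∧ HasDerivAt g d t)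
    (hgrid : ∀ n j : ℕ, g (a + j * ((b - a) / n)) ≠ 0) :
    ∀ᶠ n : ℕ in atTop, ({t | g t = 0} ∩ Icc a b).encard ≤
      (signChanges g a ((b - a) / n) n).card := by
  have hfin := finite_zeros hg (a := a) (b := b) hd
  have hmesh : Tendsto (fun n : ℕ => (b - a) / n) atTop (𝓝[>] 0) := by
    refine tendsto_nhdsWithin_iff.2 ⟨tendsto_const_div_atTop_nhds_zero_nat _, ?_⟩
    filter_upwards [eventually_gt_atTop 0] with n hn
    have : (0 : ℝ) < n := by exact_mod_cast hn
    exact div_pos (sub_pos.2 hab) this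
  have hev : ∀ᶠ n : ℕ in atTop, ∀ t ∈ {t | g t = 0} ∩ Icc a b, ∀ u v, t - (b - a) / n ≤ u →
      u < t → t < v → v ≤ t + (b - a) / n → g u * g v < 0 := by
    rw [eventually_all_finite hfin]
    intro t ht
    obtain ⟨d, hd0, hd1⟩ := hd t ht.1
    exact hmesh.eventually (hd1.eventually_mul_neg hd0 ht.1)
  filter_upwards [hev, eventually_gt_atTop 0] with n hn hn0
  have hn0' : (0 : ℝ) < n := by exact_mod_cast hn0
  set h := (b - a) / n with hh
  have hh0 : 0 < h := div_pos (sub_pos.2 hab) hn0'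
  have hnh : a + n * h = b := by rw [hh]; field_simp; ring
  set J : ℝ → ℕ := fun t => ⌊(t - a) / h⌋₊ with hJ
  have hJ1 : ∀ t ∈ {t | g t = 0} ∩ Icc a b, a + J t * h < t ∧ t < a + (J t + 1) * h := by
    intro t ht
    have h0 : 0 ≤ (t - a) / h := div_nonneg (sub_nonneg.2 ht.2.1) hh0.le
    have h1 := Nat.floor_le h0
    have h2 := Nat.lt_floor_add_one ((t - a) / h)
    rw [le_div_iff₀ hh0] at h1
    rw [div_lt_iff₀ hh0] at h2
    refine ⟨lt_of_le_of_ne (by simp only [hJ]; linarith) fun he => ?_, by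
      simp only [hJ]; linarith⟩
    exact hgrid n (J t) (by rw [← hh, he]; exact ht.1)
  have hmem : ∀ t ∈ {t | g t = 0} ∩ Icc a b, J t ∈ signChanges g a h n := by
    intro t ht
    obtain ⟨h1, h2⟩ := hJ1 t ht
    refine Finset.mem_filter.2 ⟨Finset.mem_range.2 ?_, hn t ht _ _ ?_ h1 h2 ?_⟩
    · have h3 : a + J t * h < a + n * h := by rw [hnh]; exact h1.trans_le ht.2.2
      have h4 : (J t : ℝ) < n := by
        by_contra h5
        rw [not_lt] at h5
        nlinarith
      exact_mod_cast h4
    · linarith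
    · linarith
  have hinj : InjOn J ({t | g t = 0} ∩ Icc a b) := by
    have key : ∀ t ∈ {t | g t = 0} ∩ Icc a b, ∀ t' ∈ {t | g t = 0} ∩ Icc a b, J t = J t' →
        ¬ t < t' := by
      intro t ht t' ht' he hlt
      have h1 := (hJ1 t ht).1
      have h2 := (hJ1 t' ht').2
      rw [← he] at h2
      have h3 := hn t ht (t - h) t' le_rfl (by linarith) hlt (by linarith)
      rw [show g t' = 0 from ht'.1, mul_zero] at h3
      exact lt_irrefl _ h3
    intro t ht t' ht' he
    exact le_antisymm (not_lt.1 (key t' ht' t ht he.symm)) (not_lt.1 (key t ht t' ht' he))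
  rw [← Set.encard_coe_eq_coe_finsetCard, ← hinj.encard_image]
  refine Set.encard_le_encard ?_
  rintro _ ⟨t, ht, rfl⟩
  exact hmem t ht

/-- Near a double zero the function is small compared with the distance, so the grid point just
below it carries a value of order `θ / n`: unexpectedly small for a grid of `n` points. -/
theorem eventually_exists_grid_abs_le {t θ m : ℝ} (hd : HasDerivAt g 0 t) (h0 : g t = 0)
    (hθ : 0 < θ) (ht : t ∈ Ico m (m + 1)) :
    ∀ᶠ n : ℕ in atTop, ∃ j < n, |g (m + j / n)| ≤ θ / n := by
  obtain ⟨r, hr, hball⟩ := Metric.eventually_nhds_iff.1 ((hasDerivAt_iff_isLittleO.1 hd).def hθ)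
  filter_upwards [(tendsto_one_div_atTop_nhds_zero_nat (𝕜 := ℝ)).eventually (gt_mem_nhds hr),
    eventually_gt_atTop 0] with n hn hn0
  have hn0' : (0 : ℝ) < n := by exact_mod_cast hn0
  have hnn : 0 ≤ (t - m) * n := mul_nonneg (sub_nonneg.2 ht.1) hn0'.le
  refine ⟨⌊(t - m) * n⌋₊, ?_, ?_⟩
  · rw [Nat.floor_lt hnn]
    have := ht.2
    nlinarith
  · have h1 := Nat.floor_le hnn
    have h2 := Nat.lt_floor_add_one ((t - m) * n)
    set j : ℝ := (⌊(t - m) * n⌋₊ : ℝ)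
    have h3 : |m + j / n - t| ≤ 1 / n := by
      have e : m + j / n - t = (j - (t - m) * n) / n := by field_simp; ring
      rw [e, abs_div, abs_of_pos hn0']
      gcongr
      rw [abs_le]
      constructor <;> linarith
    have h4 := hball (y := m + j / n) (by rw [Real.dist_eq]; exact h3.trans_lt hn)
    simp only [h0, sub_zero, smul_zero, Real.norm_eq_abs] at h4
    refine h4.trans ?_
    rw [show θ / n = θ * (1 / n) by ring]
    exact mul_le_mul_of_nonneg_left h3 hθ.le

end counting

/-! ### Simplicity of zeros and mean number of tuples of zeros. -/

section zeros

variable {Ω : Type*} [MeasurableSpace Ω] {P : Measure Ω} {k : ℕ} {f : ℝ → Ω → ℝ}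

theorem IsNormalizedStationaryGaussian.measure_abs_le (hf : IsNormalizedStationaryGaussian k f P)
    (t : ℝ) {c : ℝ} (hc : 0 ≤ c) : P {ω | |f t ω| ≤ c} ≤ ENNReal.ofReal c := by
  have hlaw := hf.gaussian.hasGaussianLaw_eval t
  have hvar : Var[f t; P] = 1 := by
    rw [← integral_sq_eq_variance hlaw (hf.centered t)]
    simp_rw [sq]
    rw [hf.integral_mul, sub_self, hf.variance_eq]
  have hmap := hlaw.map_eq_gaussianReal
  rw [hf.centered, hvar, Real.toNNReal_one] at hmap
  have h1 : P {ω | |f t ω| ≤ c} = gaussianReal 0 1 (Icc (-c) c) := by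
    rw [← hmap, Measure.map_apply_of_aemeasurable hlaw.aemeasurable measurableSet_Icc]
    congr 1
    ext ω
    simp [abs_le]
  rw [h1]
  refine (gaussianReal_Icc_le one_ne_zero).trans (ENNReal.ofReal_le_ofReal ?_)
  have : 2 ≤ √(2 * Real.pi * (1 : NNReal)) := by
    rw [Real.le_sqrt (by norm_num) (by positivity)]
    simp
    linarith [Real.pi_gt_three]
  rw [div_le_iff₀ (by linarith)]
  nlinarith

theorem IsNormalizedStationaryGaussian.ae_ne_zero (hf : IsNormalizedStationaryGaussian k f P)
    (t : ℝ) : ∀ᵐ ω ∂P, f t ω ≠ 0 := by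
  have h := hf.measure_abs_le t le_rfl
  rw [ENNReal.ofReal_zero, nonpos_iff_eq_zero] at h
  rw [ae_iff]
  refine measure_mono_null (fun ω hω => ?_) h
  simp only [not_not, mem_ofPred_eq] at hω ⊢
  simp [hω]

/-- Bulinskaya's argument: at each of `n` grid points the value is within `θ / n` of zero with
probability at most `θ / n`, so a double zero has probability at most `θ`, for every `θ > 0`. -/
theorem IsNormalizedStationaryGaussian.measure_double_zero
    (hf : IsNormalizedStationaryGaussian k f P) (m : ℝ) :
    P {ω | ∃ t ∈ Ico m (m + 1), f t ω = 0 ∧ HasDerivAt (fun t => f t ω) 0 t} = 0 := by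
  refine le_antisymm (ENNReal.le_of_forall_pos_le_add fun θ hθ _ => ?_) zero_le
  rw [zero_add]
  have hθ' : (0 : ℝ) < θ := hθ
  set A : ℕ → Set Ω := fun n => {ω | ∃ j < n, |f (m + j / n) ω| ≤ θ / n} with hA
  have hAn : ∀ n, P (A n) ≤ θ := by
    intro n
    rcases Nat.eq_zero_or_pos n with rfl | hn
    · simp [hA]
    have hn' : (0 : ℝ) < n := by exact_mod_cast hn
    have h1 : A n ⊆ ⋃ j ∈ Finset.range n, {ω | |f (m + j / n) ω| ≤ θ / n} := by
      rintro ω ⟨j, hj, h⟩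
      exact mem_biUnion (Finset.mem_coe.2 (Finset.mem_range.2 hj)) h
    refine (measure_mono h1).trans ((measure_biUnion_finset_le _ _).trans ?_)
    refine (Finset.sum_le_sum fun j _ => hf.measure_abs_le _ (by positivity)).trans ?_
    rw [Finset.sum_const, Finset.card_range, nsmul_eq_mul, ← ENNReal.ofReal_natCast,
      ← ENNReal.ofReal_mul hn'.le, mul_div_cancel₀ _ hn'.ne', ENNReal.ofReal_coe_nnreal]
  have hsub : {ω | ∃ t ∈ Ico m (m + 1), f t ω = 0 ∧ HasDerivAt (fun t => f t ω) 0 t} ⊆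
      ⋃ N : ℕ, ⋂ n ≥ N, A n := by
    rintro ω ⟨t, ht, h0, hd⟩
    obtain ⟨N, hN⟩ := eventually_atTop.1 (eventually_exists_grid_abs_le hd h0 hθ' ht)
    exact mem_iUnion.2 ⟨N, mem_iInter₂.2 fun n hn => hN n hn⟩
  refine (measure_mono hsub).trans ?_
  have hmono : Monotone fun N : ℕ => ⋂ n ≥ N, A n := by
    intro a b hab ω hω
    exact mem_iInter₂.2 fun n hn => mem_iInter₂.1 hω n (le_trans hab hn)
  rw [hmono.measure_iUnion]
  exact iSup_le fun N => (measure_mono (iInter₂_subset N le_rfl)).trans (hAn N)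

/-- Almost surely, all the zeros of the process are simple. -/
theorem IsNormalizedStationaryGaussian.ae_simple_zeros
    (hf : IsNormalizedStationaryGaussian k f P) (hk : 1 ≤ k) :
    ∀ᵐ ω ∂P, ∀ t, f t ω = 0 → ∃ d, d ≠ 0 ∧ HasDerivAt (fun t => f t ω) d t := by
  have h1 : ∀ᵐ ω ∂P, ∀ m : ℤ,
      ¬ ∃ t ∈ Ico (m : ℝ) (m + 1), f t ω = 0 ∧ HasDerivAt (fun t => f t ω) 0 t := by
    rw [ae_all_iff]
    intro m
    rw [ae_iff]
    simpa only [not_not] using hf.measure_double_zero m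
  filter_upwards [h1, hf.contDiff] with ω hω hc t ht
  have hd : HasDerivAt (fun t => f t ω) (deriv (fun t => f t ω) t) t :=
    ((hc.differentiable (by exact_mod_cast (by omega : k ≠ 0))) t).hasDerivAt
  refine ⟨_, fun h0 => hω ⌊t⌋ ⟨t, ⟨Int.floor_le t, Int.lt_floor_add_one t⟩, ht, ?_⟩, hd⟩
  rwa [h0] at hd

theorem IsNormalizedStationaryGaussian.nullMeasurableSet_sign_change
    (hf : IsNormalizedStationaryGaussian k f P) {ι : Type*} [Countable ι] (u v : ι → ℝ) :
    NullMeasurableSet {ω | ∀ i, f (u i) ω * f (v i) ω < 0} P := by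
  rw [show {ω | ∀ i, f (u i) ω * f (v i) ω < 0} = ⋂ i, {ω | f (u i) ω * f (v i) ω < 0} by
    ext; simp]
  exact NullMeasurableSet.iInter fun i => nullMeasurableSet_lt
    ((hf.gaussian.aemeasurable _).mul (hf.gaussian.aemeasurable _)) aemeasurable_const

theorem prod_card_signChanges {Ω : Type*} {f : ℝ → Ω → ℝ} {ι : Type*} [Fintype ι] [DecidableEq ι]
    (a : ι → ℝ) (h : ℝ) (n : ℕ) (ω : Ω) : ∏ i, ((signChanges (fun t => f t ω) (a i) h n).card : ℝ≥0∞) =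
      ∑ J ∈ Fintype.piFinset fun _ : ι => Finset.range n,
        {ω | ∀ i, f (a i + J i * h) ω * f (a i + (J i + 1) * h) ω < 0}.indicator 1 ω := by
  have h1 : ∀ i, ((signChanges (fun t => f t ω) (a i) h n).card : ℝ≥0∞) =
      ∑ j ∈ Finset.range n, if f (a i + j * h) ω * f (a i + (j + 1) * h) ω < 0 then 1 else 0 := by
    intro i
    rw [signChanges, Finset.card_filter]
    push_cast
    rfl
  simp_rw [h1]
  rw [Finset.prod_univ_sum]
  refine Finset.sum_congr rfl fun J _ => ?_
  by_cases hJ : ∀ i, f (a i + J i * h) ω * f (a i + (J i + 1) * h) ω < 0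
  · rw [indicator_of_mem (by exact hJ), Finset.prod_congr rfl fun i _ => if_pos (hJ i)]
    simp
  · rw [indicator_of_notMem (by exact hJ)]
    obtain ⟨i, hi⟩ := not_forall.1 hJ
    exact Finset.prod_eq_zero (Finset.mem_univ i) (if_neg hi)

theorem IsNormalizedStationaryGaussian.aemeasurable_prod_card_signChanges
    (hf : IsNormalizedStationaryGaussian k f P) {ι : Type*} [Fintype ι] (a : ι → ℝ) (h : ℝ)
    (n : ℕ) : AEMeasurable
      (fun ω => ∏ i, ((signChanges (fun t => f t ω) (a i) h n).card : ℝ≥0∞)) P := by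
  classical
  simp_rw [prod_card_signChanges]
  exact Finset.aemeasurable_fun_sum _ fun J _ =>
    aemeasurable_const.indicator₀ (hf.nullMeasurableSet_sign_change _ _)

theorem IsNormalizedStationaryGaussian.lintegral_prod_card_signChanges
    (hf : IsNormalizedStationaryGaussian k f P) {ι : Type*} [Fintype ι] [DecidableEq ι]
    (a : ι → ℝ) (h : ℝ) (n : ℕ) :
    ∫⁻ ω, ∏ i, ((signChanges (fun t => f t ω) (a i) h n).card : ℝ≥0∞) ∂P =
      ∑ J ∈ Fintype.piFinset fun _ : ι => Finset.range n,
        P {ω | ∀ i, f (a i + J i * h) ω * f (a i + (J i + 1) * h) ω < 0} := by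
  simp_rw [prod_card_signChanges]
  rw [lintegral_finsetSum' _ fun J _ =>
    (measurable_one.aemeasurable (μ := P)).indicator₀ (hf.nullMeasurableSet_sign_change _ _)]
  exact Finset.sum_congr rfl fun J _ =>
    lintegral_indicator_one₀ (hf.nullMeasurableSet_sign_change _ _)

/-- If all the cell probabilities are close to `R` times the volume of the cells, the mean number
of tuples of zeros in a box is close to `R` times the volume of the box. -/
theorem IsNormalizedStationaryGaussian.lintegral_prod_encard_mem_Icc
    (hf : IsNormalizedStationaryGaussian k f P) (hk : 1 ≤ k) {ι : Type*} [Fintype ι]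
    (x : ι → ℝ) {ε R₁ R₂ : ℝ} (hε : 0 < ε)
    (hcell : ∀ n : ℕ, 0 < n → ∀ y : ι → ℝ, (∀ i, |y i - x i| ≤ ε) →
      R₁ * (2 * (ε / n)) ^ Fintype.card ι ≤
        P.real {ω | ∀ i, f (y i - ε / n) ω * f (y i + ε / n) ω < 0} ∧
      P.real {ω | ∀ i, f (y i - ε / n) ω * f (y i + ε / n) ω < 0} ≤
        R₂ * (2 * (ε / n)) ^ Fintype.card ι) :
    ∫⁻ ω, ∏ i, ((zeroSet f ω ∩ Icc (x i - ε) (x i + ε)).encard : ℝ≥0∞) ∂P ∈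
      Icc (ENNReal.ofReal (R₁ * (2 * ε) ^ Fintype.card ι))
        (ENNReal.ofReal (R₂ * (2 * ε) ^ Fintype.card ι)) := by
  classical
  have hprob := hf.gaussian.isProbabilityMeasure
  set c : ℕ → Ω → ℝ≥0∞ := fun n ω =>
    ∏ i, ((signChanges (fun t => f t ω) (x i - ε) (2 * ε / n) n).card : ℝ≥0∞) with hc
  have hcm : ∀ n, AEMeasurable (c n) P := fun n => hf.aemeasurable_prod_card_signChanges _ _ _
  have hint : ∀ n : ℕ, 0 < n → ∫⁻ ω, c n ω ∂P ∈
      Icc (ENNReal.ofReal (R₁ * (2 * ε) ^ Fintype.card ι))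
        (ENNReal.ofReal (R₂ * (2 * ε) ^ Fintype.card ι)) := by
    intro n hn
    have hn' : (0 : ℝ) < n := by exact_mod_cast hn
    rw [hc, hf.lintegral_prod_card_signChanges]
    have hJ : ∀ J ∈ Fintype.piFinset fun _ : ι => Finset.range n,
        P {ω | ∀ i, f (x i - ε + J i * (2 * ε / n)) ω * f (x i - ε + (J i + 1) * (2 * ε / n)) ω < 0}
          ∈ Icc (ENNReal.ofReal (R₁ * (2 * (ε / n)) ^ Fintype.card ι))
        (ENNReal.ofReal (R₂ * (2 * (ε / n)) ^ Fintype.card ι)) := by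
      intro J hJ
      -- The cell with index `J` is the interval of half-length `ε / n` around this center, which
      -- stays within `ε` of `x`.
      have hy := hcell n hn (fun i => x i - ε + (2 * J i + 1) * (ε / n)) (by
        intro i
        have h1 : (J i : ℝ) + 1 ≤ n := by
          exact_mod_cast Finset.mem_range.1 (Fintype.mem_piFinset.1 hJ i)
        have h2 : (0 : ℝ) ≤ J i := by positivity
        have h3 : n * (ε / n) = ε := by field_simp
        have h4 : 0 < ε / n := by positivity
        rw [abs_le]
        constructor <;> nlinarith)
      have e1 : ∀ i, x i - ε + (2 * J i + 1) * (ε / n) - ε / n = x i - ε + J i * (2 * ε / n) :=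
        fun i => by ring
      have e2 : ∀ i, x i - ε + (2 * J i + 1) * (ε / n) + ε / n =
          x i - ε + (J i + 1) * (2 * ε / n) := fun i => by ring
      simp only [e1, e2] at hy
      rw [mem_Icc, ← ofReal_measureReal]
      exact ⟨ENNReal.ofReal_le_ofReal hy.1, ENNReal.ofReal_le_ofReal hy.2⟩
    have hsum : ∀ R : ℝ, ∑ _J ∈ Fintype.piFinset fun _ : ι => Finset.range n,
        ENNReal.ofReal (R * (2 * (ε / n)) ^ Fintype.card ι) =
          ENNReal.ofReal (R * (2 * ε) ^ Fintype.card ι) := by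
      intro R
      rw [Finset.sum_const, Fintype.card_piFinset, nsmul_eq_mul]
      simp only [Finset.card_range, Finset.prod_const, Finset.card_univ]
      rw [← ENNReal.ofReal_natCast, ← ENNReal.ofReal_mul (by positivity)]
      congr 1
      push_cast
      rw [show 2 * (ε / n) = 2 * ε / n by ring, div_pow]
      field_simp
    rw [mem_Icc, ← hsum R₁, ← hsum R₂]
    exact ⟨Finset.sum_le_sum fun J h => (hJ J h).1, Finset.sum_le_sum fun J h => (hJ J h).2⟩
  have hcont : ∀ᵐ ω ∂P, Continuous fun t => f t ω := hf.contDiff.mono fun ω h => h.continuous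
  constructor
  -- For the lower bound a single cell suffices: a sign change over the whole interval forces a
  -- zero.
  · refine (hint 1 one_pos).1.trans (lintegral_mono_ae ?_)
    filter_upwards [hcont] with ω hω
    refine Finset.prod_le_prod' fun i _ => ?_
    have h1 := card_signChanges_le hω (x i - ε) (h := 2 * ε / (1 : ℕ)) (by simpa using hε) 1
    have h2 := ENat.toENNReal_le.2 h1
    rw [ENat.toENNReal_coe] at h2
    refine h2.trans (le_of_eq ?_)
    congr 4
    push_cast
    ring
  · have hgrid : ∀ᵐ ω ∂P, ∀ i, ∀ n j : ℕ, f (x i - ε + j * (2 * ε / n)) ω ≠ 0 := by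
      simp_rw [ae_all_iff]
      exact fun i n j => hf.ae_ne_zero _
    -- For the upper bound the counts are eventually dominated by the numbers of sign changes, and
    -- Fatou's lemma needs no domination.
    have hle : ∀ᵐ ω ∂P, ∏ i, ((zeroSet f ω ∩ Icc (x i - ε) (x i + ε)).encard : ℝ≥0∞) ≤
        liminf (fun n => c n ω) atTop := by
      filter_upwards [hcont, hgrid, hf.ae_simple_zeros hk] with ω h1 h2 h3
      refine le_liminf_of_le (by isBoundedDefault) ?_
      have h4 : ∀ᶠ n : ℕ in atTop, ∀ i, (zeroSet f ω ∩ Icc (x i - ε) (x i + ε)).encard ≤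
          (signChanges (fun t => f t ω) (x i - ε) (2 * ε / n) n).card := by
        rw [eventually_all]
        intro i
        have e : x i + ε - (x i - ε) = 2 * ε := by ring
        have := eventually_encard_le_card_signChanges h1 (a := x i - ε) (b := x i + ε)
          (by linarith) h3 (by rw [e]; exact h2 i)
        rwa [e] at this
      filter_upwards [h4] with n hn
      refine Finset.prod_le_prod' fun i _ => ?_
      have h5 := ENat.toENNReal_le.2 (hn i)
      rwa [ENat.toENNReal_coe] at h5
    refine (lintegral_mono_ae hle).trans ((lintegral_liminf_le' hcm).trans ?_)
    refine liminf_le_of_frequently_le' (Eventually.frequently ?_)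
    filter_upwards [eventually_gt_atTop 0] with n hn
    exact (hint n hn).2

/-- The limit in the center and the half-length jointly controls all cells of all grids of a small
box at once, so the intensity lies within `θ` of `R`. -/
theorem IsNormalizedStationaryGaussian.tendsto_smallBoxIntensity
    (hf : IsNormalizedStationaryGaussian k f P) (hk : 1 ≤ k) {l : ℕ} (x : Fin l → ℝ) {R : ℝ}
    (hR : Tendsto (fun p : (Fin l → ℝ) × ℝ =>
      P.real {ω | ∀ i, f (p.1 i - p.2) ω * f (p.1 i + p.2) ω < 0} / (2 * p.2) ^ l)
      (𝓝 x ×ˢ 𝓝[>] 0) (𝓝 R)) :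
    Tendsto (smallBoxIntensity P (zeroSet f) x) (𝓝[>] 0) (𝓝 (ENNReal.ofReal R)) := by
  have key : ∀ θ > 0, ∀ᶠ ε in 𝓝[>] (0 : ℝ), smallBoxIntensity P (zeroSet f) x ε ∈
      Icc (ENNReal.ofReal (R - θ)) (ENNReal.ofReal (R + θ)) := by
    intro θ hθ
    have h1 := hR.eventually (Metric.closedBall_mem_nhds R hθ)
    obtain ⟨r, hr, hr'⟩ : ∃ r > 0, ∀ y : Fin l → ℝ, (∀ i, |y i - x i| ≤ r) → ∀ δ, 0 < δ → δ ≤ r →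
        |P.real {ω | ∀ i, f (y i - δ) ω * f (y i + δ) ω < 0} / (2 * δ) ^ l - R| ≤ θ := by
      obtain ⟨u, hu, v, hv, huv⟩ := eventually_prod_iff.1 h1
      obtain ⟨r₁, hr₁, hu⟩ := Metric.eventually_nhds_iff.1 hu
      obtain ⟨r₂, hr₂, hv⟩ := Metric.eventually_nhds_iff.1 (eventually_nhdsWithin_iff.1 hv)
      refine ⟨min r₁ r₂ / 2, by positivity, fun y hy δ hδ hδ' => ?_⟩
      have hm : min r₁ r₂ / 2 < min r₁ r₂ := half_lt_self (lt_min hr₁ hr₂)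
      refine huv (hu ?_) (hv ?_ hδ)
      · refine lt_of_le_of_lt ((dist_pi_le_iff (by positivity)).2 hy)
          (hm.trans_le (min_le_left _ _))
      · rw [Real.dist_eq, sub_zero, abs_of_pos hδ]
        exact hδ'.trans_lt (hm.trans_le (min_le_right _ _))
    filter_upwards [Ioo_mem_nhdsGT hr] with ε hε
    have hε0 := hε.1
    have h2 := hf.lintegral_prod_encard_mem_Icc hk x (R₁ := R - θ) (R₂ := R + θ) hε.1 (by
      intro n hn y hy
      have hn' : (1 : ℝ) ≤ n := by exact_mod_cast hn
      have h3 : 0 < ε / n := by positivity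
      have h4 : ε / n ≤ r := (div_le_self hε0.le hn').trans hε.2.le
      have h5 := abs_le.1 (hr' y (fun i => (hy i).trans hε.2.le) _ h3 h4)
      have h6 : 0 < (2 * (ε / n)) ^ l := by positivity
      rw [Fintype.card_fin, ← le_div_iff₀ h6, ← div_le_iff₀ h6]
      constructor <;> linarith)
    rw [Fintype.card_fin] at h2
    have hp : 0 < (2 * ε) ^ l := by positivity
    have hp' : ENNReal.ofReal ((2 * ε) ^ l) ≠ 0 := by simpa using hp
    rw [smallBoxIntensity, mem_Icc, ENNReal.le_div_iff_mul_le (Or.inl hp')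
      (Or.inl ENNReal.ofReal_ne_top), ENNReal.div_le_iff hp' ENNReal.ofReal_ne_top,
      ← ENNReal.ofReal_mul' hp.le, ← ENNReal.ofReal_mul' hp.le]
    exact h2
  rw [ENNReal.tendsto_nhds ENNReal.ofReal_ne_top]
  intro θ hθ
  -- Truncation at `1` keeps an extended tolerance finite.
  have hm0 : min θ 1 ≠ 0 := (lt_min hθ one_pos).ne'
  have hmt : min θ 1 ≠ ∞ := ne_top_of_le_ne_top ENNReal.one_ne_top (min_le_right _ _)
  filter_upwards [key (min θ 1).toReal (ENNReal.toReal_pos hm0 hmt)] with ε hε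
  rw [ENNReal.ofReal_sub _ ENNReal.toReal_nonneg, ENNReal.ofReal_toReal hmt] at hε
  refine ⟨(tsub_le_tsub_left (min_le_left _ _) _).trans hε.1, hε.2.trans ?_⟩
  refine ENNReal.ofReal_add_le.trans ?_
  rw [ENNReal.ofReal_toReal hmt]
  exact add_le_add_right (min_le_left _ _) _

end zeros

/-! ### Configurations, partitions and conclusion. -/

/-- One product orders the pairs by the points, the other by their indices. Their squares are both
products over ordered pairs, so the orderings disappear. -/
theorem truncatedVandermonde_image {k : ℕ} (x : Fin k → ℝ) (hx : Function.Injective x) :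
    truncatedVandermonde (Finset.univ.image x) = ∏ i, ∏ j ∈ Finset.Ioi i, min |x i - x j| 1 := by
  have hpos : 0 < ∏ i, ∏ j ∈ Finset.Ioi i, min |x i - x j| 1 :=
    Finset.prod_pos fun i _ => Finset.prod_pos fun j hj =>
      lt_min (abs_pos.2 (sub_ne_zero.2 (hx.ne (Finset.mem_Ioi.1 hj).ne))) one_pos
  have h1 := Finset.prod_prod_Ioi_mul_eq_prod_prod_off_diag
    (fun i j : Fin k => min |x j - x i| 1)
  have h2 : ∏ i, ∏ j ∈ Finset.Ioi i, (min |x i - x j| 1 * min |x j - x i| 1) =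
      (∏ i, ∏ j ∈ Finset.Ioi i, min |x i - x j| 1) ^ 2 := by
    simp_rw [Finset.prod_mul_distrib, sq]
    congr 1
    refine Finset.prod_congr rfl fun i _ => Finset.prod_congr rfl fun j _ => ?_
    rw [abs_sub_comm]
  have h3 : truncatedVandermonde (Finset.univ.image x) ^ 2 =
      (∏ i, ∏ j ∈ Finset.Ioi i, min |x i - x j| 1) ^ 2 := by
    rw [← h2, ← prod_prod_erase_eq_truncatedVandermonde_sq, h1,
      Finset.prod_image fun i _ j _ h => hx h]
    refine Finset.prod_congr rfl fun i _ => ?_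
    have e : (Finset.univ.image x).erase (x i) = ({i}ᶜ : Finset (Fin k)).image x := by
      ext y
      simp only [Finset.mem_erase, Finset.mem_image, Finset.mem_univ, true_and,
        Finset.mem_compl, Finset.mem_singleton]
      constructor
      · rintro ⟨hy, j, rfl⟩
        exact ⟨j, fun h => hy (by rw [h]), rfl⟩
      · rintro ⟨j, hj, rfl⟩
        exact ⟨hx.ne hj, j, rfl⟩
    rw [e, Finset.prod_image fun i _ j _ h => hx h]
  exact (pow_left_inj₀ (truncatedVandermonde_pos _).le hpos.le two_ne_zero).1 h3

theorem image_subfamily {k : ℕ} (x : Fin k → ℝ) (I : Finset (Fin k)) :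
    Finset.univ.image (subfamily x I) = I.image x := by
  have : subfamily x I = x ∘ I.orderEmbOfFin rfl := rfl
  rw [this, ← Finset.image_image, Finset.image_orderEmbOfFin_univ]

theorem subfamily_injective {k : ℕ} {x : Fin k → ℝ} (hx : Function.Injective x)
    (I : Finset (Fin k)) : Function.Injective (subfamily x I) :=
  hx.comp (I.orderEmbOfFin rfl).injective

section partition

variable {α : Type*} [Fintype α] [LinearOrder α]

/-- The least index serves as the label of a block: the block determinant formula requires linearly
ordered labels. -/
theorem Finpartition.eq_of_min_eq (𝓘 : Finpartition (Finset.univ : Finset α)) {I J : Finset α}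
    (hI : I ∈ 𝓘.parts) (hJ : J ∈ 𝓘.parts) (h : I.min = J.min) : I = J := by
  obtain ⟨a, ha⟩ := Finset.min_of_nonempty (𝓘.nonempty_of_mem_parts hI)
  exact 𝓘.eq_of_mem_parts hI hJ (Finset.mem_of_min ha) (Finset.mem_of_min (h ▸ ha))

/-- A function of the blocks of a partition of an index set, written in terms of labels of the
indexed points. -/
theorem Finpartition.prod_image_eq_prod_filter (𝓘 : Finpartition (Finset.univ : Finset α))
    {β M : Type*} [DecidableEq β] [CommMonoid M] {x : α → β}
    {b : β → WithTop α} (hb : ∀ i, b (x i) = (𝓘.part i).min) (g : Finset β → M) :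
    ∏ c ∈ (Finset.univ.image x).image b, g ((Finset.univ.image x).filter (b · = c)) =
      ∏ I ∈ 𝓘.parts, g (I.image x) := by
  have h1 : (Finset.univ.image x).image b = 𝓘.parts.image Finset.min := by
    ext c
    simp only [Finset.mem_image, Finset.mem_univ, true_and, exists_exists_eq_and]
    constructor
    · rintro ⟨i, rfl⟩
      exact ⟨𝓘.part i, 𝓘.part_mem.2 (Finset.mem_univ i), (hb i).symm⟩
    · rintro ⟨I, hI, rfl⟩
      obtain ⟨i, hi⟩ := 𝓘.nonempty_of_mem_parts hI
      exact ⟨i, by rw [hb, 𝓘.part_eq_of_mem hI hi]⟩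
  rw [h1, Finset.prod_image fun I hI J hJ h => 𝓘.eq_of_min_eq hI hJ h]
  refine Finset.prod_congr rfl fun I hI => ?_
  congr 1
  ext y
  simp only [Finset.mem_filter, Finset.mem_image, Finset.mem_univ, true_and]
  constructor
  · rintro ⟨⟨i, rfl⟩, h⟩
    rw [hb] at h
    have hi := 𝓘.part_mem.2 (Finset.mem_univ i)
    refine ⟨i, ?_, rfl⟩
    rw [← 𝓘.eq_of_min_eq hi hI h]
    exact 𝓘.mem_part (Finset.mem_univ i)
  · rintro ⟨i, hi, rfl⟩
    exact ⟨⟨i, rfl⟩, by rw [hb, 𝓘.part_eq_of_mem hI hi]⟩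

end partition

section main

variable {Ω : Type*} [MeasurableSpace Ω] {P : Measure Ω} {k : ℕ} {f : ℝ → Ω → ℝ}

/-- The moments of the spectral measure bound the derivatives of `κ`; only then does `ckNorm`
dominate them and turn its decay into pointwise decay up to order `k`. -/
theorem IsNormalizedStationaryGaussian.exists_nondegenerateCurve
    (hf : IsNormalizedStationaryGaussian k f P) (hk : 1 ≤ k)
    (hκ : Tendsto (fun η => ckNorm (correlationFunction f P) k η) atTop (𝓝 0)) :
    ∃ F' : ℝ → Lp ℝ 2 P, NondegenerateCurve k (correlationFunction f P) hf.curve F' ∧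
      ∀ s : Finset ℝ, LinearIndependent ℝ
        (Sum.elim (fun i : s => hf.curve i) (fun i : s => F' i)) := by
  obtain ⟨μ, hμ⟩ := hf.exists_spectral_measure hk
  choose F' hF' using hf.exists_hasStrictDerivAt_curve hk
  have hm := hf.memLp_spectral hμ
  obtain ⟨B, -, hB⟩ := exists_bound_iteratedDeriv hμ hm
  have hdec : ∀ j ≤ k,
      Tendsto (iteratedDeriv j (correlationFunction f P)) (Bornology.cobounded ℝ) (𝓝 0) := by
    intro j hj
    refine squeeze_zero_norm (fun t => ?_) (hκ.comp tendsto_norm_cobounded_atTop)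
    exact abs_iteratedDeriv_le_ckNorm ⟨B, fun i hi => hB i (by omega)⟩ hj le_rfl
  have h0 : Tendsto (correlationFunction f P) atTop (𝓝 0) := by
    have := (hdec 0 (Nat.zero_le k)).mono_left IsOrderBornology.atTop_le_cobounded
    rwa [iteratedDeriv_zero] at this
  exact ⟨F', nondegenerateCurve_of_spectral hμ hm hdec hf.inner_curve hF', fun s =>
    linearIndependent_jets hμ h0 hk hm hf.inner_curve hF' (fun i : s => (i : ℝ))
      Subtype.val_injective⟩

/-- The Kac-Rice formula. -/
theorem IsNormalizedStationaryGaussian.tendsto_smallBoxIntensity_kacRiceDensity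
    (hf : IsNormalizedStationaryGaussian k f P) (hk : 1 ≤ k) {F' : ℝ → Lp ℝ 2 P}
    (h : NondegenerateCurve k (correlationFunction f P) hf.curve F')
    (hli : ∀ s : Finset ℝ, LinearIndependent ℝ
        (Sum.elim (fun i : s => hf.curve i) (fun i : s => F' i)))
    {l : ℕ} (x : Fin l → ℝ) (hx : Function.Injective x) :
    Tendsto (smallBoxIntensity P (zeroSet f) x) (𝓝[>] 0) (𝓝 (ENNReal.ofReal
      (kacRiceDensity (correlationFunction f P) hf.curve F' (Finset.univ.image x)))) := by
  refine hf.tendsto_smallBoxIntensity hk x ?_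
  set s := Finset.univ.image x with hs
  have hscard : s.card = l := by rw [hs, Finset.card_image_of_injective _ hx]; simp
  have hxs : ∀ i, x i ∈ s := fun i => Finset.mem_image_of_mem x (Finset.mem_univ i)
  have hinv : ∀ y : s, ∃ i, x i = y := fun y => by
    obtain ⟨i, -, hi⟩ := Finset.mem_image.1 y.2
    exact ⟨i, hi⟩
  choose e he using hinv
  have he' : ∀ i, e ⟨x i, hxs i⟩ = i := fun i => hx (he ⟨x i, hxs i⟩)
  have h1 := hf.tendsto_measure_sign_change h.hasStrictDerivAt (fun i : s => (i : ℝ)) (hli s)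
  rw [integral_prod_abs_mul_gaussianDensity_eq_kacRiceDensity h.inner_eq s (hli s),
    Fintype.card_coe, hscard] at h1
  have h2 : Tendsto (fun p : (Fin l → ℝ) × ℝ => ((fun i : s => p.1 (e i)), p.2))
      (𝓝 x ×ˢ 𝓝[>] 0) (𝓝 (fun i : s => (i : ℝ)) ×ˢ 𝓝[>] 0) := by
    refine Tendsto.prodMk (tendsto_pi_nhds.2 fun i => ?_) tendsto_snd
    have h3 := (tendsto_pi_nhds.1 (tendsto_fst (f := 𝓝 x) (g := 𝓝[>] (0 : ℝ)))) (e i)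
    rwa [he] at h3
  refine (h1.comp h2).congr fun p => ?_
  simp only [Function.comp_apply]
  congr 3
  ext ω
  exact ⟨fun h i => by simpa only [he'] using h ⟨x i, hxs i⟩, fun h i => h (e i)⟩

end main

theorem theorem1p10 {Ω : Type*} [MeasurableSpace Ω] (P : Measure Ω) (f : ℝ → Ω → ℝ)
    (k : ℕ) (hk : 1 ≤ k) (hf : IsNormalizedStationaryGaussian k f P)
    (hκ : Tendsto (fun η => ckNorm (correlationFunction f P) k η) atTop (𝓝 0)) :
    -- the `l`-point functions, `1 ≤ l ≤ k`, are well-defined off the large diagonal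
    (∀ l : ℕ, 1 ≤ l → l ≤ k → ∀ x : Fin l → ℝ, Function.Injective x →
      HasPointFunctionAt P (zeroSet f) x) ∧
    -- short-range repulsion and boundedness
    (∃ C : ℝ, 0 < C ∧ ∀ x : Fin k → ℝ, Function.Injective x →
      0 ≤ pointFunction P (zeroSet f) x ∧
      pointFunction P (zeroSet f) x ≤ C * ∏ i, ∏ j ∈ Finset.Ioi i, min |x i - x j| 1) ∧
    -- clustering
    (∃ C : ℝ, 0 < C ∧ ∀ η : ℝ, 1 ≤ η → ∀ 𝓘 : Finpartition (Finset.univ : Finset (Fin k)),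
      ∀ x : Fin k → ℝ, Function.Injective x →
      (∀ I ∈ 𝓘.parts, ∀ J ∈ 𝓘.parts, I ≠ J → ∀ i ∈ I, ∀ j ∈ J, η < |x i - x j|) →
      ∃ e : ℝ, |e| ≤ C * √(ckNorm (correlationFunction f P) k η) ∧
        ∏ I ∈ 𝓘.parts, pointFunction P (zeroSet f) (subfamily x I)
          = pointFunction P (zeroSet f) x * (1 + e)) := by
  obtain ⟨F', h, hli⟩ := hf.exists_nondegenerateCurve hk hκ
  obtain ⟨c, C, hc, hC, hb⟩ := h.exists_kacRiceDensity_bounds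
  have hlim : ∀ {l : ℕ} (x : Fin l → ℝ), Function.Injective x →
      Tendsto (smallBoxIntensity P (zeroSet f) x) (𝓝[>] 0) (𝓝 (ENNReal.ofReal
        (kacRiceDensity (correlationFunction f P) hf.curve F' (Finset.univ.image x)))) :=
    fun x hx => hf.tendsto_smallBoxIntensity_kacRiceDensity hk h hli x hx
  have hval : ∀ {l : ℕ} (x : Fin l → ℝ), Function.Injective x → l ≤ k →
      pointFunction P (zeroSet f) x =
        kacRiceDensity (correlationFunction f P) hf.curve F' (Finset.univ.image x) := by
    intro l x hx hl
    have hcard : (Finset.univ.image x).card ≤ k :=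
      Finset.card_image_le.trans (by simpa using hl)
    rw [pointFunction, (hlim x hx).limUnder_eq, ENNReal.toReal_ofReal]
    exact (mul_pos hc (truncatedVandermonde_pos _)).le.trans (hb _ hcard).1
  refine ⟨fun l _ _ x hx => ⟨_, ENNReal.ofReal_ne_top, hlim x hx⟩, ⟨C, hC, fun x hx =>
    ⟨ENNReal.toReal_nonneg, ?_⟩⟩, ?_⟩
  · rw [hval x hx le_rfl, ← truncatedVandermonde_image x hx]
    exact (hb _ (Finset.card_image_le.trans (by simp))).2
  · obtain ⟨C', hC', hcl⟩ := h.exists_cluster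
    refine ⟨C', hC', fun η hη 𝓘 x hx hsep => ?_⟩
    have hne : Nonempty (Fin k) := ⟨⟨0, hk⟩⟩
    -- A point is labelled by the block of its index, recovered by the inverse of `x`; labels of
    -- other reals play no role.
    set b : ℝ → WithTop (Fin k) := fun y => (𝓘.part (Function.invFun x y)).min with hbdef
    have hbx : ∀ i, b (x i) = (𝓘.part i).min := fun i => by
      rw [hbdef]
      simp only [Function.leftInverse_invFun hx i]
    obtain ⟨e, he, heq⟩ := hcl η (WithTop (Fin k)) (Finset.univ.image x) b hη
      (by rw [Finset.card_image_of_injective _ hx]; simp) (by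
        intro y hy z hz hyz
        obtain ⟨i, -, rfl⟩ := Finset.mem_image.1 hy
        obtain ⟨j, -, rfl⟩ := Finset.mem_image.1 hz
        refine hsep _ (𝓘.part_mem.2 (Finset.mem_univ i)) _ (𝓘.part_mem.2 (Finset.mem_univ j))
          (fun hij => hyz ?_) i (𝓘.mem_part (Finset.mem_univ i)) j
            (𝓘.mem_part (Finset.mem_univ j))
        rw [hbx, hbx, hij])
    refine ⟨e, he, ?_⟩
    rw [hval x hx le_rfl, ← heq, 𝓘.prod_image_eq_prod_filter hbx]
    refine Finset.prod_congr rfl fun I _ => ?_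
    rw [hval _ (subfamily_injective hx I) (by simpa using Finset.card_le_univ I),
      image_subfamily]
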